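/- **Setting.** Let $f$ be a real, jointly measurable, statistically homogeneous random field (all finite-dimensional laws are translation invariant) with zero mean and finite moments of all orders on the box with periods $L_1,\dots,L_d$ and volume $V=L_1\cdots L_d$. For wavevectors $\mathbf k=(2\pi n_i/L_i)_i$, $n\in\mathbb Z^d$, put $f_{\mathbf k}=V^{-1/2}\int f(x)e^{-i\mathbf k\cdot x}dx$, $P(\mathbf k)=\langle|f_{\mathbf k}|^2\rangle$ and $\alpha_{\mathbf k}=f_{\mathbf k}/\sqrt{P(\mathbf k)}$, so that $\alpha_{-\mathbf k}=\overline{\alpha_{\mathbf k}}$. With $\langle\cdots\rangle_c$ denoting joint cumulants, the polyspectra $P^{(N)}$ are defined, for $\mathbf k_1+\dots+\mathbf k_N=0$, by $\langle f_{\mathbf k_1}\cdots f_{\mathbf k_N}\rangle_c=V^{1-N/2}P^{(N)}(\mathbf k_1,\dots,\mathbf k_N)$, and the normalized polyspectra by $p^{(N)}(\mathbf k_1,\dots,\mathbf k_N)=P^{(N)}(\mathbf k_1,\dots,\mathbf k_N)/\sqrt{P(\mathbf k_1)\cdots P(\mathbf k_N)}$ if $\mathbf k_1+\dots+\mathbf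 k_N=0$ and $p^{(N)}=0$ otherwise. Let "uhs" be an upper half of Fourier space (closed under addition, not containing $0$, containing one of $\pm\mathbf k$ for each $\mathbf k\ne0$), let $U\subset$ uhs be a finite set of modes with $P(\mathbf k)>0$ for $\mathbf k\in U$, and write $\alpha_{\mathbf k}=a_{\mathbf k}+ib_{\mathbf k}$ for $\mathbf k\in U$. All sums below run over $U$ ("uhs") or $U\cup(-U)$ ("both"). For real numbers $K_{\mathbf k},L_{\mathbf k}$ put $X=\sum_{\mathbf k\in U}(K_{\mathbf k}a_{\mathbf k}+L_{\mathbf k}b_{\mathbf k})$. The *formal joint density* $\mathcal P=\sum_{n\ge0}V^{-n/2}\rho_n$ of $(\alpha_{\mathbf k})_{\mathbf k\in U}$ with respect to $\prod da_{\mathbf k}\,db_{\mathbf k}$ is the inverse Fourier transform $$\int\prod_{\mathbf k\in U}\frac{dK_{\mathbf k}\,dL_{\mathbf k}}{(2\pi)^2}\;e^{iX}\exp\Bigl(\sum_{N\ge2}\frac{(-i)^N}{N!}\langle X^N\rangle_c\Bigr)$$ (in the factor $e^{iX}$ the $a_{\mathbf k},b_{\mathbf k}$ are the arguments of $\mathcal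 P$), where $\exp(\sum_{N\ge3})$ is expanded as a formal power series in $V^{-1/2}$, the $N$-th term being assigned order $V^{-(N-2)/2}$ with coefficient $\frac{(-i)^N}{N!}V^{N/2-1}\langle X^N\rangle_c$, and the integral is taken coefficient by coefficient. Let $\mathcal P_G=\prod_{\mathbf k\in U}\pi^{-1}e^{-\alpha_{-\mathbf k}\alpha_{\mathbf k}}$ and let $$H_{\mathbf k_1\cdots\mathbf k_n}=\frac{(-1)^n}{\mathcal P_G}\frac{\partial}{\partial\alpha_{\mathbf k_1}}\cdots\frac{\partial}{\partial\alpha_{\mathbf k_n}}\mathcal P_G,\qquad \frac{\partial}{\partial\alpha_{\pm\mathbf k}}=\tfrac12\Bigl(\frac{\partial}{\partial a_{\mathbf k}}\mp i\frac{\partial}{\partial b_{\mathbf k}}\Bigr)\quad(\mathbf k\in U)$$ be the generalized Hermite polynomials. **(1) Expansion to all orders.** The integrals defining the $\rho_n$ converge absolutely, $\rho_0=\mathcal P_G$, and for $n\ge1$ $$\rho_n=\Biggl[\sum_{m\ge1}\frac1{m!}\sum_{\substack{n_1,\dots,n_m\ge1\\n_1+\dots+n_m=n}}\ \prod_{j=1}^m\frac1{(n_j+2)!}\sum^{\rm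 both}_{\mathbf k^{(1)}_1,\dots,\mathbf k^{(1)}_{n_1+2}}\cdots\sum^{\rm both}_{\mathbf k^{(m)}_1,\dots,\mathbf k^{(m)}_{n_m+2}}\ \prod_{j=1}^m p^{(n_j+2)}(\mathbf k^{(j)}_1,\dots,\mathbf k^{(j)}_{n_j+2})\;H_{\mathbf k^{(1)}_1\cdots\mathbf k^{(1)}_{n_1+2}\cdots\mathbf k^{(m)}_1\cdots\mathbf k^{(m)}_{n_m+2}}\Biggr]\mathcal P_G .$$ **(2) Relation to the law of the modes.** For every polynomial $q$ in the variables $\alpha_{\mathbf k}$, $\mathbf k\in U\cup(-U)$, and every $M\ge\deg q$, $$\langle q(\alpha)\rangle=\sum_{n=0}^{M}V^{-n/2}\int q\,\rho_n\prod_{\mathbf k\in U}da_{\mathbf k}\,db_{\mathbf k},$$ the expectation and all integrals being absolutely convergent. **(3) Explicit form up to $V^{-1}$.** Suppose $p^{(N)}(-\mathbf k_1,\dots,-\mathbf k_N)=p^{(N)}(\mathbf k_1,\dots,\mathbf k_N)$ for $N=3,4$ and $\mathbf k_j\in U\cup(-U)$. Write $\alpha_{\mathbf k}=A_{\mathbf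 k}e^{i\theta_{\mathbf k}}$ with $A_{\mathbf k}\ge0$ for $\mathbf k\in U$. Then $$\frac{\mathcal P}{\mathcal P_G}=1+\frac1{\sqrt V}\sum_{i=1}^2\mathcal Q^{(1)}_i+\frac1V\sum_{i=1}^{22}\mathcal Q^{(2)}_i+\mathcal O(V^{-3/2}),$$ that is, $\rho_1=\sum_i\mathcal Q^{(1)}_i\mathcal P_G$ and $\rho_2=\sum_i\mathcal Q^{(2)}_i\mathcal P_G$. Moreover, for each number of modes, each polynomial $q$ in the corresponding variables and each $B$ there is a constant $C$ such that, for all such fields (on boxes of the given dimension) and modes with $V\ge1$ and $|p^{(N)}|\le B$ on $U\cup(-U)$ for $3\le N\le\deg q$, $$\Bigl|\langle q(\alpha)\rangle-\int q\,\Bigl[1+V^{-1/2}\sum_i\mathcal Q^{(1)}_i+V^{-1}\sum_i\mathcal Q^{(2)}_i\Bigr]\mathcal P_G\prod_{\mathbf k\in U}da_{\mathbf k}\,db_{\mathbf k}\Bigr|\le C\,V^{-3/2}.$$ Here, writing $A_j=A_{\mathbf k_j}$, $\theta_j=\theta_{\mathbf k_j}$, $p^{(N)}(\pm a,\pm b,\dots)=p^{(N)}(\pm\mathbf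 k_a,\pm\mathbf k_b,\dots)$, and $\sum'_r$ for the sum over all ordered $r$-tuples $(\mathbf k_1,\dots,\mathbf k_r)$ of mutually different modes of $U$, - $\mathcal Q^{(1)}_1=\sum'_2A_1^2A_2\cos(2\theta_1-\theta_2)\,p^{(3)}(1,1,-2)$ - $\mathcal Q^{(1)}_2=\sum'_3A_1A_2A_3\cos(\theta_1+\theta_2-\theta_3)\,p^{(3)}(1,2,-3)$ - $\mathcal Q^{(2)}_1=\sum'_1(\frac14A_1^4-A_1^2+\frac12)\,p^{(4)}(1,1,-1,-1)$ - $\mathcal Q^{(2)}_2=\sum'_2\frac12(A_1^2A_2^2-A_1^2-A_2^2+1)\,p^{(4)}(1,2,-1,-2)$ - $\mathcal Q^{(2)}_3=\sum'_2\frac13A_1^3A_2\cos(3\theta_1-\theta_2)\,p^{(4)}(1,1,1,-2)$ - $\mathcal Q^{(2)}_4=\sum'_3A_1^2A_2A_3\cos(2\theta_1+\theta_2-\theta_3)\,p^{(4)}(1,1,2,-3)$ - $\mathcal Q^{(2)}_5=\sum'_3\frac12A_1^2A_2A_3\cos(2\theta_1-\theta_2-\theta_3)\,p^{(4)}(1,1,-2,-3)$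 - $\mathcal Q^{(2)}_6=\sum'_4\frac13A_1A_2A_3A_4\cos(\theta_1+\theta_2+\theta_3-\theta_4)\,p^{(4)}(1,2,3,-4)$ - $\mathcal Q^{(2)}_7=\sum'_4\frac14A_1A_2A_3A_4\cos(\theta_1+\theta_2-\theta_3-\theta_4)\,p^{(4)}(1,2,-3,-4)$ - $\mathcal Q^{(2)}_8=\sum'_2[\frac12A_1^4A_2^2\cos^2(2\theta_1-\theta_2)-A_1^2A_2^2-\frac14A_1^4+A_1^2+\frac12A_2^2-\frac12]\,[p^{(3)}(1,1,-2)]^2$ - $\mathcal Q^{(2)}_9=\sum'_3[A_1^2A_2^2A_3^2\cos^2(\theta_1+\theta_2-\theta_3)-\frac12(A_1^2A_2^2+A_1^2A_3^2+A_2^2A_3^2-A_1^2-A_2^2-A_3^2+1)]\,[p^{(3)}(1,2,-3)]^2$ - $\mathcal Q^{(2)}_{10}=\sum'_3[A_1^2A_2^3A_3\cos(2\theta_1-\theta_2)\cos(2\theta_2-\theta_3)-A_1^2A_2A_3\cos(2\theta_1+\theta_2-\theta_3)]\,p^{(3)}(1,1,-2)p^{(3)}(2,2,-3)$ - $\mathcal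 Q^{(2)}_{11}=\sum'_3[2A_1^3A_2^2A_3\cos(2\theta_1-\theta_2)\cos(\theta_1+\theta_2-\theta_3)-A_1^3A_3\cos(3\theta_1-\theta_3)-2A_1A_2^2A_3\cos(\theta_1-2\theta_2+\theta_3)]\,p^{(3)}(1,1,-2)p^{(3)}(1,2,-3)$ - $\mathcal Q^{(2)}_{12}=\sum'_4\frac12A_1^2A_2^2A_3A_4\cos(2\theta_1-\theta_3)\cos(2\theta_2-\theta_4)\,p^{(3)}(1,1,-3)p^{(3)}(2,2,-4)$ - $\mathcal Q^{(2)}_{13}=\sum'_4[2A_1^3A_2A_3A_4\cos(2\theta_1-\theta_3)\cos(\theta_1-\theta_2+\theta_4)-2A_1A_2A_3A_4\cos(\theta_1+\theta_2-\theta_3-\theta_4)]\,p^{(3)}(1,1,-3)p^{(3)}(1,-2,4)$ - $\mathcal Q^{(2)}_{14}=\sum'_4[A_1^3A_2A_3A_4\cos(2\theta_1-\theta_4)\cos(\theta_1-\theta_2-\theta_3)-A_1A_2A_3A_4\cos(\theta_1+\theta_2+\theta_3-\theta_4)]\,p^{(3)}(1,1,-4)p^{(3)}(-1,2,3)$ -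 $\mathcal Q^{(2)}_{15}=\sum'_4[2A_1^2A_2A_3A_4^2\cos(2\theta_1-\theta_4)\cos(\theta_2-\theta_3+\theta_4)-A_1^2A_2A_3\cos(2\theta_1+\theta_2-\theta_3)]\,p^{(3)}(1,1,-4)p^{(3)}(2,-3,4)$ - $\mathcal Q^{(2)}_{16}=\sum'_4[A_1^2A_2A_3A_4^2\cos(2\theta_1-\theta_4)\cos(\theta_2+\theta_3-\theta_4)-\frac12A_1^2A_2A_3\cos(2\theta_1-\theta_2-\theta_3)]\,p^{(3)}(1,1,-4)p^{(3)}(2,3,-4)$ - $\mathcal Q^{(2)}_{17}=\sum'_4[4A_1^2A_2A_3A_4^2\cos(\theta_1+\theta_2-\theta_4)\cos(\theta_1-\theta_3+\theta_4)-2A_1^2A_2A_3\cos(2\theta_1+\theta_2-\theta_3)-2A_2A_3A_4^2\cos(\theta_2+\theta_3-2\theta_4)]\,p^{(3)}(1,2,-4)p^{(3)}(1,-3,4)$ - $\mathcal Q^{(2)}_{18}=\sum'_5A_1^2A_2A_3A_4A_5\cos(2\theta_1-\theta_4)\cos(\theta_2+\theta_3-\theta_5)\,p^{(3)}(1,1,-4)p^{(3)}(2,3,-5)$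 - $\mathcal Q^{(2)}_{19}=\sum'_5[2A_1A_2A_3A_4A_5^2\cos(\theta_1-\theta_3-\theta_5)\cos(\theta_2-\theta_4+\theta_5)-A_1A_2A_3A_4\cos(\theta_1+\theta_2-\theta_3-\theta_4)]\,p^{(3)}(1,-3,-5)p^{(3)}(2,-4,5)$ - $\mathcal Q^{(2)}_{20}=\sum'_5[2A_1A_2A_3A_4A_5^2\cos(\theta_1+\theta_2-\theta_5)\cos(\theta_3-\theta_4+\theta_5)-A_1A_2A_3A_4\cos(\theta_1+\theta_2+\theta_3-\theta_4)]\,p^{(3)}(1,2,-5)p^{(3)}(3,-4,5)$ - $\mathcal Q^{(2)}_{21}=\sum'_5[\frac12A_1A_2A_3A_4A_5^2\cos(\theta_1+\theta_2-\theta_5)\cos(\theta_3+\theta_4-\theta_5)-\frac14A_1A_2A_3A_4\cos(\theta_1+\theta_2-\theta_3-\theta_4)]\,p^{(3)}(1,2,-5)p^{(3)}(3,4,-5)$ - $\mathcal Q^{(2)}_{22}=\sum'_6\frac12A_1A_2A_3A_4A_5A_6\cos(\theta_1+\theta_2-\theta_3)\cos(\theta_4+\theta_5-\theta_6)\,p^{(3)}(1,2,-3)p^{(3)}(4,5,-6)$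 -/

import Mathlib

open MeasureTheory ProbabilityTheory
open scoped ComplexConjugate

namespace FourierModes

noncomputable section

/-! ### The periodic box, random fields and their Fourier modes -/

/-- The box with side lengths `L i` and periodic boundary conditions. Its Haar measure `volume`
is Lebesgue measure on the box, of total mass `∏ i, L i`. -/
abbrev Torus {d : ℕ} (L : Fin d → ℝ) : Type := (i : Fin d) → AddCircle (L i)

/-- The label `n ∈ ℤ^d` of the wavevector `𝐤 = (2π n_1 / L_1, …, 2π n_d / L_d)`. -/
abbrev Mode (d : ℕ) : Type := Fin d → ℤ

/-- The volume `V = L_1 ⋯ L_d` of the box. -/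
def boxVolume {d : ℕ} (L : Fin d → ℝ) : ℝ := ∏ i, L i

/-- A choice of an upper half of Fourier space: of any two opposite nonzero wavevectors it
contains exactly one, and it is closed under addition (as for `k_z > 0`, ties on the hyperplane
`k_z = 0` being broken by the remaining coordinates). -/
structure IsUpperHalf {d : ℕ} (H : Set (Mode d)) : Prop where
  zero_notMem : (0 : Mode d) ∉ H
  add_mem : ∀ k ∈ H, ∀ l ∈ H, k + l ∈ H
  mem_or_neg_mem : ∀ k : Mode d, k ≠ 0 → k ∈ H ∨ -k ∈ H

/-- A real, centred, statistically homogeneous random field on the periodic box, all of whose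
moments are finite. -/
structure IsHomogeneousField {d : ℕ} (L : Fin d → ℝ) {Ω : Type*} [MeasurableSpace Ω]
    (μ : Measure Ω) (f : Torus L → Ω → ℝ) : Prop where
  measurable : Measurable (Function.uncurry f)
  moments : ∀ (x : Torus L) (N : ℕ), Integrable (fun ω => |f x ω| ^ N) μ
  mean_zero : ∀ x : Torus L, ∫ ω, f x ω ∂μ = 0
  homogeneous : ∀ (m : ℕ) (x : Fin m → Torus L) (y : Torus L),
    IdentDistrib (fun ω j => f (x j + y) ω) (fun ω j => f (x j) ω) μ μ

/-- The joint cumulant `⟨X_1 ⋯ X_N⟩_c`, through the sum over set partitions. -/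
def jointCumulant {Ω : Type*} [MeasurableSpace Ω] (μ : Measure Ω) {N : ℕ}
    (X : Fin N → Ω → ℂ) : ℂ :=
  ∑ π : Finpartition (Finset.univ : Finset (Fin N)),
    (-1) ^ (π.parts.card - 1) * ((π.parts.card - 1).factorial : ℂ) *
      ∏ B ∈ π.parts, ∫ ω, ∏ j ∈ B, X j ω ∂μ

section Field

variable {d : ℕ} (L : Fin d → ℝ) [∀ i, Fact (0 < L i)] {Ω : Type*} [MeasurableSpace Ω]
  (μ : Measure Ω) (f : Torus L → Ω → ℝ)

/-- The volume-normalized Fourier coefficient `f_𝐤 = V^{-1/2} ∫ f(x) e^{-i𝐤·x} dx`. -/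
def mode (n : Mode d) (ω : Ω) : ℂ :=
  ((√(boxVolume L) : ℝ) : ℂ)⁻¹ * ∫ x : Torus L, (f x ω : ℂ) * ∏ i, fourier (-(n i)) (x i)

/-- The power spectrum `P(𝐤) = ⟨|f_𝐤|²⟩`. -/
def powerSpectrum (n : Mode d) : ℝ := ∫ ω, ‖mode L f n ω‖ ^ 2 ∂μ

/-- The polyspectrum `P^{(N)}`, that is `⟨f_{𝐤_1} ⋯ f_{𝐤_N}⟩_c = V^{1-N/2} P^{(N)}`. It is written
as a function of all `N` wavevectors; only arguments with zero sum are ever used. -/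
def polyspectrum {N : ℕ} (n : Fin N → Mode d) : ℂ :=
  ((√(boxVolume L) : ℝ) : ℂ) ^ ((N : ℤ) - 2) * jointCumulant μ (fun j => mode L f (n j))

/-- The normalized polyspectrum `p^{(N)}(𝐤_1, …, 𝐤_N)`, with the Kronecker delta of the sum of the
wavevectors. -/
def normalizedPolyspectrum {N : ℕ} (n : Fin N → Mode d) : ℂ :=
  if ∑ j, n j = 0 then
    polyspectrum L μ f n / ((∏ j, √(powerSpectrum L μ f (n j)) : ℝ) : ℂ)
  else 0

/-- The normalized mode `α_𝐤 = f_𝐤 / √P(𝐤)`. -/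
def normalizedMode (n : Mode d) (ω : Ω) : ℂ :=
  mode L f n ω / ((√(powerSpectrum L μ f n) : ℝ) : ℂ)

end Field

/-! ### A finite family of independent modes

A finite set of modes in the upper half is given by an injective family `k : ι → Mode d`. Its
points together with their opposites ("both" halves) are labelled by `ι × ℤˣ`, where `(i, 1)`
stands for `𝐤_i` and `(i, -1)` for `-𝐤_i`. -/

/-- The label of `𝐤_i`. -/
abbrev up {ι : Type*} (i : ι) : ι × ℤˣ := (i, 1)

/-- The label of `-𝐤_i`. -/
abbrev dn {ι : Type*} (i : ι) : ι × ℤˣ := (i, -1)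

/-- The wavevector `±𝐤_i` carried by the label `(i, ±1)`. -/
def signedMode {d : ℕ} {ι : Type*} (k : ι → Mode d) (l : ι × ℤˣ) : Mode d := (l.2 : ℤ) • k l.1

/-- The variable `α_{±𝐤_i}`, with `α_{-𝐤} = conj α_𝐤`. -/
def signedVar {ι : Type*} (α : ι → ℂ) (l : ι × ℤˣ) : ℂ :=
  if l.2 = 1 then α l.1 else conj (α l.1)

section Family

variable {d : ℕ} (L : Fin d → ℝ) [∀ i, Fact (0 < L i)] {Ω : Type*} [MeasurableSpace Ω]
  (μ : Measure Ω) (f : Torus L → Ω → ℝ) {ι : Type*} (k : ι → Mode d)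

/-- `f` is a homogeneous random field and `k` a family of distinct modes in an upper half of
Fourier space, at which the power spectrum does not vanish. -/
structure IsModeFamily : Prop where
  field : IsHomogeneousField L μ f
  injective : Function.Injective k
  upper : ∃ H : Set (Mode d), IsUpperHalf H ∧ ∀ i, k i ∈ H
  power_pos : ∀ i, 0 < powerSpectrum L μ f (k i)

/-- The random vector `(α_{𝐤_i})_i`. -/
def modeVector (ω : Ω) (i : ι) : ℂ := normalizedMode L μ f (k i) ω

/-- The normalized polyspectra as functions of the labels of the modes. -/
def pSpec (N : ℕ) (l : Fin N → ι × ℤˣ) : ℂ :=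
  normalizedPolyspectrum L μ f (fun j => signedMode k (l j))

/-- The symmetry `P^{(N)}(-𝐤_1, …, -𝐤_N) = P^{(N)}(𝐤_1, …, 𝐤_N)` of the bispectrum and the
trispectrum at the modes of the family. -/
def IsReflectionSymmetric : Prop :=
  ∀ N : ℕ, N = 3 ∨ N = 4 → ∀ l : Fin N → ι × ℤˣ,
    pSpec L μ f k N (fun j => ((l j).1, -(l j).2)) = pSpec L μ f k N l

variable [Fintype ι]

/-- `X = ∑_i (K_i a_i + L_i b_i)`, where `α_i = a_i + i b_i` and `J_i = K_i + i L_i`. -/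
def pairing {ι : Type*} [Fintype ι] (J α : ι → ℂ) : ℝ :=
  ∑ i, ((J i).re * (α i).re + (J i).im * (α i).im)

/-- The cumulant `⟨X^N⟩_c` of the random variable `X = ∑_i (K_i a_i + L_i b_i)`. -/
def pairingCumulant (J : ι → ℂ) (N : ℕ) : ℂ :=
  jointCumulant μ (fun (_ : Fin N) ω => (pairing J (modeVector L μ f k ω) : ℂ))

/-- The part `∑_{N ≥ 3} (-i)^N / N! ⟨X^N⟩_c` of the cumulant expansion, as a formal power series
in `ε = V^{-1/2}`: the coefficient of `ε^{N-2}` is the `N`-th term divided by `V^{-(N-2)/2}`. -/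
def cumulantSeries (J : ι → ℂ) : PowerSeries ℂ :=
  PowerSeries.mk fun n =>
    if n = 0 then 0
    else (-Complex.I) ^ (n + 2) / ((n + 2).factorial : ℂ) *
      (((√(boxVolume L) : ℝ) : ℂ) ^ n * pairingCumulant L μ f k J (n + 2))

/-- The characteristic function `⟨e^{-iX}⟩ = exp (∑_{N ≥ 2} (-i)^N / N! ⟨X^N⟩_c)` as a formal power
series in `ε = V^{-1/2}`. -/
def formalCharFun (J : ι → ℂ) : PowerSeries ℂ :=
  PowerSeries.C (Complex.exp ((-Complex.I) ^ 2 / 2 * pairingCumulant L μ f k J 2)) *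
    (PowerSeries.exp ℂ).subst (cumulantSeries L μ f k J)

/-- The formal joint density `𝒫` of the normalized modes with respect to `∏_i da_i db_i`: the
inverse Fourier transform of the formal characteristic function, taken coefficientwise. It is a
formal power series in `ε = V^{-1/2}`. -/
def formalDensity (α : ι → ℂ) : PowerSeries ℂ :=
  PowerSeries.mk fun n =>
    ((2 * Real.pi : ℝ) : ℂ)⁻¹ ^ (2 * Fintype.card ι) *
      ∫ J : ι → ℂ, Complex.exp (Complex.I * pairing J α) *
        PowerSeries.coeff n (formalCharFun L μ f k J)

end Family

/-! ### Gaussian law, generalized Hermite polynomials, and the general term -/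

section Hermite

variable {ι : Type*} [Fintype ι]

/-- The Gaussian density `𝒫_G = ∏_i π⁻¹ exp (-α_{-𝐤_i} α_{𝐤_i})` with respect to
`∏_i da_i db_i`. -/
def gaussianDensity (α : ι → ℂ) : ℂ :=
  ((∏ i, (Real.pi⁻¹ * Real.exp (-(‖α i‖ ^ 2))) : ℝ) : ℂ)

variable [DecidableEq ι]

/-- The derivative `∂/∂α_{±𝐤_i} = ½ (∂/∂a_i ∓ i ∂/∂b_i)`, in which `α_{𝐤_i} = a_i + i b_i` and
`α_{-𝐤_i} = a_i - i b_i` are treated as independent variables. -/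
def modeDeriv (l : ι × ℤˣ) (F : (ι → ℂ) → ℂ) (α : ι → ℂ) : ℂ :=
  (1 / 2) * (fderiv ℝ F α (Pi.single l.1 1) -
    ((l.2 : ℤ) : ℂ) * Complex.I * fderiv ℝ F α (Pi.single l.1 Complex.I))

/-- The generalized Hermite polynomial
`H_{𝐤_1 ⋯ 𝐤_n} = (-1)^n / 𝒫_G · ∂/∂α_{𝐤_1} ⋯ ∂/∂α_{𝐤_n} 𝒫_G`. -/
def genHermite (l : List (ι × ℤˣ)) (α : ι → ℂ) : ℂ :=
  (-1) ^ l.length / gaussianDensity α * l.foldr modeDeriv gaussianDensity α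

/-- The coefficient of `V^{-n/2}`, `n ≥ 1`, in the expansion of `𝒫 / 𝒫_G`. Since
`n_1 + ⋯ + n_m = n` with all `n_j ≥ 1` forces `m ≤ n`, the sum over `m` stops at `n`. -/
def expansionCoeff (p : (N : ℕ) → (Fin N → ι × ℤˣ) → ℂ) (n : ℕ) (α : ι → ℂ) : ℂ :=
  ∑ m ∈ Finset.Icc 1 n, ((m.factorial : ℂ))⁻¹ *
    ∑ ν ∈ (Fintype.piFinset fun _ : Fin m => Finset.Icc 1 n) with ∑ j, ν j = n,
      (∏ j, (((ν j + 2).factorial : ℂ))⁻¹) *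
        ∑ l : (j : Fin m) → Fin (ν j + 2) → ι × ℤˣ,
          (∏ j, p (ν j + 2) (l j)) *
            genHermite (List.ofFn fun j => List.ofFn (l j)).flatten α

end Hermite

/-! ### The first two orders, as sums over mutually different modes

A sum over `k : Fin r ↪ ι` is a sum over `r` mutually different modes of the upper half; `k 0`,
`k 1`, … stand for `𝐤_1`, `𝐤_2`, …. `A` and `θ` are the amplitudes and the phases. -/

section Explicit

variable {ι : Type*} [Fintype ι] [DecidableEq ι]

/-- The terms `𝒬^{(1)}_1, 𝒬^{(1)}_2`. -/
def Q1 (p : (N : ℕ) → (Fin N → ι × ℤˣ) → ℂ) (A θ : ι → ℝ) : Fin 2 → ℂ :=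
  ![∑ k : Fin 2 ↪ ι,
      ((A (k 0) ^ 2 * A (k 1) * Real.cos (2 * θ (k 0) - θ (k 1)) : ℝ) : ℂ) *
        p 3 ![up (k 0), up (k 0), dn (k 1)],
    ∑ k : Fin 3 ↪ ι,
      ((A (k 0) * A (k 1) * A (k 2) * Real.cos (θ (k 0) + θ (k 1) - θ (k 2)) : ℝ) : ℂ) *
        p 3 ![up (k 0), up (k 1), dn (k 2)]]

/-- The terms `𝒬^{(2)}_1, …, 𝒬^{(2)}_7`, linear in the normalized trispectrum. -/
def Q2tri (p : (N : ℕ) → (Fin N → ι × ℤˣ) → ℂ) (A θ : ι → ℝ) : Fin 7 → ℂ :=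
  ![
    -- 1
    ∑ k : Fin 1 ↪ ι,
      ((1 / 4 * A (k 0) ^ 4 - A (k 0) ^ 2 + 1 / 2 : ℝ) : ℂ) *
        p 4 ![up (k 0), up (k 0), dn (k 0), dn (k 0)],
    -- 2
    ∑ k : Fin 2 ↪ ι,
      ((1 / 2 * (A (k 0) ^ 2 * A (k 1) ^ 2 - A (k 0) ^ 2 - A (k 1) ^ 2 + 1) : ℝ) : ℂ) *
        p 4 ![up (k 0), up (k 1), dn (k 0), dn (k 1)],
    -- 3
    ∑ k : Fin 2 ↪ ι,
      ((1 / 3 * A (k 0) ^ 3 * A (k 1) * Real.cos (3 * θ (k 0) - θ (k 1)) : ℝ) : ℂ) *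
        p 4 ![up (k 0), up (k 0), up (k 0), dn (k 1)],
    -- 4
    ∑ k : Fin 3 ↪ ι,
      ((A (k 0) ^ 2 * A (k 1) * A (k 2) *
        Real.cos (2 * θ (k 0) + θ (k 1) - θ (k 2)) : ℝ) : ℂ) *
        p 4 ![up (k 0), up (k 0), up (k 1), dn (k 2)],
    -- 5
    ∑ k : Fin 3 ↪ ι,
      ((1 / 2 * A (k 0) ^ 2 * A (k 1) * A (k 2) *
        Real.cos (2 * θ (k 0) - θ (k 1) - θ (k 2)) : ℝ) : ℂ) *
        p 4 ![up (k 0), up (k 0), dn (k 1), dn (k 2)],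
    -- 6
    ∑ k : Fin 4 ↪ ι,
      ((1 / 3 * A (k 0) * A (k 1) * A (k 2) * A (k 3) *
        Real.cos (θ (k 0) + θ (k 1) + θ (k 2) - θ (k 3)) : ℝ) : ℂ) *
        p 4 ![up (k 0), up (k 1), up (k 2), dn (k 3)],
    -- 7
    ∑ k : Fin 4 ↪ ι,
      ((1 / 4 * A (k 0) * A (k 1) * A (k 2) * A (k 3) *
        Real.cos (θ (k 0) + θ (k 1) - θ (k 2) - θ (k 3)) : ℝ) : ℂ) *
        p 4 ![up (k 0), up (k 1), dn (k 2), dn (k 3)]]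

/-- The terms `𝒬^{(2)}_8, …, 𝒬^{(2)}_{22}`, quadratic in the normalized bispectrum. -/
def Q2bi (p : (N : ℕ) → (Fin N → ι × ℤˣ) → ℂ) (A θ : ι → ℝ) : Fin 15 → ℂ :=
  ![
    -- 8
    ∑ k : Fin 2 ↪ ι,
      ((1 / 2 * A (k 0) ^ 4 * A (k 1) ^ 2 * Real.cos (2 * θ (k 0) - θ (k 1)) ^ 2
        - A (k 0) ^ 2 * A (k 1) ^ 2 - 1 / 4 * A (k 0) ^ 4 + A (k 0) ^ 2
        + 1 / 2 * A (k 1) ^ 2 - 1 / 2 : ℝ) : ℂ) *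
        p 3 ![up (k 0), up (k 0), dn (k 1)] ^ 2,
    -- 9
    ∑ k : Fin 3 ↪ ι,
      ((A (k 0) ^ 2 * A (k 1) ^ 2 * A (k 2) ^ 2 * Real.cos (θ (k 0) + θ (k 1) - θ (k 2)) ^ 2
        - 1 / 2 * (A (k 0) ^ 2 * A (k 1) ^ 2 + A (k 0) ^ 2 * A (k 2) ^ 2
          + A (k 1) ^ 2 * A (k 2) ^ 2 - A (k 0) ^ 2 - A (k 1) ^ 2 - A (k 2) ^ 2 + 1) : ℝ) : ℂ) *
        p 3 ![up (k 0), up (k 1), dn (k 2)] ^ 2,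
    -- 10
    ∑ k : Fin 3 ↪ ι,
      ((A (k 0) ^ 2 * A (k 1) ^ 3 * A (k 2) *
          Real.cos (2 * θ (k 0) - θ (k 1)) * Real.cos (2 * θ (k 1) - θ (k 2))
        - A (k 0) ^ 2 * A (k 1) * A (k 2) *
          Real.cos (2 * θ (k 0) + θ (k 1) - θ (k 2)) : ℝ) : ℂ) *
        p 3 ![up (k 0), up (k 0), dn (k 1)] * p 3 ![up (k 1), up (k 1), dn (k 2)],
    -- 11
    ∑ k : Fin 3 ↪ ι,
      ((2 * A (k 0) ^ 3 * A (k 1) ^ 2 * A (k 2) *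
          Real.cos (2 * θ (k 0) - θ (k 1)) * Real.cos (θ (k 0) + θ (k 1) - θ (k 2))
        - A (k 0) ^ 3 * A (k 2) * Real.cos (3 * θ (k 0) - θ (k 2))
        - 2 * A (k 0) * A (k 1) ^ 2 * A (k 2) *
          Real.cos (θ (k 0) - 2 * θ (k 1) + θ (k 2)) : ℝ) : ℂ) *
        p 3 ![up (k 0), up (k 0), dn (k 1)] * p 3 ![up (k 0), up (k 1), dn (k 2)],
    -- 12
    ∑ k : Fin 4 ↪ ι,
      ((1 / 2 * A (k 0) ^ 2 * A (k 1) ^ 2 * A (k 2) * A (k 3) *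
          Real.cos (2 * θ (k 0) - θ (k 2)) * Real.cos (2 * θ (k 1) - θ (k 3)) : ℝ) : ℂ) *
        p 3 ![up (k 0), up (k 0), dn (k 2)] * p 3 ![up (k 1), up (k 1), dn (k 3)],
    -- 13
    ∑ k : Fin 4 ↪ ι,
      ((2 * A (k 0) ^ 3 * A (k 1) * A (k 2) * A (k 3) *
          Real.cos (2 * θ (k 0) - θ (k 2)) * Real.cos (θ (k 0) - θ (k 1) + θ (k 3))
        - 2 * A (k 0) * A (k 1) * A (k 2) * A (k 3) *
          Real.cos (θ (k 0) + θ (k 1) - θ (k 2) - θ (k 3)) : ℝ) : ℂ) *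
        p 3 ![up (k 0), up (k 0), dn (k 2)] * p 3 ![up (k 0), dn (k 1), up (k 3)],
    -- 14
    ∑ k : Fin 4 ↪ ι,
      ((A (k 0) ^ 3 * A (k 1) * A (k 2) * A (k 3) *
          Real.cos (2 * θ (k 0) - θ (k 3)) * Real.cos (θ (k 0) - θ (k 1) - θ (k 2))
        - A (k 0) * A (k 1) * A (k 2) * A (k 3) *
          Real.cos (θ (k 0) + θ (k 1) + θ (k 2) - θ (k 3)) : ℝ) : ℂ) *
        p 3 ![up (k 0), up (k 0), dn (k 3)] * p 3 ![dn (k 0), up (k 1), up (k 2)],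
    -- 15
    ∑ k : Fin 4 ↪ ι,
      ((2 * A (k 0) ^ 2 * A (k 1) * A (k 2) * A (k 3) ^ 2 *
          Real.cos (2 * θ (k 0) - θ (k 3)) * Real.cos (θ (k 1) - θ (k 2) + θ (k 3))
        - A (k 0) ^ 2 * A (k 1) * A (k 2) *
          Real.cos (2 * θ (k 0) + θ (k 1) - θ (k 2)) : ℝ) : ℂ) *
        p 3 ![up (k 0), up (k 0), dn (k 3)] * p 3 ![up (k 1), dn (k 2), up (k 3)],
    -- 16
    ∑ k : Fin 4 ↪ ι,
      ((A (k 0) ^ 2 * A (k 1) * A (k 2) * A (k 3) ^ 2 *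
          Real.cos (2 * θ (k 0) - θ (k 3)) * Real.cos (θ (k 1) + θ (k 2) - θ (k 3))
        - 1 / 2 * A (k 0) ^ 2 * A (k 1) * A (k 2) *
          Real.cos (2 * θ (k 0) - θ (k 1) - θ (k 2)) : ℝ) : ℂ) *
        p 3 ![up (k 0), up (k 0), dn (k 3)] * p 3 ![up (k 1), up (k 2), dn (k 3)],
    -- 17
    ∑ k : Fin 4 ↪ ι,
      ((4 * A (k 0) ^ 2 * A (k 1) * A (k 2) * A (k 3) ^ 2 *
          Real.cos (θ (k 0) + θ (k 1) - θ (k 3)) * Real.cos (θ (k 0) - θ (k 2) + θ (k 3))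
        - 2 * A (k 0) ^ 2 * A (k 1) * A (k 2) *
          Real.cos (2 * θ (k 0) + θ (k 1) - θ (k 2))
        - 2 * A (k 1) * A (k 2) * A (k 3) ^ 2 *
          Real.cos (θ (k 1) + θ (k 2) - 2 * θ (k 3)) : ℝ) : ℂ) *
        p 3 ![up (k 0), up (k 1), dn (k 3)] * p 3 ![up (k 0), dn (k 2), up (k 3)],
    -- 18
    ∑ k : Fin 5 ↪ ι,
      ((A (k 0) ^ 2 * A (k 1) * A (k 2) * A (k 3) * A (k 4) *
          Real.cos (2 * θ (k 0) - θ (k 3)) * Real.cos (θ (k 1) + θ (k 2) - θ (k 4)) : ℝ) : ℂ) *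
        p 3 ![up (k 0), up (k 0), dn (k 3)] * p 3 ![up (k 1), up (k 2), dn (k 4)],
    -- 19
    ∑ k : Fin 5 ↪ ι,
      ((2 * A (k 0) * A (k 1) * A (k 2) * A (k 3) * A (k 4) ^ 2 *
          Real.cos (θ (k 0) - θ (k 2) - θ (k 4)) * Real.cos (θ (k 1) - θ (k 3) + θ (k 4))
        - A (k 0) * A (k 1) * A (k 2) * A (k 3) *
          Real.cos (θ (k 0) + θ (k 1) - θ (k 2) - θ (k 3)) : ℝ) : ℂ) *
        p 3 ![up (k 0), dn (k 2), dn (k 4)] * p 3 ![up (k 1), dn (k 3), up (k 4)],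
    -- 20
    ∑ k : Fin 5 ↪ ι,
      ((2 * A (k 0) * A (k 1) * A (k 2) * A (k 3) * A (k 4) ^ 2 *
          Real.cos (θ (k 0) + θ (k 1) - θ (k 4)) * Real.cos (θ (k 2) - θ (k 3) + θ (k 4))
        - A (k 0) * A (k 1) * A (k 2) * A (k 3) *
          Real.cos (θ (k 0) + θ (k 1) + θ (k 2) - θ (k 3)) : ℝ) : ℂ) *
        p 3 ![up (k 0), up (k 1), dn (k 4)] * p 3 ![up (k 2), dn (k 3), up (k 4)],
    -- 21
    ∑ k : Fin 5 ↪ ι,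
      ((1 / 2 * A (k 0) * A (k 1) * A (k 2) * A (k 3) * A (k 4) ^ 2 *
          Real.cos (θ (k 0) + θ (k 1) - θ (k 4)) * Real.cos (θ (k 2) + θ (k 3) - θ (k 4))
        - 1 / 4 * A (k 0) * A (k 1) * A (k 2) * A (k 3) *
          Real.cos (θ (k 0) + θ (k 1) - θ (k 2) - θ (k 3)) : ℝ) : ℂ) *
        p 3 ![up (k 0), up (k 1), dn (k 4)] * p 3 ![up (k 2), up (k 3), dn (k 4)],
    -- 22
    ∑ k : Fin 6 ↪ ι,
      ((1 / 2 * A (k 0) * A (k 1) * A (k 2) * A (k 3) * A (k 4) * A (k 5) *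
          Real.cos (θ (k 0) + θ (k 1) - θ (k 2)) *
          Real.cos (θ (k 3) + θ (k 4) - θ (k 5)) : ℝ) : ℂ) *
        p 3 ![up (k 0), up (k 1), dn (k 2)] * p 3 ![up (k 3), up (k 4), dn (k 5)]]

/-- The first-order term `∑_{i=1}^{2} 𝒬^{(1)}_i`. -/
def firstOrder (p : (N : ℕ) → (Fin N → ι × ℤˣ) → ℂ) (A θ : ι → ℝ) : ℂ :=
  ∑ i, Q1 p A θ i

/-- The second-order term `∑_{i=1}^{22} 𝒬^{(2)}_i`. -/
def secondOrder (p : (N : ℕ) → (Fin N → ι × ℤˣ) → ℂ) (A θ : ι → ℝ) : ℂ :=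
  ∑ i, Q2tri p A θ i + ∑ i, Q2bi p A θ i

end Explicit

/-- The value of a polynomial in the variables `α_𝐤`, `𝐤` in both halves. -/
def polyValue {ι : Type*} (q : MvPolynomial (ι × ℤˣ) ℂ) (α : ι → ℂ) : ℂ :=
  MvPolynomial.eval (signedVar α) q

end

end FourierModes

open FourierModes

/-! Translation invariance multiplies a joint moment of modes by a character of the total
wavevector, so the moment vanishes unless the wavevectors add up to zero
(`IsHomogeneousField.integral_prod_mode_eq_zero`), and cumulants inherit this. Since no two modes of
an upper half are opposite, the covariance of the normalized modes is that of the complex Gaussian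
`gaussianDensity` (`IsModeFamily.moment_X_mul_X`).

Expansion. Write X as a linear form in all α_l, l in both halves, with coefficients J_{-l}/2. The
second cumulant yields the factor exp(-∑|J_i|²/4), and by multilinearity the higher ones are
polynomials in the symbols y_l = -iJ_{-l}/2 whose coefficients are the normalized polyspectra, all
powers of V cancelling. Every coefficient of the formal characteristic function is therefore a
Gaussian times `densityPoly` at the symbols. Under the inverse Fourier transform y_l becomes
-∂/∂α_l, so monomials in the symbols become Hermite polynomials times 𝒫_G
(`genHermite_mul_gaussianDensity`).

Moments. Integration by parts moves y_l onto the test polynomial as a derivative. Tested on powers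
of a linear form ∑ c_l α_l, a polynomial g in the symbols becomes g(ct) times the Gaussian moment
series (`integral_linForm_pow_mul_invFourier`). On the probabilistic side the moment-cumulant
recursion says M' = K'M for the moment and cumulant series of the linear form. The Gaussian series
solves the same equation with only the quadratic part of K, so M is the exponential of the higher
cumulants times the Gaussian series (`momentSeries_eq`). The two products agree once sorted by
powers of V^{-1/2}; a term of order n with m factors has degree n + 2m in t, so finitely many orders
meet a given degree. Polarization (`eq_zero_of_linForm_pow`) passes from powers of linear forms to
all polynomials.

Explicit orders. Closure of the upper half under addition removes the terms with all signs equal,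
and reflection symmetry pairs each remaining sign pattern with its opposite. The free sums are then
sorted by which modes coincide. Momentum conservation excludes most patterns, and the symmetries
group the rest into the listed terms (`sum_bispectrum_pairs` and its analogues for the trispectrum).
On a fixed pattern the claim is an identity of Laurent polynomials in the phases.

Remainder. The moment formula is an exact finite sum, so the error consists of its terms with n ≥ 3.
A Hermite polynomial of order above deg q integrates to zero against q, hence only p^{(N)} with N ≤
deg q enter these terms, and they are bounded uniformly (`exists_bound_invFourierMoment`). -/

noncomputable section

set_option linter.unusedSectionVars false
set_option linter.unusedSimpArgs false

namespace FourierModes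

/-! ### Characters of the periodic box and joint moments of the modes -/

section Torus

variable {d : ℕ} (L : Fin d → ℝ)

/-- The character `e^{-i𝐤·x}` of the box. -/
def boxChar (n : Mode d) (x : Torus L) : ℂ := ∏ i, fourier (-(n i)) (x i)

theorem continuous_boxChar (n : Mode d) : Continuous (boxChar L n) := by
  unfold boxChar
  fun_prop

theorem norm_boxChar (n : Mode d) (x : Torus L) : ‖boxChar L n x‖ = 1 := by
  unfold boxChar
  rw [norm_prod]
  exact Finset.prod_eq_one fun i _ => by rw [fourier_apply]; exact Circle.norm_coe _

theorem boxChar_add (n : Mode d) (x y : Torus L) :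
    boxChar L n (x + y) = boxChar L n x * boxChar L n y := by
  simp [boxChar, fourier_apply, smul_add, AddCircle.toCircle_add, Finset.prod_mul_distrib]

theorem boxChar_neg (n : Mode d) (x : Torus L) : boxChar L (-n) x = conj (boxChar L n x) := by
  unfold boxChar
  rw [map_prod]
  exact Finset.prod_congr rfl fun i _ => by rw [← fourier_neg]; rfl

theorem boxChar_sum {τ : Type*} [Fintype τ] (n : τ → Mode d) (x : Torus L) :
    boxChar L (∑ j, n j) x = ∏ j, boxChar L (n j) x := by
  simp only [boxChar]
  rw [Finset.prod_comm]
  refine Finset.prod_congr rfl fun i _ => ?_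
  simp only [Finset.sum_apply]
  induction (Finset.univ : Finset τ) using Finset.cons_induction with
  | empty => simp
  | cons a s ha ih =>
    rw [Finset.sum_cons, Finset.prod_cons, neg_add, fourier_add, ih]

/-- A nonzero frequency along one axis is detected by moving half of its wavelength along that axis,
where the character is -1. -/
theorem exists_boxChar_ne_one [∀ i, Fact (0 < L i)] {n : Mode d} (hn : n ≠ 0) :
    ∃ y : Torus L, boxChar L n y ≠ 1 := by
  obtain ⟨i, hi⟩ : ∃ i, n i ≠ 0 := by
    by_contra! h
    exact hn (funext h)
  refine ⟨Pi.single i ((L i / 2 / (-(n i) : ℤ) : ℝ) : AddCircle (L i)), ?_⟩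
  have h1 := fourier_add_half_inv_index (T := L i) (neg_ne_zero.2 hi) (Fact.out) 0
  rw [zero_add] at h1
  have h2 : boxChar L n (Pi.single i ((L i / 2 / (-(n i) : ℤ) : ℝ) : AddCircle (L i))) = -1 := by
    unfold boxChar
    rw [Finset.prod_eq_single i]
    · rw [Pi.single_eq_same, h1]
      simp
    · intro j _ hj
      rw [Pi.single_eq_of_ne hj]
      simp
    · simp
  rw [h2]
  norm_num

end Torus

/-- The product is at most a power of its largest factor, which is one of the summands; the 1 covers
the empty family. Mixed moments of the field are thereby controlled by one-point moments. -/
theorem prod_le_sum_pow {τ : Type*} [Fintype τ] (a : τ → ℝ) (ha : ∀ j, 0 ≤ a j) :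
    ∏ j, a j ≤ 1 + ∑ j, a j ^ Fintype.card τ := by
  rcases isEmpty_or_nonempty τ with h | h
  · simp
  · obtain ⟨j, -, hj⟩ := Finset.exists_max_image Finset.univ a Finset.univ_nonempty
    have h1 : ∏ i, a i ≤ a j ^ Fintype.card τ := by
      calc ∏ i, a i ≤ ∏ _i : τ, a j :=
            Finset.prod_le_prod (fun i _ => ha i) fun i hi => hj i hi
        _ = a j ^ Fintype.card τ := by simp
    have h2 : a j ^ Fintype.card τ ≤ ∑ i, a i ^ Fintype.card τ :=
      Finset.single_le_sum (f := fun i => a i ^ Fintype.card τ)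
        (fun i _ => pow_nonneg (ha i) _) (Finset.mem_univ j)
    linarith

/-! ### Integrability and translation covariance of joint moments -/

section Moments

variable {d : ℕ} {L : Fin d → ℝ} [∀ i, Fact (0 < L i)] {Ω : Type*} [MeasurableSpace Ω]
  {μ : Measure Ω} [IsProbabilityMeasure μ] {f : Torus L → Ω → ℝ}

theorem IsHomogeneousField.measurable_apply (hf : IsHomogeneousField L μ f) (x : Torus L) :
    Measurable (f x) :=
  hf.measurable.comp (measurable_const.prodMk measurable_id)

theorem IsHomogeneousField.identDistrib (hf : IsHomogeneousField L μ f) {τ : Type*} [Fintype τ]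
    (x : τ → Torus L) (y : Torus L) :
    IdentDistrib (fun ω j => f (x j + y) ω) (fun ω j => f (x j) ω) μ μ := by
  let e := Fintype.equivFin τ
  have h := hf.homogeneous (Fintype.card τ) (fun j => x (e.symm j)) y
  have hm : Measurable (fun (v : Fin (Fintype.card τ) → ℝ) (j : τ) => v (e j)) := by fun_prop
  simpa [Function.comp_def] using h.comp hm

theorem IsHomogeneousField.integral_abs_pow (hf : IsHomogeneousField L μ f) (x : Torus L)
    (N : ℕ) : ∫ ω, |f x ω| ^ N ∂μ = ∫ ω, |f 0 ω| ^ N ∂μ := by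
  have h := hf.identDistrib (fun _ : Unit => (0 : Torus L)) x
  have hm : Measurable (fun v : Unit → ℝ => |v ()| ^ N) := by fun_prop
  simpa [Function.comp_def] using (h.comp hm).integral_eq

theorem IsHomogeneousField.integrable_prod_abs (hf : IsHomogeneousField L μ f) {τ : Type*}
    [Fintype τ] (x : τ → Torus L) : Integrable (fun ω => ∏ j, |f (x j) ω|) μ := by
  have hb : Integrable (fun ω => 1 + ∑ j, |f (x j) ω| ^ Fintype.card τ) μ :=
    (integrable_const _).add (integrable_finsetSum _ fun j _ => hf.moments _ _)
  refine hb.mono' ?_ (Filter.Eventually.of_forall fun ω => ?_)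
  · exact (Finset.measurable_prod _ fun j _ =>
      (hf.measurable_apply (x j)).abs).aestronglyMeasurable
  · rw [Real.norm_of_nonneg (Finset.prod_nonneg fun j _ => abs_nonneg _)]
    exact prod_le_sum_pow _ fun j => abs_nonneg _

/-- The bound does not depend on the points, because homogeneity moves every one-point moment to the
origin. This uniformity is what Fubini needs on the box, which has finite volume. -/
theorem IsHomogeneousField.integral_prod_abs_le (hf : IsHomogeneousField L μ f) {τ : Type*}
    [Fintype τ] (x : τ → Torus L) :
    ∫ ω, ∏ j, |f (x j) ω| ∂μ ≤ 1 + Fintype.card τ * ∫ ω, |f 0 ω| ^ Fintype.card τ ∂μ := by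
  have hi : ∀ j, Integrable (fun ω => |f (x j) ω| ^ Fintype.card τ) μ := fun j => hf.moments _ _
  calc ∫ ω, ∏ j, |f (x j) ω| ∂μ ≤ ∫ ω, (1 + ∑ j, |f (x j) ω| ^ Fintype.card τ) ∂μ :=
        integral_mono (hf.integrable_prod_abs x)
          ((integrable_const _).add (integrable_finsetSum _ fun j _ => hi j))
          fun ω => prod_le_sum_pow _ fun j => abs_nonneg _
    _ = 1 + Fintype.card τ * ∫ ω, |f 0 ω| ^ Fintype.card τ ∂μ := by
        rw [integral_add (integrable_const _) (integrable_finsetSum _ fun j _ => hi j),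
          integral_finsetSum _ fun j _ => hi j]
        simp [hf.integral_abs_pow]

/-- The integrand of the joint moments of the modes. -/
def momentIntegrand (f : Torus L → Ω → ℝ) {τ : Type*} [Fintype τ] (n : τ → Mode d)
    (x : τ → Torus L) (ω : Ω) : ℂ := ∏ j, ((f (x j) ω : ℂ) * boxChar L (n j) (x j))

theorem IsHomogeneousField.measurable_momentIntegrand (hf : IsHomogeneousField L μ f) {τ : Type*}
    [Fintype τ] (n : τ → Mode d) : Measurable (Function.uncurry (momentIntegrand f n)) := by
  unfold momentIntegrand Function.uncurry
  refine Finset.measurable_prod _ fun j _ => Measurable.mul ?_ ?_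
  · have h : Measurable (fun p : (τ → Torus L) × Ω => Function.uncurry f (p.1 j, p.2)) :=
      hf.measurable.comp (((measurable_pi_apply j).comp measurable_fst).prodMk measurable_snd)
    exact Complex.measurable_ofReal.comp h
  · exact (continuous_boxChar L (n j)).measurable.comp
      ((measurable_pi_apply j).comp measurable_fst)

theorem norm_momentIntegrand {τ : Type*} [Fintype τ] (n : τ → Mode d)
    (x : τ → Torus L) (ω : Ω) : ‖momentIntegrand f n x ω‖ = ∏ j, |f (x j) ω| := by
  simp [momentIntegrand, norm_boxChar]

theorem IsHomogeneousField.integrable_momentIntegrand (hf : IsHomogeneousField L μ f) {τ : Type*}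
    [Fintype τ] (n : τ → Mode d) :
    Integrable (Function.uncurry (momentIntegrand f n))
      ((volume : Measure (τ → Torus L)).prod μ) := by
  have hm := hf.measurable_momentIntegrand n
  rw [integrable_prod_iff hm.aestronglyMeasurable]
  constructor
  · refine Filter.Eventually.of_forall fun x => ?_
    refine (hf.integrable_prod_abs x).mono'
      (hm.comp (measurable_const.prodMk measurable_id)).aestronglyMeasurable
      (Filter.Eventually.of_forall fun ω => ?_)
    exact (norm_momentIntegrand n x ω).le
  · refine Integrable.mono' (integrable_const
      (1 + Fintype.card τ * ∫ ω, |f 0 ω| ^ Fintype.card τ ∂μ)) ?_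
      (Filter.Eventually.of_forall fun x => ?_)
    · exact hm.norm.stronglyMeasurable.integral_prod_right.aestronglyMeasurable
    · rw [Real.norm_of_nonneg (integral_nonneg fun ω => norm_nonneg _)]
      simpa only [Function.uncurry, norm_momentIntegrand] using hf.integral_prod_abs_le x

/-- A product of integrals over the box is one integral over a product of boxes, so a joint moment
becomes a single integral over positions and `Ω`. -/
theorem prod_mode_eq {τ : Type*} [Fintype τ] (n : τ → Mode d) (ω : Ω) :
    ∏ j, mode L f (n j) ω = ((√(boxVolume L) : ℝ) : ℂ)⁻¹ ^ Fintype.card τ *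
      ∫ x : τ → Torus L, momentIntegrand f n x ω := by
  simp only [mode, Finset.prod_mul_distrib, Finset.prod_const, Finset.card_univ]
  congr 1
  exact (integral_fintype_prod_volume_eq_prod
    (fun j (x : Torus L) => (f x ω : ℂ) * boxChar L (n j) x)).symm

theorem IsHomogeneousField.integrable_prod_mode (hf : IsHomogeneousField L μ f) {τ : Type*}
    [Fintype τ] (n : τ → Mode d) : Integrable (fun ω => ∏ j, mode L f (n j) ω) μ := by
  simp only [prod_mode_eq]
  exact (hf.integrable_momentIntegrand n).integral_prod_right.const_mul _

theorem IsHomogeneousField.integral_momentIntegrand_add (hf : IsHomogeneousField L μ f)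
    {τ : Type*} [Fintype τ] (n : τ → Mode d) (x : τ → Torus L) (y : Torus L) :
    ∫ ω, momentIntegrand f n (fun j => x j + y) ω ∂μ =
      boxChar L (∑ j, n j) y * ∫ ω, momentIntegrand f n x ω ∂μ := by
  have hm : Measurable (fun v : τ → ℝ => ∏ j, ((v j : ℂ) * boxChar L (n j) (x j))) := by
    refine Finset.measurable_prod _ fun j _ => ?_
    exact (Complex.measurable_ofReal.comp (measurable_pi_apply j)).mul_const _
  have h := ((hf.identDistrib x y).comp hm).integral_eq
  simp only [Function.comp_def] at h
  unfold momentIntegrand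
  rw [← h, ← integral_const_mul]
  refine integral_congr_ae (Filter.Eventually.of_forall fun ω => ?_)
  simp only [boxChar_add, boxChar_sum, Finset.prod_mul_distrib]
  ring

/-- By translation invariance, joint moments of the modes vanish off the zero-sum set. -/
theorem IsHomogeneousField.integral_prod_mode_eq_zero (hf : IsHomogeneousField L μ f) {τ : Type*}
    [Fintype τ] (n : τ → Mode d) (hn : ∑ j, n j ≠ 0) :
    ∫ ω, ∏ j, mode L f (n j) ω ∂μ = 0 := by
  obtain ⟨y, hy⟩ := exists_boxChar_ne_one L hn
  simp only [prod_mode_eq]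
  rw [integral_const_mul]
  have hswap := integral_integral_swap (hf.integrable_momentIntegrand n)
  rw [← hswap]
  have hT : (volume : Measure (Torus L)).IsAddRightInvariant := by
    have : ∀ i, (volume : Measure (AddCircle (L i))).IsAddRightInvariant := fun i => inferInstance
    rw [volume_pi]
    infer_instance
  have hT' : (volume : Measure (τ → Torus L)).IsAddRightInvariant := by
    rw [volume_pi]
    infer_instance
  -- Translating all positions by `y` preserves Haar measure, so the integral equals itself times a
  -- number different from 1.
  have key : ∫ x : τ → Torus L, ∫ ω, momentIntegrand f n x ω ∂μ =
      boxChar L (∑ j, n j) y * ∫ x : τ → Torus L, ∫ ω, momentIntegrand f n x ω ∂μ := by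
    rw [← integral_const_mul]
    rw [← integral_add_right_eq_self (fun x : τ → Torus L => ∫ ω, momentIntegrand f n x ω ∂μ)
      (fun _ => y)]
    refine integral_congr_ae (Filter.Eventually.of_forall fun x => ?_)
    exact hf.integral_momentIntegrand_add n x y
  have : (1 - boxChar L (∑ j, n j) y) *
      ∫ x : τ → Torus L, ∫ ω, momentIntegrand f n x ω ∂μ = 0 := by
    linear_combination key
  rcases mul_eq_zero.1 this with h | h
  · exact absurd (sub_eq_zero.1 h).symm hy
  · rw [h, mul_zero]

theorem mode_neg (n : Mode d) (ω : Ω) : mode L f (-n) ω = conj (mode L f n ω) := by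
  have h : ∀ m : Mode d, mode L f m ω = ((√(boxVolume L) : ℝ) : ℂ)⁻¹ *
      ∫ x : Torus L, (f x ω : ℂ) * boxChar L m x := fun m => rfl
  rw [h, h, map_mul, map_inv₀, Complex.conj_ofReal, ← integral_conj]
  congr 1
  refine integral_congr_ae (Filter.Eventually.of_forall fun x => ?_)
  simp [boxChar_neg]

theorem powerSpectrum_neg (n : Mode d) : powerSpectrum L μ f (-n) = powerSpectrum L μ f n := by
  simp [powerSpectrum, mode_neg]

theorem normalizedMode_neg (n : Mode d) (ω : Ω) :
    normalizedMode L μ f (-n) ω = conj (normalizedMode L μ f n ω) := by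
  simp [normalizedMode, mode_neg, powerSpectrum_neg]

end Moments

/-! ### Cumulants of set functions -/

section SetFunction

variable {τ : Type*} [DecidableEq τ]

/-- The Möbius sign `(-1)^{r-1} (r-1)!` of a partition into `r` blocks. -/
def partitionWeight (r : ℕ) : ℂ := (-1) ^ (r - 1) * ((r - 1).factorial : ℂ)

/-- The cumulant of a set function of moments. -/
def setCumulant (m : Finset τ → ℂ) (S : Finset τ) : ℂ :=
  ∑ π : Finpartition S, partitionWeight π.parts.card * ∏ B ∈ π.parts, m B

/-- This is the cancellation behind the moment recursion. A partition into r blocks arises r - 1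
times from partitions into r - 1 blocks, once for each block avoiding a marked element, and these
contributions cancel its own weight. -/
theorem partitionWeight_add {r : ℕ} (hr : 2 ≤ r) :
    partitionWeight r + (r - 1 : ℕ) * partitionWeight (r - 1) = 0 := by
  obtain ⟨s, rfl⟩ := Nat.exists_eq_add_of_le hr
  have h1 : 2 + s - 1 = s + 1 := by omega
  have h2 : s + 1 - 1 = s := by omega
  simp only [partitionWeight, h1, h2, Nat.factorial_succ]
  push_cast
  ring

/-- Removing a block from a partition. -/
def removeBlock {S : Finset τ} (σ : Finpartition S) (C : Finset τ) (hC : C ∈ σ.parts) :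
    Finpartition (S \ C) :=
  Finpartition.ofExistsUnique (σ.parts.erase C)
    (fun p hp => by
      rw [Finset.mem_erase] at hp
      intro a ha
      rw [Finset.mem_sdiff]
      exact ⟨σ.subset hp.2 ha, fun haC => hp.1 (σ.eq_of_mem_parts hp.2 hC ha haC)⟩)
    (fun a ha => by
      rw [Finset.mem_sdiff] at ha
      obtain ⟨t, ⟨ht, hat⟩, hu⟩ := σ.existsUnique_mem ha.1
      refine ⟨t, ⟨Finset.mem_erase.2 ⟨fun h => ha.2 (h ▸ hat), ht⟩, hat⟩, ?_⟩
      intro y hy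
      exact hu y ⟨Finset.mem_of_mem_erase hy.1, hy.2⟩)
    (fun h => σ.empty_notMem_parts (Finset.mem_of_mem_erase h))

theorem removeBlock_parts {S : Finset τ} (σ : Finpartition S) (C : Finset τ) (hC : C ∈ σ.parts) :
    (removeBlock σ C hC).parts = σ.parts.erase C := rfl

/-- Double counting: deleting a block that avoids `s` leaves a partition of a proper subset
containing `s`, and the deleted block is recovered as the complement of that subset. -/
theorem sum_marked_block {S : Finset τ} {s : τ} (hs : s ∈ S) (T : Finset (Finset τ) → Finset τ → ℂ) :
    ∑ σ : Finpartition S, ∑ C ∈ σ.parts with s ∉ C, T (σ.parts.erase C) C =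
      ∑ B ∈ S.powerset with s ∈ B ∧ B ≠ S, ∑ π : Finpartition B, T π.parts (S \ B) := by
  rw [Finset.sum_sigma', Finset.sum_sigma']
  refine Finset.sum_bij' (i := fun x hx => ⟨S \ x.2, removeBlock x.1 x.2 (by simp at hx; exact hx.1)⟩)
    (j := fun x hx => ⟨x.2.extend (b := S \ x.1) (c := S) (by
        simp only [Finset.mem_sigma, Finset.mem_filter, Finset.mem_powerset] at hx
        rw [Finset.bot_eq_empty, Ne, Finset.sdiff_eq_empty_iff_subset]
        exact fun h => hx.1.2.2 (Finset.Subset.antisymm hx.1.1 h)) Finset.disjoint_sdiff (by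
        simp only [Finset.mem_sigma, Finset.mem_filter, Finset.mem_powerset] at hx
        exact Finset.union_sdiff_of_subset hx.1.1), S \ x.1⟩) ?_ ?_ ?_ ?_ ?_
  · rintro ⟨σ, C⟩ hx
    simp only [Finset.mem_sigma, Finset.mem_filter, Finset.mem_univ, true_and] at hx
    simp only [Finset.mem_sigma, Finset.mem_filter, Finset.mem_powerset, Finset.mem_univ, and_true,
      Finset.sdiff_subset, true_and, Finset.mem_sdiff]
    refine ⟨⟨hs, hx.2⟩, fun h => ?_⟩
    obtain ⟨a, ha⟩ := σ.nonempty_of_mem_parts hx.1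
    have := σ.subset hx.1 ha
    rw [← h, Finset.mem_sdiff] at this
    exact this.2 ha
  · rintro ⟨B, π⟩ hx
    simp only [Finset.mem_sigma, Finset.mem_filter, Finset.mem_powerset, Finset.mem_univ,
      and_true] at hx
    simp [Finset.mem_sdiff, hx.2.1]
  · rintro ⟨σ, C⟩ hx
    simp only [Finset.mem_sigma, Finset.mem_filter, Finset.mem_univ, true_and] at hx
    have h : S \ (S \ C) = C := Finset.sdiff_sdiff_eq_self (σ.subset hx.1)
    refine Sigma.ext ?_ (heq_of_eq h)
    ext1
    simp only [Finpartition.extend_parts, removeBlock_parts, h]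
    exact Finset.insert_erase hx.1
  · rintro ⟨B, π⟩ hx
    simp only [Finset.mem_sigma, Finset.mem_filter, Finset.mem_powerset, Finset.mem_univ,
      and_true] at hx
    have h : S \ (S \ B) = B := Finset.sdiff_sdiff_eq_self hx.1
    have hn : S \ B ∉ π.parts := fun hm => by
      obtain ⟨a, ha⟩ := π.nonempty_of_mem_parts hm
      exact (Finset.mem_sdiff.1 ha).2 (π.subset hm ha)
    have key : ∀ (B' : Finset τ) (π' : Finpartition B'), B' = B → π'.parts = π.parts →
        (⟨B', π'⟩ : (B : Finset τ) × Finpartition B) = ⟨B, π⟩ := by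
      rintro B' π' rfl h
      congr 1
      ext1
      exact h
    refine key _ _ h ?_
    simp only [removeBlock_parts, Finpartition.extend_parts]
    exact Finset.erase_insert hn
  · rintro ⟨σ, C⟩ hx
    simp only [Finset.mem_sigma, Finset.mem_filter, Finset.mem_univ, true_and] at hx
    simp only [removeBlock_parts, Finset.sdiff_sdiff_eq_self (σ.subset hx.1)]

theorem sum_powerset_filter_mem (m : Finset τ → ℂ) (hm : m ∅ = 1) {S : Finset τ} {s : τ}
    (hs : s ∈ S) : ∑ B ∈ S.powerset with s ∈ B, setCumulant m B * m (S \ B) =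
      setCumulant m S + ∑ B ∈ S.powerset with s ∈ B ∧ B ≠ S, setCumulant m B * m (S \ B) := by
  rw [← Finset.sum_erase_add _ _ (a := S) (by simp [hs]), add_comm, Finset.sdiff_self, hm, mul_one]
  congr 1
  refine Finset.sum_congr ?_ fun _ _ => rfl
  ext B
  simp only [Finset.mem_erase, Finset.mem_filter]
  tauto

/-- The recursion between moments and cumulants, obtained by splitting off the block of one
element. -/
theorem moment_eq_sum_setCumulant (m : Finset τ → ℂ) (hm : m ∅ = 1) {S : Finset τ} {s : τ}
    (hs : s ∈ S) : m S = ∑ B ∈ S.powerset with s ∈ B, setCumulant m B * m (S \ B) := by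
  have hS : S ≠ ∅ := Finset.ne_empty_of_mem hs
  have h1 : ∑ B ∈ S.powerset with s ∈ B ∧ B ≠ S, setCumulant m B * m (S \ B) =
      ∑ σ : Finpartition S, ((σ.parts.card - 1 : ℕ) * partitionWeight (σ.parts.card - 1)) *
        ∏ B ∈ σ.parts, m B := by
    have := sum_marked_block hs
      (fun P C => partitionWeight P.card * (∏ B ∈ P, m B) * m C)
    simp only [setCumulant, Finset.sum_mul]
    rw [← this]
    refine Finset.sum_congr rfl fun σ _ => ?_
    -- Exactly one block contains `s`, so all the others can be the deleted one.
    have hcard : (σ.parts.filter fun C => s ∉ C).card = σ.parts.card - 1 := by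
      have : (σ.parts.filter fun C => s ∉ C) = σ.parts.erase (σ.part s) := by
        ext C
        simp only [Finset.mem_filter, Finset.mem_erase]
        constructor
        · rintro ⟨hC, h⟩
          exact ⟨fun h' => h (by rw [h']; exact σ.mem_part_self.2 hs), hC⟩
        · rintro ⟨h, hC⟩
          exact ⟨hC, fun h' => h (σ.part_eq_of_mem hC h').symm⟩
      rw [this, Finset.card_erase_of_mem (σ.part_mem.2 hs)]
    rw [← hcard, mul_assoc, ← nsmul_eq_mul, ← Finset.sum_const]
    refine Finset.sum_congr rfl fun C hC => ?_
    rw [Finset.mem_filter] at hC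
    rw [hcard, Finset.card_erase_of_mem hC.1, mul_assoc, Finset.prod_erase_mul _ _ hC.1]
  rw [sum_powerset_filter_mem m hm hs, h1, setCumulant, ← Finset.sum_add_distrib]
  -- Partitions with at least two blocks cancel; the one-block partition has weight 1 and
  -- contributes `m S`.
  rw [Finset.sum_eq_single (Finpartition.indiscrete hS)]
  · simp [partitionWeight]
  · intro σ _ hσ
    rw [← add_mul, partitionWeight_add, zero_mul]
    by_contra! h
    have h3 : 0 < σ.parts.card := Finset.card_pos.2 (σ.parts_nonempty hS)
    obtain ⟨C, hC⟩ := Finset.card_eq_one.1 (show σ.parts.card = 1 by omega)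
    apply hσ
    ext1
    have := σ.biUnion_parts
    rw [hC, Finset.singleton_biUnion, id] at this
    rw [hC, this]
    simp
  · simp

/-- Solved for the top cumulant, the recursion determines cumulants by induction on proper subsets.
Invariance under relabelling then follows without transporting partitions. -/
theorem setCumulant_eq_sub (m : Finset τ → ℂ) (hm : m ∅ = 1) {S : Finset τ} {s : τ}
    (hs : s ∈ S) : setCumulant m S =
      m S - ∑ B ∈ S.powerset with s ∈ B ∧ B ≠ S, setCumulant m B * m (S \ B) := by
  rw [eq_sub_iff_add_eq, ← sum_powerset_filter_mem m hm hs,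
    ← moment_eq_sum_setCumulant m hm hs]

/-- The truncated subtraction `0 - 1 = 0` gives the empty partition weight 1. This value is the base
of the induction for relabelling. -/
theorem setCumulant_empty (m : Finset τ → ℂ) : setCumulant m ∅ = 1 := by
  have : (Finset.univ : Finset (Finpartition (∅ : Finset τ))) =
      {Finpartition.empty (Finset τ)} := by
    ext π
    simp only [Finset.mem_univ, Finset.mem_singleton, true_iff]
    exact Subsingleton.elim (α := Finpartition (⊥ : Finset τ)) _ _
  rw [setCumulant, this, Finset.sum_singleton]
  simp [partitionWeight]

/-- Cumulants do not depend on the names of the elements. -/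
theorem setCumulant_map {τ' : Type*} [DecidableEq τ'] (e : τ ↪ τ') (m : Finset τ' → ℂ)
    (hm : m ∅ = 1) (S : Finset τ) :
    setCumulant m (S.map e) = setCumulant (fun B => m (B.map e)) S := by
  induction S using Finset.strongInduction with
  | H S ih =>
    rcases S.eq_empty_or_nonempty with rfl | ⟨s, hs⟩
    · rw [Finset.map_empty, setCumulant_empty, setCumulant_empty]
    · rw [setCumulant_eq_sub m hm (Finset.mem_map_of_mem e hs),
        setCumulant_eq_sub _ (by simpa using hm) hs]
      congr 1
      symm
      refine Finset.sum_bij (fun B _ => B.map e) ?_ ?_ ?_ ?_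
      · intro B hB
        simp only [Finset.mem_filter, Finset.mem_powerset] at hB ⊢
        exact ⟨Finset.map_subset_map.2 hB.1, Finset.mem_map_of_mem e hB.2.1,
          fun h => hB.2.2 (Finset.map_injective e h)⟩
      · intro B _ B' _ h
        exact Finset.map_injective e h
      · intro C hC
        simp only [Finset.mem_filter, Finset.mem_powerset] at hC
        obtain ⟨B, hB, rfl⟩ := Finset.subset_map_iff.1 hC.1
        refine ⟨B, ?_, rfl⟩
        simp only [Finset.mem_filter, Finset.mem_powerset]
        exact ⟨hB, (Finset.mem_map' e).1 hC.2.1, fun h => hC.2.2 (by rw [h])⟩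
      · intro B hB
        simp only [Finset.mem_filter, Finset.mem_powerset] at hB
        rw [ih B (hB.1.ssubset_of_ne hB.2.2)]
        congr 2
        exact Finset.map_sdiff _ _

end SetFunction

/-! ### Cumulants of a linear functional -/

section Functional

variable {A : Type*} [CommRing A] [Algebra ℂ A] (E : A →ₗ[ℂ] ℂ)

/-- The joint cumulant of elements of an algebra with respect to a linear functional. -/
def cumulant {N : ℕ} (x : Fin N → A) : ℂ :=
  setCumulant (fun B => E (∏ j ∈ B, x j)) Finset.univ

/-- The `i`-th argument enters one block only, hence the term of each partition is linear in it. -/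
theorem prod_blocks_update {N : ℕ} (π : Finpartition (Finset.univ : Finset (Fin N)))
    (x : Fin N → A) (i : Fin N) (c : A) :
    ∏ B ∈ π.parts, E (∏ j ∈ B, Function.update x i c j) =
      E (c * ∏ j ∈ π.part i \ {i}, x j) *
        ∏ B ∈ π.parts.erase (π.part i), E (∏ j ∈ B, x j) := by
  have hi := π.part_mem.2 (Finset.mem_univ i)
  rw [← Finset.mul_prod_erase _ _ hi,
    Finset.prod_update_of_mem (π.mem_part_self.2 (Finset.mem_univ i))]
  congr 1
  refine Finset.prod_congr rfl fun B hB => ?_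
  rw [Finset.prod_update_of_notMem]
  intro hiB
  exact (Finset.mem_erase.1 hB).1 (π.part_eq_of_mem (Finset.mem_erase.1 hB).2 hiB).symm

/-- The joint cumulant as a multilinear map. -/
def cumulantMap (N : ℕ) : MultilinearMap ℂ (fun _ : Fin N => A) ℂ :=
  ∑ π : Finpartition (Finset.univ : Finset (Fin N)), partitionWeight π.parts.card •
    MultilinearMap.mk' (fun x : Fin N → A => ∏ B ∈ π.parts, E (∏ j ∈ B, x j))
      (fun x i a b => by
        simp only [prod_blocks_update]
        rw [add_mul, map_add, add_mul])
      (fun x i c a => by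
        simp only [prod_blocks_update]
        rw [smul_mul_assoc, map_smul, smul_mul_assoc])

theorem cumulantMap_apply {N : ℕ} (x : Fin N → A) : cumulantMap E N x = cumulant E x := by
  simp [cumulantMap, cumulant, setCumulant]

theorem cumulant_smul {N : ℕ} (c : Fin N → ℂ) (x : Fin N → A) :
    cumulant E (fun j => c j • x j) = (∏ j, c j) * cumulant E x := by
  rw [← cumulantMap_apply, MultilinearMap.map_smul_univ, cumulantMap_apply, smul_eq_mul]

theorem cumulant_sum {Λ : Type*} [Fintype Λ] [DecidableEq Λ] {N : ℕ} (c : Λ → ℂ) (x : Λ → A) :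
    cumulant E (fun _ : Fin N => ∑ l, c l • x l) =
      ∑ l : Fin N → Λ, (∏ j, c (l j)) * cumulant E (fun j => x (l j)) := by
  rw [← cumulantMap_apply, MultilinearMap.map_sum]
  refine Finset.sum_congr rfl fun l _ => ?_
  rw [cumulantMap_apply, cumulant_smul]

theorem cumulant_comp_perm (hE : E 1 = 1) {N : ℕ} (σ : Equiv.Perm (Fin N)) (x : Fin N → A) :
    cumulant E (fun j => x (σ j)) = cumulant E x := by
  have h := setCumulant_map σ.toEmbedding (fun B => E (∏ j ∈ B, x j)) (by simpa using hE)
    Finset.univ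
  rw [Finset.map_univ_equiv] at h
  rw [cumulant, cumulant, h]
  simp

/-- The cumulants of a single element. -/
def cumulantSelf (x : A) (N : ℕ) : ℂ := cumulant E (fun _ : Fin N => x)

/-- With equal arguments the cumulant of a subset depends only on its cardinality, which turns the
recursion over subsets into one over integers. -/
theorem setCumulant_const (hE : E 1 = 1) (x : A) {τ : Type*} [DecidableEq τ] (S : Finset τ) :
    setCumulant (fun B => E (x ^ B.card)) S = cumulantSelf E x S.card := by
  let e : Fin S.card ↪ τ := S.equivFin.symm.toEmbedding.trans (Function.Embedding.subtype _)
  have h := setCumulant_map e (fun B : Finset τ => E (x ^ B.card)) (by simpa using hE)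
    Finset.univ
  have h2 : Finset.univ.map e = S := by
    ext a
    simp only [e, Finset.mem_map, Finset.mem_univ, true_and, Function.Embedding.trans_apply]
    constructor
    · rintro ⟨b, rfl⟩
      exact (S.equivFin.symm b).2
    · intro ha
      exact ⟨S.equivFin ⟨a, ha⟩, by simp⟩
  rw [h2] at h
  rw [h, cumulantSelf, cumulant]
  simp

/-- The block of a distinguished element takes `j` of the other `D` elements, in `D.choose j` ways.
For exponential generating series this reads M' = K'M. -/
theorem moment_succ (hE : E 1 = 1) (x : A) (D : ℕ) :
    E (x ^ (D + 1)) = ∑ j ∈ Finset.range (D + 1),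
      (D.choose j : ℂ) * cumulantSelf E x (j + 1) * E (x ^ (D - j)) := by
  have h := moment_eq_sum_setCumulant (fun B : Finset (Fin (D + 1)) => E (x ^ B.card))
    (by simpa using hE) (Finset.mem_univ (0 : Fin (D + 1)))
  simp only [Finset.card_univ, Fintype.card_fin, setCumulant_const E hE] at h
  rw [h]
  have h3 : ∑ B ∈ (Finset.univ : Finset (Fin (D + 1))).powerset with 0 ∈ B,
      cumulantSelf E x B.card * E (x ^ (Finset.univ \ B).card) =
      ∑ B ∈ ((Finset.univ : Finset (Fin (D + 1))).erase 0).powerset,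
        cumulantSelf E x (B.card + 1) * E (x ^ (D - B.card)) := by
    refine Finset.sum_bij' (i := fun B _ => B.erase 0) (j := fun B _ => insert 0 B) ?_ ?_ ?_ ?_ ?_
    · intro B hB
      simp only [Finset.mem_powerset]
      exact Finset.erase_subset_erase _ (Finset.subset_univ _)
    · intro B hB
      simp
    · intro B hB
      exact Finset.insert_erase (Finset.mem_filter.1 hB).2
    · intro B hB
      rw [Finset.mem_powerset] at hB
      exact Finset.erase_insert fun h0 => (Finset.mem_erase.1 (hB h0)).1 rfl
    · intro B hB
      have h0 := (Finset.mem_filter.1 hB).2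
      rw [Finset.card_erase_add_one h0, Finset.card_univ_sdiff, Finset.card_erase_of_mem h0,
        Fintype.card_fin]
      have : 0 < B.card := Finset.card_pos.2 ⟨0, h0⟩
      congr 3
      omega
  rw [h3, Finset.sum_powerset_apply_card
    (fun c => cumulantSelf E x (c + 1) * E (x ^ (D - c)))]
  simp [nsmul_eq_mul, mul_assoc]

theorem cumulantSelf_one (hE : E 1 = 1) (x : A) : cumulantSelf E x 1 = E x := by
  have h := moment_succ E hE x 0
  simp [hE] at h
  exact h.symm

theorem cumulantSelf_two (hE : E 1 = 1) (x : A) :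
    cumulantSelf E x 2 = E (x ^ 2) - E x ^ 2 := by
  have h := moment_succ E hE x 1
  simp [Finset.sum_range_succ, hE, cumulantSelf_one E hE] at h
  rw [h]
  ring

end Functional

/-! ### The moment functional of a family of modes -/

section Labels

variable {ι : Type*}

/-- The label of the opposite wavevector. -/
def opp (l : ι × ℤˣ) : ι × ℤˣ := (l.1, -l.2)

@[simp] theorem opp_opp (l : ι × ℤˣ) : opp (opp l) = l := by simp [opp]

@[simp] theorem signedVar_up (α : ι → ℂ) (i : ι) : signedVar α (i, 1) = α i := by
  simp [signedVar]

@[simp] theorem signedVar_dn (α : ι → ℂ) (i : ι) : signedVar α (i, -1) = conj (α i) := by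
  simp [signedVar]

theorem signedVar_opp (α : ι → ℂ) (l : ι × ℤˣ) : signedVar α (opp l) = conj (signedVar α l) := by
  obtain ⟨i, s⟩ := l
  rcases Int.units_eq_one_or s with rfl | rfl <;> simp [opp]

theorem norm_signedVar (α : ι → ℂ) (l : ι × ℤˣ) : ‖signedVar α l‖ = ‖α l.1‖ := by
  obtain ⟨i, s⟩ := l
  rcases Int.units_eq_one_or s with rfl | rfl <;> simp

theorem sum_labels [Fintype ι] {M : Type*} [AddCommMonoid M] (F : ι × ℤˣ → M) :
    ∑ l, F l = ∑ i, (F (i, 1) + F (i, -1)) := by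
  rw [Fintype.sum_prod_type]
  refine Finset.sum_congr rfl fun i _ => ?_
  have h : (Finset.univ : Finset ℤˣ) = {1, -1} := rfl
  rw [h, Finset.sum_pair (by decide)]

/-- The pairing is the real part of ∑ conj(J_i) α_i, written as half the sum of conjugate terms;
this is why `J` carries the label opposite to that of `α`. -/
theorem pairing_eq_sum [Fintype ι] (J α : ι → ℂ) :
    (pairing J α : ℂ) = ∑ l, 1 / 2 * signedVar J (opp l) * signedVar α l := by
  rw [sum_labels, pairing]
  push_cast
  refine Finset.sum_congr rfl fun i _ => ?_
  simp only [opp, neg_neg, signedVar_up, signedVar_dn]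
  apply Complex.ext <;> simp <;> ring

@[simp] theorem polyValue_X (l : ι × ℤˣ) (α : ι → ℂ) :
    polyValue (MvPolynomial.X l) α = signedVar α l := by simp [polyValue]

@[simp] theorem polyValue_C (c : ℂ) (α : ι → ℂ) :
    polyValue (MvPolynomial.C c) α = c := by simp [polyValue]

@[simp] theorem polyValue_one (α : ι → ℂ) : polyValue 1 α = 1 := by simp [polyValue]

@[simp] theorem polyValue_zero (α : ι → ℂ) : polyValue 0 α = 0 := by simp [polyValue]

@[simp] theorem polyValue_add (q r : MvPolynomial (ι × ℤˣ) ℂ) (α : ι → ℂ) :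
    polyValue (q + r) α = polyValue q α + polyValue r α := by simp [polyValue]

@[simp] theorem polyValue_sub (q r : MvPolynomial (ι × ℤˣ) ℂ) (α : ι → ℂ) :
    polyValue (q - r) α = polyValue q α - polyValue r α := by simp [polyValue]

@[simp] theorem polyValue_mul (q r : MvPolynomial (ι × ℤˣ) ℂ) (α : ι → ℂ) :
    polyValue (q * r) α = polyValue q α * polyValue r α := by simp [polyValue]

@[simp] theorem polyValue_smul (c : ℂ) (q : MvPolynomial (ι × ℤˣ) ℂ) (α : ι → ℂ) :
    polyValue (c • q) α = c * polyValue q α := by simp [polyValue, MvPolynomial.smul_eval]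

@[simp] theorem polyValue_sum {κ : Type*} (s : Finset κ) (q : κ → MvPolynomial (ι × ℤˣ) ℂ)
    (α : ι → ℂ) : polyValue (∑ j ∈ s, q j) α = ∑ j ∈ s, polyValue (q j) α := by simp [polyValue]

@[simp] theorem polyValue_prod {κ : Type*} (s : Finset κ) (q : κ → MvPolynomial (ι × ℤˣ) ℂ)
    (α : ι → ℂ) : polyValue (∏ j ∈ s, q j) α = ∏ j ∈ s, polyValue (q j) α := by
  simp [polyValue]

end Labels

section Family

variable {d : ℕ} {L : Fin d → ℝ} [∀ i, Fact (0 < L i)] {Ω : Type*} [MeasurableSpace Ω]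
  {μ : Measure Ω} [IsProbabilityMeasure μ] {f : Torus L → Ω → ℝ} {ι : Type*} {k : ι → Mode d}

theorem normalizedMode_signedMode (l : ι × ℤˣ) (ω : Ω) :
    normalizedMode L μ f (signedMode k l) ω = signedVar (modeVector L μ f k ω) l := by
  obtain ⟨i, s⟩ := l
  rcases Int.units_eq_one_or s with rfl | rfl
  · simp [signedMode, modeVector]
  · simp [signedMode, modeVector, normalizedMode_neg]

theorem powerSpectrum_signedMode (l : ι × ℤˣ) :
    powerSpectrum L μ f (signedMode k l) = powerSpectrum L μ f (k l.1) := by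
  obtain ⟨i, s⟩ := l
  rcases Int.units_eq_one_or s with rfl | rfl
  · simp [signedMode]
  · simp [signedMode, powerSpectrum_neg]

theorem IsModeFamily.sqrt_power_ne_zero (h : IsModeFamily L μ f k) (l : ι × ℤˣ) :
    ((√(powerSpectrum L μ f (signedMode k l)) : ℝ) : ℂ) ≠ 0 := by
  rw [powerSpectrum_signedMode]
  exact_mod_cast (Real.sqrt_pos.2 (h.power_pos l.1)).ne'

theorem IsModeFamily.mode_signedMode (h : IsModeFamily L μ f k) (l : ι × ℤˣ) (ω : Ω) :
    mode L f (signedMode k l) ω = ((√(powerSpectrum L μ f (signedMode k l)) : ℝ) : ℂ) *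
      signedVar (modeVector L μ f k ω) l := by
  rw [← normalizedMode_signedMode, normalizedMode, mul_div_cancel₀ _ (h.sqrt_power_ne_zero l)]

theorem prod_signedVar_modeVector {τ : Type*} [Fintype τ] (l : τ → ι × ℤˣ) (ω : Ω) :
    ∏ j, signedVar (modeVector L μ f k ω) (l j) =
      (∏ j, ((√(powerSpectrum L μ f (signedMode k (l j))) : ℝ) : ℂ)⁻¹) *
        ∏ j, mode L f (signedMode k (l j)) ω := by
  rw [← Finset.prod_mul_distrib]
  refine Finset.prod_congr rfl fun j _ => ?_
  rw [← normalizedMode_signedMode, normalizedMode, div_eq_inv_mul]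

theorem IsModeFamily.integrable_prod (h : IsModeFamily L μ f k) {τ : Type*} [Fintype τ]
    (l : τ → ι × ℤˣ) : Integrable (fun ω => ∏ j, signedVar (modeVector L μ f k ω) (l j)) μ := by
  simp only [prod_signedVar_modeVector]
  exact (h.field.integrable_prod_mode _).const_mul _

theorem IsModeFamily.integrable_polyValue (h : IsModeFamily L μ f k)
    (q : MvPolynomial (ι × ℤˣ) ℂ) :
    Integrable (fun ω => polyValue q (modeVector L μ f k ω)) μ := by
  simp only [polyValue, MvPolynomial.eval_eq]
  refine integrable_finsetSum _ fun s _ => Integrable.const_mul ?_ _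
  -- The monomial is a product over a type with `s l` copies of each label `l`.
  have := h.integrable_prod (fun j : (l : s.support) × Fin (s l) => j.1.1)
  refine this.congr (Filter.Eventually.of_forall fun ω => ?_)
  simp only [Fintype.prod_sigma, Finset.prod_const, Finset.card_univ, Fintype.card_fin]
  exact Finset.prod_coe_sort s.support (fun l => signedVar (modeVector L μ f k ω) l ^ s l)

/-- The expectation of polynomials in the modes. -/
def IsModeFamily.moment (h : IsModeFamily L μ f k) : MvPolynomial (ι × ℤˣ) ℂ →ₗ[ℂ] ℂ where
  toFun q := ∫ ω, polyValue q (modeVector L μ f k ω) ∂μ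
  map_add' q r := by
    simp only [polyValue_add]
    exact integral_add (h.integrable_polyValue q) (h.integrable_polyValue r)
  map_smul' c q := by
    simp only [polyValue_smul, integral_const_mul, RingHom.id_apply, smul_eq_mul]

theorem IsModeFamily.moment_apply (h : IsModeFamily L μ f k) (q : MvPolynomial (ι × ℤˣ) ℂ) :
    h.moment q = ∫ ω, polyValue q (modeVector L μ f k ω) ∂μ := rfl

theorem IsModeFamily.moment_one (h : IsModeFamily L μ f k) : h.moment 1 = 1 := by
  simp [moment_apply]

theorem IsModeFamily.moment_prod_eq_zero (h : IsModeFamily L μ f k) {τ : Type*} (B : Finset τ)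
    (l : τ → ι × ℤˣ) (hl : ∑ j ∈ B, signedMode k (l j) ≠ 0) :
    h.moment (∏ j ∈ B, MvPolynomial.X (l j)) = 0 := by
  rw [moment_apply]
  simp only [polyValue_prod, polyValue_X]
  have h1 : ∀ ω, ∏ j ∈ B, signedVar (modeVector L μ f k ω) (l j) =
      ∏ j : B, signedVar (modeVector L μ f k ω) (l j) := fun ω =>
    (Finset.prod_coe_sort B (fun j => signedVar (modeVector L μ f k ω) (l j))).symm
  simp only [h1, prod_signedVar_modeVector, integral_const_mul]
  rw [h.field.integral_prod_mode_eq_zero, mul_zero]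
  rwa [Finset.sum_coe_sort B (fun j => signedMode k (l j))]

theorem IsModeFamily.ne_zero (h : IsModeFamily L μ f k) (i : ι) : k i ≠ 0 := by
  obtain ⟨H, hH, hk⟩ := h.upper
  intro h0
  exact hH.zero_notMem (h0 ▸ hk i)

theorem IsModeFamily.moment_X (h : IsModeFamily L μ f k) (l : ι × ℤˣ) :
    h.moment (MvPolynomial.X l) = 0 := by
  have := h.moment_prod_eq_zero ({()} : Finset Unit) (fun _ => l)
  rw [Finset.prod_singleton] at this
  apply this
  rw [Finset.sum_singleton]
  obtain ⟨i, s⟩ := l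
  rcases Int.units_eq_one_or s with rfl | rfl <;> simp [signedMode, h.ne_zero i]

/-- A sum of two modes of the upper half stays there and is not zero. So the signs must differ, and
injectivity of `k` identifies the indices. -/
theorem IsModeFamily.eq_opp_of_add_eq_zero (h : IsModeFamily L μ f k) {l l' : ι × ℤˣ}
    (hl : signedMode k l + signedMode k l' = 0) : l' = opp l := by
  obtain ⟨H, hH, hk⟩ := h.upper
  obtain ⟨i, s⟩ := l
  obtain ⟨j, s'⟩ := l'
  have h1 : ∀ i j, k i + k j ≠ 0 := fun i j h0 =>
    hH.zero_notMem (h0 ▸ hH.add_mem _ (hk i) _ (hk j))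
  rcases Int.units_eq_one_or s with rfl | rfl <;> rcases Int.units_eq_one_or s' with rfl | rfl <;>
    simp only [signedMode, Units.val_one, Units.val_neg, one_smul, neg_smul, opp, neg_neg] at hl ⊢
  · exact absurd hl (h1 i j)
  · rw [add_neg_eq_zero] at hl
    rw [h.injective hl]
  · rw [neg_add_eq_zero] at hl
    rw [h.injective hl]
  · rw [← neg_add, neg_eq_zero] at hl
    exact absurd hl (h1 i j)

/-- Off the diagonal the total wavevector is nonzero; on it the moment is the mean of |α|², which
the division by the power spectrum normalizes to 1. -/
theorem IsModeFamily.moment_X_mul_X [DecidableEq ι] (h : IsModeFamily L μ f k) (l l' : ι × ℤˣ) :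
    h.moment (MvPolynomial.X l * MvPolynomial.X l') = if l' = opp l then 1 else 0 := by
  split_ifs with hl
  · subst hl
    rw [moment_apply]
    have h1 : ∀ ω, polyValue (MvPolynomial.X l * MvPolynomial.X (opp l)) (modeVector L μ f k ω) =
        (((powerSpectrum L μ f (k l.1))⁻¹ * ‖mode L f (k l.1) ω‖ ^ 2 : ℝ) : ℂ) := by
      intro ω
      rw [polyValue_mul, polyValue_X, polyValue_X, signedVar_opp, Complex.mul_conj,
        Complex.normSq_eq_norm_sq, norm_signedVar]
      congr 1
      rw [modeVector, normalizedMode, norm_div, div_pow, Complex.norm_real, Real.norm_eq_abs, sq_abs,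
        Real.sq_sqrt (h.power_pos _).le, div_eq_inv_mul]
    simp only [h1]
    rw [integral_complex_ofReal, integral_const_mul]
    change (((powerSpectrum L μ f (k l.1))⁻¹ * powerSpectrum L μ f (k l.1) : ℝ) : ℂ) = 1
    rw [inv_mul_cancel₀ (h.power_pos _).ne', Complex.ofReal_one]
  · have := h.moment_prod_eq_zero (Finset.univ : Finset (Fin 2)) ![l, l']
    rw [Fin.prod_univ_two] at this
    refine this ?_
    rw [Fin.sum_univ_two]
    exact fun h0 => hl (h.eq_opp_of_add_eq_zero h0)

theorem IsModeFamily.jointCumulant_eq (h : IsModeFamily L μ f k) {N : ℕ}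
    (x : Fin N → MvPolynomial (ι × ℤˣ) ℂ) :
    jointCumulant μ (fun j ω => polyValue (x j) (modeVector L μ f k ω)) = cumulant h.moment x := by
  simp only [jointCumulant, cumulant, setCumulant, partitionWeight, moment_apply, polyValue_prod]

/-- If the total wavevector is nonzero, every partition has a block with nonzero total, and the
moment of that block vanishes. -/
theorem IsModeFamily.cumulant_eq_zero (h : IsModeFamily L μ f k) {N : ℕ} (l : Fin N → ι × ℤˣ)
    (hl : ∑ j, signedMode k (l j) ≠ 0) :
    cumulant h.moment (fun j => MvPolynomial.X (l j)) = 0 := by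
  rw [cumulant, setCumulant]
  refine Finset.sum_eq_zero fun π _ => ?_
  have h1 : ∑ j, signedMode k (l j) = ∑ B ∈ π.parts, ∑ j ∈ B, signedMode k (l j) := by
    have h2 := Finset.sum_biUnion (f := fun j => signedMode k (l j)) π.disjoint
    rwa [π.biUnion_parts] at h2
  rw [h1] at hl
  obtain ⟨B, hB, hBl⟩ := Finset.exists_ne_zero_of_sum_ne_zero hl
  rw [Finset.prod_eq_zero hB (h.moment_prod_eq_zero B l hBl), mul_zero]

/-- The Kronecker delta can be dropped because the cumulant itself vanishes off the zero-sum set.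
The factors √P come out by multilinearity. -/
theorem IsModeFamily.pSpec_eq (h : IsModeFamily L μ f k) (N : ℕ) (l : Fin N → ι × ℤˣ) :
    pSpec L μ f k N l = ((√(boxVolume L) : ℝ) : ℂ) ^ ((N : ℤ) - 2) *
      cumulant h.moment (fun j => MvPolynomial.X (l j)) := by
  rw [pSpec, normalizedPolyspectrum]
  split_ifs with hl
  · have h1 : jointCumulant μ (fun j => mode L f (signedMode k (l j))) =
        (∏ j, ((√(powerSpectrum L μ f (signedMode k (l j))) : ℝ) : ℂ)) *
          cumulant h.moment (fun j => MvPolynomial.X (l j)) := by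
      rw [← cumulant_smul, ← h.jointCumulant_eq]
      congr 1
      funext j ω
      rw [polyValue_smul, polyValue_X, h.mode_signedMode]
    rw [polyspectrum, h1, Complex.ofReal_prod]
    have h2 : (∏ j, ((√(powerSpectrum L μ f (signedMode k (l j))) : ℝ) : ℂ)) ≠ 0 :=
      Finset.prod_ne_zero_iff.2 fun j _ => h.sqrt_power_ne_zero (l j)
    field_simp
  · rw [h.cumulant_eq_zero l hl, mul_zero]

theorem pSpec_eq_zero {N : ℕ} (l : Fin N → ι × ℤˣ) (hl : ∑ j, signedMode k (l j) ≠ 0) :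
    pSpec L μ f k N l = 0 := by
  rw [pSpec, normalizedPolyspectrum, if_neg hl]

theorem IsModeFamily.pSpec_perm (h : IsModeFamily L μ f k) {N : ℕ} (σ : Equiv.Perm (Fin N))
    (l : Fin N → ι × ℤˣ) : pSpec L μ f k N (fun j => l (σ j)) = pSpec L μ f k N l := by
  rw [h.pSpec_eq, h.pSpec_eq, cumulant_comp_perm h.moment h.moment_one σ
    (fun j => MvPolynomial.X (l j))]

/-- A complex linear form in the modes. -/
def linForm [Fintype ι] (c : ι × ℤˣ → ℂ) : MvPolynomial (ι × ℤˣ) ℂ := ∑ l, c l • MvPolynomial.X l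

theorem IsModeFamily.cumulantSelf_linForm_two [Fintype ι] [DecidableEq ι]
    (h : IsModeFamily L μ f k) (c : ι × ℤˣ → ℂ) :
    cumulantSelf h.moment (linForm c) 2 = ∑ l, c l * c (opp l) := by
  rw [cumulantSelf_two _ h.moment_one]
  have h1 : h.moment (linForm c) = 0 := by
    simp [linForm, h.moment_X]
  rw [h1, sq, linForm, Finset.sum_mul_sum, map_sum]
  simp only [map_sum, smul_mul_smul_comm, map_smul, h.moment_X_mul_X, smul_eq_mul]
  simp

/-- The power of √V assigned to order n is exactly the one in the definition of the polyspectra, so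
the right side has no explicit volume factor. -/
theorem IsModeFamily.cumulantSelf_linForm [Fintype ι] [DecidableEq ι]
    (h : IsModeFamily L μ f k) (c : ι × ℤˣ → ℂ) (n : ℕ) :
    ((√(boxVolume L) : ℝ) : ℂ) ^ n * cumulantSelf h.moment (linForm c) (n + 2) =
      ∑ l : Fin (n + 2) → ι × ℤˣ, (∏ j, c (l j)) * pSpec L μ f k (n + 2) l := by
  rw [cumulantSelf, linForm, cumulant_sum, Finset.mul_sum]
  refine Finset.sum_congr rfl fun l _ => ?_
  rw [h.pSpec_eq]
  have : (((n + 2 : ℕ) : ℤ) - 2) = (n : ℤ) := by push_cast; ring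
  rw [this, zpow_natCast]
  ring

theorem IsModeFamily.pairingCumulant_eq [Fintype ι] (h : IsModeFamily L μ f k) (J : ι → ℂ)
    (N : ℕ) : pairingCumulant L μ f k J N =
      cumulantSelf h.moment (linForm fun l => 1 / 2 * signedVar J (opp l)) N := by
  rw [pairingCumulant, cumulantSelf, ← h.jointCumulant_eq]
  congr 1
  funext j ω
  rw [pairing_eq_sum, linForm]
  simp

end Family

/-! ### Polynomials times Gaussians -/

section Gaussian

variable {ι : Type*} [Fintype ι]

/-- The Gaussian weight `exp (-b ∑ |α_i|²)`. -/
def gaussWeight (b : ℝ) (α : ι → ℂ) : ℂ := ∏ i, Complex.exp (-(b : ℂ) * (‖α i‖ : ℂ) ^ 2)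

/-- Half of the Gaussian absorbs the monomial, and the other half is integrable. -/
theorem integrable_pow_mul_gauss {b : ℝ} (hb : 0 < b) (m n : ℕ) :
    Integrable fun z : ℂ => z ^ m * conj z ^ n * Complex.exp (-(b : ℂ) * (‖z‖ : ℂ) ^ 2) := by
  have h1 := GaussianFourier.integrable_cexp_neg_mul_sq_norm_add (V := ℂ) (b := ((b / 2 : ℝ) : ℂ))
    (by simpa using hb) 0 0
  have h2 : Integrable fun z : ℂ => Real.exp (-(b / 2) * ‖z‖ ^ 2) := by
    refine h1.norm.congr (Filter.Eventually.of_forall fun z => ?_)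
    simp only [zero_mul, add_zero, Complex.norm_exp]
    congr 1
    rw [← Complex.ofReal_neg, ← Complex.ofReal_pow, ← Complex.ofReal_mul, Complex.ofReal_re]
  -- With N = m + n, the constant comes from x^N ≤ 1 + x^{2N} and y^N / N! ≤ e^y at y = b x² / 2.
  refine (h2.const_mul (1 + (m + n).factorial * (2 / b) ^ (m + n))).mono' ?_
    (Filter.Eventually.of_forall fun z => ?_)
  · have : Continuous fun z : ℂ =>
        z ^ m * conj z ^ n * Complex.exp (-(b : ℂ) * (‖z‖ : ℂ) ^ 2) := by
      have := Complex.continuous_conj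
      fun_prop
    exact this.aestronglyMeasurable
  · have hn : ‖z ^ m * conj z ^ n * Complex.exp (-(b : ℂ) * (‖z‖ : ℂ) ^ 2)‖ =
        ‖z‖ ^ (m + n) * Real.exp (-b * ‖z‖ ^ 2) := by
      rw [norm_mul, norm_mul, norm_pow, norm_pow, RCLike.norm_conj, ← pow_add, Complex.norm_exp]
      congr 2
      rw [← Complex.ofReal_neg, ← Complex.ofReal_pow, ← Complex.ofReal_mul, Complex.ofReal_re]
    have hx := norm_nonneg z
    generalize ‖z‖ = x at hn hx ⊢
    rw [hn]
    have e1 : Real.exp (-b * x ^ 2) = Real.exp (-(b / 2) * x ^ 2) * Real.exp (-(b / 2 * x ^ 2)) := by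
      rw [← Real.exp_add]
      congr 1
      ring
    have e2 : x ^ (m + n) ≤
        (1 + (m + n).factorial * (2 / b) ^ (m + n)) * Real.exp (b / 2 * x ^ 2) := by
      have hy : 0 ≤ b / 2 * x ^ 2 := by positivity
      have a1 := Real.pow_div_factorial_le_exp _ hy (m + n)
      have a2 : 1 ≤ Real.exp (b / 2 * x ^ 2) := Real.one_le_exp hy
      have a3 : x ^ (m + n) ≤ 1 + (x ^ (m + n)) ^ 2 := by nlinarith [sq_nonneg (x ^ (m + n) - 1)]
      have a4 : (x ^ (m + n)) ^ 2 = (m + n).factorial * (2 / b) ^ (m + n) *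
          ((b / 2 * x ^ 2) ^ (m + n) / (m + n).factorial) := by
        have : ((m + n).factorial : ℝ) ≠ 0 := by positivity
        rw [mul_pow]
        field_simp
        rw [← mul_pow, show 2 / b * (b / 2) = 1 by field_simp]
        ring
      have a5 : (m + n).factorial * (2 / b) ^ (m + n) *
          ((b / 2 * x ^ 2) ^ (m + n) / (m + n).factorial) ≤
          (m + n).factorial * (2 / b) ^ (m + n) * Real.exp (b / 2 * x ^ 2) :=
        mul_le_mul_of_nonneg_left a1 (by positivity)
      linarith
    have e3 : Real.exp (b / 2 * x ^ 2) * Real.exp (-(b / 2 * x ^ 2)) = 1 := by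
      rw [← Real.exp_add]
      simp
    calc x ^ (m + n) * Real.exp (-b * x ^ 2)
        ≤ (1 + (m + n).factorial * (2 / b) ^ (m + n)) * Real.exp (b / 2 * x ^ 2) *
            Real.exp (-b * x ^ 2) := mul_le_mul_of_nonneg_right e2 (Real.exp_pos _).le
      _ = (1 + (m + n).factorial * (2 / b) ^ (m + n)) * Real.exp (-(b / 2) * x ^ 2) := by
          rw [e1]
          linear_combination (1 + (m + n).factorial * (2 / b) ^ (m + n)) *
            Real.exp (-(b / 2) * x ^ 2) * e3

theorem integrable_polyValue_mul_gaussWeight {b : ℝ} (hb : 0 < b)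
    (q : MvPolynomial (ι × ℤˣ) ℂ) : Integrable fun α : ι → ℂ => polyValue q α * gaussWeight b α := by
  simp only [polyValue, MvPolynomial.eval_eq', Finset.sum_mul]
  refine integrable_finsetSum _ fun s _ => ?_
  have h1 : ∀ α : ι → ℂ, MvPolynomial.coeff s q * (∏ l, signedVar α l ^ s l) * gaussWeight b α =
      MvPolynomial.coeff s q * ∏ i, (α i ^ s (i, 1) * conj (α i) ^ s (i, -1) *
        Complex.exp (-(b : ℂ) * (‖α i‖ : ℂ) ^ 2)) := by
    intro α
    rw [gaussWeight, Fintype.prod_prod_type, mul_assoc, ← Finset.prod_mul_distrib]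
    congr 1
    refine Finset.prod_congr rfl fun i _ => ?_
    have h : (Finset.univ : Finset ℤˣ) = {1, -1} := rfl
    rw [h, Finset.prod_pair (by decide), signedVar_up, signedVar_dn]
  simp only [h1]
  refine Integrable.const_mul ?_ _
  exact Integrable.fintype_prod (f := fun i z => z ^ s (i, 1) * conj z ^ s (i, -1) *
        Complex.exp (-(b : ℂ) * (‖z‖ : ℂ) ^ 2)) fun i => integrable_pow_mul_gauss hb _ _

theorem continuous_signedVar (l : ι × ℤˣ) : Continuous fun α : ι → ℂ => signedVar α l := by
  obtain ⟨i, s⟩ := l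
  rcases Int.units_eq_one_or s with rfl | rfl
  · simp only [signedVar_up]
    fun_prop
  · simp only [signedVar_dn]
    exact Complex.continuous_conj.comp (continuous_apply i)

theorem continuous_polyValue (q : MvPolynomial (ι × ℤˣ) ℂ) : Continuous (polyValue q) := by
  unfold polyValue
  simp only [MvPolynomial.eval_eq']
  refine continuous_finsetSum _ fun s _ => continuous_const.mul
    (continuous_finsetProd _ fun l _ => (continuous_signedVar l).pow _)

theorem continuous_gaussWeight (b : ℝ) : Continuous (gaussWeight b : (ι → ℂ) → ℂ) := by
  unfold gaussWeight
  fun_prop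

/-! ### The derivatives `∂/∂α_{±𝐤}` -/

/-- The coordinate `α_{±𝐤_i}` as a real-linear map. -/
def signedCLM (l : ι × ℤˣ) : (ι → ℂ) →L[ℝ] ℂ :=
  if l.2 = 1 then ContinuousLinearMap.proj l.1
  else (Complex.conjCLE : ℂ →L[ℝ] ℂ).comp (ContinuousLinearMap.proj l.1)

theorem signedCLM_apply (l : ι × ℤˣ) (α : ι → ℂ) : signedCLM l α = signedVar α l := by
  unfold signedCLM signedVar
  split_ifs <;> simp

/-- The real-linear map with components `a l` along the coordinates `α_l`. -/
def modeCLM (a : ι × ℤˣ → ℂ) : (ι → ℂ) →L[ℝ] ℂ :=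
  ∑ l, (ContinuousLinearMap.mul ℝ ℂ (a l)).comp (signedCLM l)

theorem modeCLM_apply (a : ι × ℤˣ → ℂ) (v : ι → ℂ) :
    modeCLM a v = ∑ l, a l * signedVar v l := by
  simp [modeCLM, signedCLM_apply]

/-- `a l` are the derivatives of `F` along `α_l`, treated as independent variables. -/
def HasModeDeriv (F : (ι → ℂ) → ℂ) (a : ι × ℤˣ → ℂ) (α : ι → ℂ) : Prop :=
  HasFDerivAt F (modeCLM a) α

/-- Conjugation fixes 1 and negates `I`, so the combination of these two directional derivatives
isolates a single component. -/
theorem HasModeDeriv.modeDeriv [DecidableEq ι] {F : (ι → ℂ) → ℂ} {a : ι × ℤˣ → ℂ} {α : ι → ℂ}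
    (h : HasModeDeriv F a α) (l : ι × ℤˣ) : modeDeriv l F α = a l := by
  obtain ⟨i, s⟩ := l
  have h' : fderiv ℝ F α = modeCLM a := HasFDerivAt.fderiv h
  rw [FourierModes.modeDeriv, h']
  simp only [modeCLM_apply, sum_labels, signedVar_up, signedVar_dn]
  rw [Finset.sum_eq_single i, Finset.sum_eq_single i]
  · simp only [Pi.single_eq_same, map_one, Complex.conj_I]
    rcases Int.units_eq_one_or s with rfl | rfl
    · push_cast
      linear_combination (-1 / 2 * a (i, 1) + 1 / 2 * a (i, -1)) * Complex.I_sq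
    · push_cast
      linear_combination (1 / 2 * a (i, 1) - 1 / 2 * a (i, -1)) * Complex.I_sq
  · intro j _ hj
    simp [Pi.single_eq_of_ne hj]
  · simp
  · intro j _ hj
    simp [Pi.single_eq_of_ne hj]
  · simp

theorem hasModeDeriv_signedVar [DecidableEq ι] (l : ι × ℤˣ) (α : ι → ℂ) :
    HasModeDeriv (fun α => signedVar α l) (Pi.single l 1) α := by
  unfold HasModeDeriv
  have : modeCLM (Pi.single l 1 : ι × ℤˣ → ℂ) = (signedCLM l : (ι → ℂ) →L[ℝ] ℂ) := by
    refine ContinuousLinearMap.ext fun v => ?_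
    rw [modeCLM_apply, signedCLM_apply, Finset.sum_eq_single l]
    · simp
    · intro l' _ h
      simp [Pi.single_eq_of_ne h]
    · simp
  rw [this]
  exact ((signedCLM l).hasFDerivAt).congr_of_eventuallyEq
    (Filter.Eventually.of_forall fun β => (signedCLM_apply l β).symm)

theorem HasModeDeriv.add {F G : (ι → ℂ) → ℂ} {a b : ι × ℤˣ → ℂ} {α : ι → ℂ}
    (hF : HasModeDeriv F a α) (hG : HasModeDeriv G b α) :
    HasModeDeriv (fun α => F α + G α) (fun l => a l + b l) α := by
  unfold HasModeDeriv
  convert! HasFDerivAt.add hF hG using 1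
  refine ContinuousLinearMap.ext fun v => ?_
  change _ = modeCLM a v + modeCLM b v
  simp only [modeCLM_apply, add_mul, Finset.sum_add_distrib]

theorem HasModeDeriv.mul {F G : (ι → ℂ) → ℂ} {a b : ι × ℤˣ → ℂ} {α : ι → ℂ}
    (hF : HasModeDeriv F a α) (hG : HasModeDeriv G b α) :
    HasModeDeriv (fun α => F α * G α) (fun l => F α * b l + G α * a l) α := by
  unfold HasModeDeriv
  convert! HasFDerivAt.mul hF hG using 1
  refine ContinuousLinearMap.ext fun v => ?_
  change _ = F α * modeCLM b v + G α * modeCLM a v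
  simp only [modeCLM_apply, add_mul, Finset.sum_add_distrib, Finset.mul_sum, mul_assoc]

theorem HasModeDeriv.cexp {F : (ι → ℂ) → ℂ} {a : ι × ℤˣ → ℂ} {α : ι → ℂ}
    (hF : HasModeDeriv F a α) :
    HasModeDeriv (fun α => Complex.exp (F α)) (fun l => Complex.exp (F α) * a l) α := by
  unfold HasModeDeriv
  convert! HasFDerivAt.cexp hF using 1
  refine ContinuousLinearMap.ext fun v => ?_
  change _ = Complex.exp (F α) * modeCLM a v
  simp only [modeCLM_apply, Finset.mul_sum, mul_assoc]

theorem hasModeDeriv_polyValue [DecidableEq ι] (q : MvPolynomial (ι × ℤˣ) ℂ) (α : ι → ℂ) :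
    HasModeDeriv (polyValue q) (fun l => polyValue (MvPolynomial.pderiv l q) α) α := by
  induction q using MvPolynomial.induction_on with
  | C c =>
    unfold HasModeDeriv
    have : polyValue (MvPolynomial.C c) = fun _ : ι → ℂ => c := funext fun α => polyValue_C c α
    rw [this]
    convert! hasFDerivAt_const (𝕜 := ℝ) c α using 1
    refine ContinuousLinearMap.ext fun v => ?_
    simp [modeCLM_apply]
  | add p q hp hq =>
    simp only [map_add, polyValue_add]
    have : polyValue (p + q) = fun α : ι → ℂ => polyValue p α + polyValue q α :=
      funext fun α => polyValue_add p q α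
    rw [this]
    exact hp.add hq
  | mul_X p l hp =>
    have : polyValue (p * MvPolynomial.X l) = fun α : ι → ℂ => polyValue p α * signedVar α l :=
      funext fun α => by simp
    rw [this]
    convert hp.mul (hasModeDeriv_signedVar l α) using 1
    funext l'
    rw [Derivation.leibniz, MvPolynomial.pderiv_X]
    simp only [smul_eq_mul, polyValue_add, polyValue_mul, polyValue_X]
    by_cases h : l = l'
    · subst h
      simp
    · rw [Pi.single_eq_of_ne h, Pi.single_eq_of_ne (Ne.symm h)]
      simp

theorem gaussianDensity_eq (α : ι → ℂ) :
    gaussianDensity α = (Real.pi : ℂ)⁻¹ ^ Fintype.card ι * gaussWeight 1 α := by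
  simp [gaussianDensity, gaussWeight, Finset.prod_mul_distrib]

theorem gaussWeight_one_eq (α : ι → ℂ) : gaussWeight 1 α =
    Complex.exp (polyValue (-∑ i, MvPolynomial.X (i, 1) * MvPolynomial.X (i, -1)) α) := by
  rw [gaussWeight, ← Complex.exp_sum]
  congr 1
  rw [← Finset.sum_neg_distrib, polyValue_sum]
  refine Finset.sum_congr rfl fun i _ => ?_
  rw [polyValue, map_neg, map_mul, MvPolynomial.eval_X, MvPolynomial.eval_X, signedVar_up,
    signedVar_dn, Complex.mul_conj, Complex.normSq_eq_norm_sq]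
  push_cast
  ring

theorem pderiv_quadratic [DecidableEq ι] (l : ι × ℤˣ) :
    MvPolynomial.pderiv l (-∑ i : ι, MvPolynomial.X (R := ℂ) (i, (1 : ℤˣ)) * MvPolynomial.X (i, -1)) =
      -MvPolynomial.X (opp l) := by
  obtain ⟨j, s⟩ := l
  rw [map_neg, map_sum, Finset.sum_eq_single j]
  · rw [Derivation.leibniz, MvPolynomial.pderiv_X, MvPolynomial.pderiv_X]
    rcases Int.units_eq_one_or s with rfl | rfl
    · rw [Pi.single_eq_same, Pi.single_eq_of_ne (by simp [Prod.ext_iff])]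
      simp [opp]
    · rw [Pi.single_eq_same, Pi.single_eq_of_ne (by simp [Prod.ext_iff])]
      simp [opp]
  · intro i _ hi
    rw [Derivation.leibniz, MvPolynomial.pderiv_X, MvPolynomial.pderiv_X,
      Pi.single_eq_of_ne (by simp [Prod.ext_iff, hi]),
      Pi.single_eq_of_ne (by simp [Prod.ext_iff, hi])]
    simp
  · simp

/-- The derivation of polynomials times the Gaussian density. -/
def gaussDeriv (l : ι × ℤˣ) (r : MvPolynomial (ι × ℤˣ) ℂ) : MvPolynomial (ι × ℤˣ) ℂ :=
  MvPolynomial.pderiv l r - MvPolynomial.X (opp l) * r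

/-- The logarithmic derivative of the Gaussian along α_l is -α_{-l}. Polynomials times the Gaussian
are thus closed under differentiation, and the calculus reduces to the algebraic operator
`gaussDeriv`. -/
theorem hasModeDeriv_mul_gaussianDensity [DecidableEq ι] (r : MvPolynomial (ι × ℤˣ) ℂ)
    (α : ι → ℂ) : HasModeDeriv (fun α => polyValue r α * gaussianDensity α)
      (fun l => polyValue (gaussDeriv l r) α * gaussianDensity α) α := by
  have h1 : (fun α : ι → ℂ => polyValue r α * gaussianDensity α) = fun α =>
      polyValue (MvPolynomial.C ((Real.pi : ℂ)⁻¹ ^ Fintype.card ι) * r) α *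
        Complex.exp (polyValue (-∑ i, MvPolynomial.X (i, 1) * MvPolynomial.X (i, -1)) α) := by
    funext α
    rw [gaussianDensity_eq, gaussWeight_one_eq, polyValue_mul, polyValue_C]
    ring
  rw [h1]
  convert (hasModeDeriv_polyValue _ α).mul (hasModeDeriv_polyValue _ α).cexp using 1
  funext l
  rw [pderiv_quadratic, gaussianDensity_eq, gaussWeight_one_eq, MvPolynomial.pderiv_C_mul]
  simp only [gaussDeriv, polyValue_sub, polyValue_mul, polyValue_X, polyValue_C]
  have h2 : polyValue (-MvPolynomial.X (opp l)) α = -signedVar α (opp l) := by simp [polyValue]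
  rw [h2]
  ring

theorem integrable_polyValue_mul_gaussianDensity (q : MvPolynomial (ι × ℤˣ) ℂ) :
    Integrable fun α : ι → ℂ => polyValue q α * gaussianDensity α := by
  simp only [gaussianDensity_eq]
  refine ((integrable_polyValue_mul_gaussWeight one_pos q).const_mul
    ((Real.pi : ℂ)⁻¹ ^ Fintype.card ι)).congr (Filter.Eventually.of_forall fun α => ?_)
  simp only
  ring

/-- The Gaussian expectation of polynomials. -/
def gaussMoment : MvPolynomial (ι × ℤˣ) ℂ →ₗ[ℂ] ℂ where
  toFun q := ∫ α : ι → ℂ, polyValue q α * gaussianDensity α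
  map_add' q r := by
    simp only [polyValue_add, add_mul]
    exact integral_add (integrable_polyValue_mul_gaussianDensity q)
      (integrable_polyValue_mul_gaussianDensity r)
  map_smul' c q := by
    simp only [polyValue_smul, mul_assoc, integral_const_mul, RingHom.id_apply, smul_eq_mul]

theorem gaussMoment_apply (q : MvPolynomial (ι × ℤˣ) ℂ) :
    gaussMoment q = ∫ α : ι → ℂ, polyValue q α * gaussianDensity α := rfl

/-- The integrand is a combination of directional derivatives of a function that is integrable
together with its derivatives. Read algebraically, this is Wick's identity for the Gaussian. -/
theorem gaussMoment_gaussDeriv [DecidableEq ι] (l : ι × ℤˣ) (r : MvPolynomial (ι × ℤˣ) ℂ) :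
    gaussMoment (gaussDeriv l r) = 0 := by
  set F : (ι → ℂ) → ℂ := fun α => polyValue r α * gaussianDensity α with hF
  have hd : ∀ α, HasModeDeriv F _ α := hasModeDeriv_mul_gaussianDensity r
  have hdiff : ∀ α, DifferentiableAt ℝ F α := fun α => HasFDerivAt.differentiableAt (hd α)
  have hfd : ∀ v α, fderiv ℝ F α v =
      polyValue (∑ l, signedVar v l • gaussDeriv l r) α * gaussianDensity α := by
    intro v α
    have h := HasFDerivAt.fderiv (hd α)
    rw [h]
    simp only [modeCLM_apply, polyValue_sum, polyValue_smul, Finset.sum_mul]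
    exact Finset.sum_congr rfl fun _ _ => by ring
  have hFint : ∀ v, Integrable fun α => fderiv ℝ F α v := fun v => by
    simp only [hfd]
    exact integrable_polyValue_mul_gaussianDensity _
  have hzero : ∀ v, ∫ α, fderiv ℝ F α v = 0 := by
    intro v
    -- Integration by parts against the constant function 1.
    have := integral_mul_fderiv_eq_neg_fderiv_mul_of_integrable (μ := volume)
      (f := fun _ : ι → ℂ => (1 : ℂ)) (g := F) (v := v) (by simp) (by simpa using hFint v)
      (by simpa using integrable_polyValue_mul_gaussianDensity r) (fun x _ => by simp)
      (fun x _ => hdiff x)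
    simpa using this
  rw [gaussMoment_apply]
  have h2 : ∀ α, polyValue (gaussDeriv l r) α * gaussianDensity α =
      (1 / 2) * (fderiv ℝ F α (Pi.single l.1 1) -
        ((l.2 : ℤ) : ℂ) * Complex.I * fderiv ℝ F α (Pi.single l.1 Complex.I)) :=
    fun α => ((hd α).modeDeriv l).symm
  simp only [h2]
  rw [integral_const_mul, integral_sub (hFint _) ((hFint _).const_mul _), integral_const_mul,
    hzero, hzero]
  simp

end Gaussian

/-! ### Inverse Fourier transforms of polynomials times Gaussians -/

section Fourier

variable {ι : Type*} [Fintype ι]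

/-- The symbol `-i J_{-l} / 2` of `-∂/∂α_l` under the inverse Fourier transform. -/
def symbol (J : ι → ℂ) (l : ι × ℤˣ) : ℂ := -Complex.I / 2 * signedVar J (opp l)

/-- The Fourier integrand of a polynomial in the symbols. -/
def fourierIntegrand (g : MvPolynomial (ι × ℤˣ) ℂ) (α J : ι → ℂ) : ℂ :=
  Complex.exp (Complex.I * pairing J α) * (gaussWeight (1 / 4) J * MvPolynomial.eval (symbol J) g)

/-- The inverse Fourier transform of a polynomial in the symbols times `exp (-∑ |J_i|² / 4)`. -/
def invFourier (g : MvPolynomial (ι × ℤˣ) ℂ) (α : ι → ℂ) : ℂ :=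
  ((2 * Real.pi : ℝ) : ℂ)⁻¹ ^ (2 * Fintype.card ι) * ∫ J : ι → ℂ, fourierIntegrand g α J

/-- Symbols are multiples of the variables J_{-l}, so polynomials in them inherit continuity and
Gaussian integrability from polynomials in J and its conjugates. -/
theorem eval_symbol (g : MvPolynomial (ι × ℤˣ) ℂ) (J : ι → ℂ) :
    MvPolynomial.eval (symbol J) g = polyValue (MvPolynomial.aeval (fun l =>
      MvPolynomial.C (-Complex.I / 2) * MvPolynomial.X (opp l)) g) J := by
  induction g using MvPolynomial.induction_on with
  | C c => simp [MvPolynomial.algebraMap_eq]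
  | add p q hp hq => simp [hp, hq]
  | mul_X p l hp => simp [hp, symbol]

theorem continuous_pairing (α : ι → ℂ) : Continuous fun J : ι → ℂ => pairing J α := by
  unfold pairing
  fun_prop

theorem continuous_fourierIntegrand (g : MvPolynomial (ι × ℤˣ) ℂ) (α : ι → ℂ) :
    Continuous (fourierIntegrand g α) := by
  unfold fourierIntegrand
  simp only [eval_symbol]
  have := continuous_pairing α
  have := continuous_gaussWeight (ι := ι) (1 / 4)
  have := continuous_polyValue (MvPolynomial.aeval (fun l : ι × ℤˣ =>
      MvPolynomial.C (-Complex.I / 2) * MvPolynomial.X (opp l)) g)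
  fun_prop

theorem norm_fourierIntegrand (g : MvPolynomial (ι × ℤˣ) ℂ) (α J : ι → ℂ) :
    ‖fourierIntegrand g α J‖ = ‖gaussWeight (1 / 4) J * MvPolynomial.eval (symbol J) g‖ := by
  rw [fourierIntegrand, norm_mul, mul_comm Complex.I, Complex.norm_exp_ofReal_mul_I, one_mul]

theorem integrable_gaussWeight_mul_eval_symbol (g : MvPolynomial (ι × ℤˣ) ℂ) :
    Integrable fun J : ι → ℂ => gaussWeight (1 / 4) J * MvPolynomial.eval (symbol J) g := by
  simp only [eval_symbol]
  refine (integrable_polyValue_mul_gaussWeight (b := 1 / 4) (by norm_num) _).congr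
    (Filter.Eventually.of_forall fun J => mul_comm _ _)

theorem integrable_fourierIntegrand (g : MvPolynomial (ι × ℤˣ) ℂ) (α : ι → ℂ) :
    Integrable (fourierIntegrand g α) :=
  (integrable_gaussWeight_mul_eval_symbol g).mono
    (continuous_fourierIntegrand g α).aestronglyMeasurable
    (Filter.Eventually.of_forall fun J => (norm_fourierIntegrand g α J).le)

theorem invFourier_add (g g' : MvPolynomial (ι × ℤˣ) ℂ) (α : ι → ℂ) :
    invFourier (g + g') α = invFourier g α + invFourier g' α := by
  unfold invFourier
  rw [← mul_add, ← integral_add (integrable_fourierIntegrand g α)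
    (integrable_fourierIntegrand g' α)]
  congr 2
  funext J
  simp only [fourierIntegrand, map_add]
  ring

theorem invFourier_smul (c : ℂ) (g : MvPolynomial (ι × ℤˣ) ℂ) (α : ι → ℂ) :
    invFourier (c • g) α = c * invFourier g α := by
  unfold invFourier
  rw [mul_left_comm, ← integral_const_mul c]
  congr 2
  funext J
  simp only [fourierIntegrand, MvPolynomial.smul_eval]
  ring

theorem invFourier_sum {κ : Type*} (s : Finset κ) (g : κ → MvPolynomial (ι × ℤˣ) ℂ) (α : ι → ℂ) :
    invFourier (∑ j ∈ s, g j) α = ∑ j ∈ s, invFourier (g j) α := by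
  classical
  induction s using Finset.induction_on with
  | empty => simpa using invFourier_smul 0 0 α
  | insert j s hj ih => rw [Finset.sum_insert hj, Finset.sum_insert hj, invFourier_add, ih]

theorem pairing_eq_sum_inner (J α : ι → ℂ) : pairing J α = ∑ i, inner ℝ (α i) (J i) := by
  unfold pairing
  refine Finset.sum_congr rfl fun i _ => ?_
  simp [Complex.inner]

/-- The integral factorizes into planar Gaussian integrals, each equal to 4π exp(-|α_i|²), and 4π /
(2π)² = 1/π is the normalization of the density. -/
theorem invFourier_one (α : ι → ℂ) : invFourier 1 α = gaussianDensity α := by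
  have h1 : ∀ J : ι → ℂ, fourierIntegrand 1 α J = ∏ i,
      Complex.exp (-((1 / 4 : ℝ) : ℂ) * (‖J i‖ : ℂ) ^ 2 + Complex.I * (inner ℝ (α i) (J i) : ℝ)) := by
    intro J
    simp only [fourierIntegrand, gaussWeight, map_one, mul_one, pairing_eq_sum_inner]
    push_cast
    rw [Finset.mul_sum, Complex.exp_sum, ← Finset.prod_mul_distrib]
    refine Finset.prod_congr rfl fun i _ => ?_
    rw [← Complex.exp_add, add_comm]
  unfold invFourier
  simp only [h1]
  rw [integral_fintype_prod_volume_eq_prod (fun i (z : ℂ) =>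
    Complex.exp (-((1 / 4 : ℝ) : ℂ) * (‖z‖ : ℂ) ^ 2 + Complex.I * (inner ℝ (α i) z : ℝ)))]
  have h2 : ∀ i, ∫ z : ℂ, Complex.exp (-((1 / 4 : ℝ) : ℂ) * (‖z‖ : ℂ) ^ 2 +
      Complex.I * (inner ℝ (α i) z : ℝ)) = 4 * Real.pi * Complex.exp (-(‖α i‖ : ℂ) ^ 2) := by
    intro i
    rw [GaussianFourier.integral_cexp_neg_mul_sq_norm_add (by norm_num) Complex.I (α i)]
    rw [Complex.finrank_real_complex, Complex.I_sq]
    push_cast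
    norm_num
    ring_nf
  simp only [h2]
  rw [Finset.prod_mul_distrib, Finset.prod_const, Finset.card_univ, ← mul_assoc, pow_mul,
    ← mul_pow, gaussianDensity_eq]
  congr 1
  · congr 1
    push_cast
    have : (Real.pi : ℂ) ≠ 0 := by exact_mod_cast Real.pi_ne_zero
    field_simp
    norm_num
  · simp [gaussWeight]

theorem hasModeDeriv_fourierIntegrand [DecidableEq ι] (g : MvPolynomial (ι × ℤˣ) ℂ)
    (α J : ι → ℂ) : HasModeDeriv (fun α => fourierIntegrand g α J)
      (fun l => -fourierIntegrand (MvPolynomial.X l * g) α J) α := by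
  have hE : ∀ α : ι → ℂ, Complex.exp (Complex.I * pairing J α) = Complex.exp
      (polyValue (∑ l, (Complex.I / 2 * signedVar J (opp l)) • MvPolynomial.X l) α) := by
    intro α
    congr 1
    rw [pairing_eq_sum, polyValue_sum, Finset.mul_sum]
    refine Finset.sum_congr rfl fun l _ => ?_
    rw [polyValue_smul, polyValue_X]
    ring
  have h1 : (fun α : ι → ℂ => fourierIntegrand g α J) = fun α =>
      Complex.exp (polyValue (∑ l, (Complex.I / 2 * signedVar J (opp l)) • MvPolynomial.X l) α) *
        polyValue (MvPolynomial.C (gaussWeight (1 / 4) J * MvPolynomial.eval (symbol J) g)) α := by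
    funext α
    rw [polyValue_C, fourierIntegrand, hE]
  rw [h1]
  convert! (hasModeDeriv_polyValue _ α).cexp.mul (hasModeDeriv_polyValue _ α) using 1
  funext l
  have h2 : MvPolynomial.pderiv l (∑ l, (Complex.I / 2 * signedVar J (opp l)) •
      MvPolynomial.X (R := ℂ) l) = MvPolynomial.C (Complex.I / 2 * signedVar J (opp l)) := by
    rw [map_sum, Finset.sum_eq_single l]
    · rw [Derivation.map_smul, MvPolynomial.pderiv_X_self, MvPolynomial.smul_eq_C_mul, mul_one]
    · intro l' _ h
      rw [Derivation.map_smul, MvPolynomial.pderiv_X_of_ne h, smul_zero]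
    · simp
  rw [h2, MvPolynomial.pderiv_C, polyValue_C, polyValue_C, polyValue_zero, ← hE, fourierIntegrand,
    map_mul, MvPolynomial.eval_X, symbol]
  ring

/-- Differentiation under the integral sign: the oscillating exponential has modulus one, so the
dominating function is independent of `α`, and each derivative brings down minus a symbol. -/
theorem invFourier_hasModeDeriv [DecidableEq ι] (g : MvPolynomial (ι × ℤˣ) ℂ) (α : ι → ℂ) :
    HasModeDeriv (invFourier g) (fun l => -invFourier (MvPolynomial.X l * g) α) α := by
  set c : ℂ := ((2 * Real.pi : ℝ) : ℂ)⁻¹ ^ (2 * Fintype.card ι) with hc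
  let F' : (ι → ℂ) → (ι → ℂ) → (ι → ℂ) →L[ℝ] ℂ := fun α J =>
    modeCLM fun l => -fourierIntegrand (MvPolynomial.X l * g) α J
  let bound : (ι → ℂ) → ℝ := fun J => ∑ l : ι × ℤˣ,
    ‖gaussWeight (1 / 4) J * MvPolynomial.eval (symbol J) (MvPolynomial.X l * g)‖ *
      ‖(signedCLM l : (ι → ℂ) →L[ℝ] ℂ)‖
  have hterm : ∀ l : ι × ℤˣ, Continuous fun J : ι → ℂ =>
      (ContinuousLinearMap.mul ℝ ℂ (-fourierIntegrand (MvPolynomial.X l * g) α J)).comp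
        (signedCLM l : (ι → ℂ) →L[ℝ] ℂ) := fun l => by
    have := continuous_fourierIntegrand (MvPolynomial.X l * g) α
    fun_prop
  have hF'cont : Continuous (F' α) := by
    change Continuous fun J => ∑ l : ι × ℤˣ, _
    exact continuous_finsetSum _ fun l _ => hterm l
  have hnorm : ∀ (β J : ι → ℂ) (l : ι × ℤˣ),
      ‖(ContinuousLinearMap.mul ℝ ℂ (-fourierIntegrand (MvPolynomial.X l * g) β J)).comp
        (signedCLM l : (ι → ℂ) →L[ℝ] ℂ)‖ ≤
      ‖gaussWeight (1 / 4) J * MvPolynomial.eval (symbol J) (MvPolynomial.X l * g)‖ *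
        ‖(signedCLM l : (ι → ℂ) →L[ℝ] ℂ)‖ := by
    intro β J l
    refine (ContinuousLinearMap.opNorm_comp_le _ _).trans ?_
    refine mul_le_mul_of_nonneg_right ?_ (norm_nonneg _)
    refine (ContinuousLinearMap.opNorm_mul_apply_le ℝ ℂ _).trans ?_
    rw [norm_neg, norm_fourierIntegrand]
  have hbint : Integrable bound :=
    integrable_finsetSum _ fun l _ => (integrable_gaussWeight_mul_eval_symbol _).norm.mul_const _
  have key := hasFDerivAt_integral_of_dominated_of_fderiv_le (𝕜 := ℝ) (μ := volume)
    (F := fun α J => fourierIntegrand g α J) (F' := F') (x₀ := α) (bound := bound)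
    (s := Set.univ) Filter.univ_mem
    (Filter.Eventually.of_forall fun β => (continuous_fourierIntegrand g β).aestronglyMeasurable)
    (integrable_fourierIntegrand g α) hF'cont.aestronglyMeasurable
    (Filter.Eventually.of_forall fun J β _ =>
      (norm_sum_le _ _).trans (Finset.sum_le_sum fun l _ => hnorm β J l))
    hbint (Filter.Eventually.of_forall fun J β _ => hasModeDeriv_fourierIntegrand g β J)
  have hF'int : Integrable (F' α) := hbint.mono' hF'cont.aestronglyMeasurable
    (Filter.Eventually.of_forall fun J =>
      (norm_sum_le _ _).trans (Finset.sum_le_sum fun l _ => hnorm α J l))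
  have hFint : ∫ J, F' α J = modeCLM fun l =>
      -∫ J, fourierIntegrand (MvPolynomial.X l * g) α J := by
    refine ContinuousLinearMap.ext fun v => ?_
    rw [ContinuousLinearMap.integral_apply hF'int, modeCLM_apply]
    simp only [F', modeCLM_apply]
    have hi : ∀ l : ι × ℤˣ, Integrable fun J =>
        -fourierIntegrand (MvPolynomial.X l * g) α J * signedVar v l := fun l =>
      (integrable_fourierIntegrand _ α).neg.mul_const _
    rw [integral_finsetSum _ fun l _ => hi l]
    refine Finset.sum_congr rfl fun l _ => ?_
    rw [integral_mul_const, integral_neg]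
  rw [hFint] at key
  have h5 : HasModeDeriv (fun α => ∫ J, fourierIntegrand g α J) _ α := key
  convert! (hasModeDeriv_polyValue (MvPolynomial.C c) α).mul h5 using 1
  · funext β
    rw [polyValue_C]
    rfl
  · funext l
    rw [MvPolynomial.pderiv_C, polyValue_C, polyValue_zero, invFourier, hc]
    ring

theorem modeDeriv_invFourier [DecidableEq ι] (g : MvPolynomial (ι × ℤˣ) ℂ) (l : ι × ℤˣ) :
    modeDeriv l (invFourier g) = fun α => -invFourier (MvPolynomial.X l * g) α :=
  funext fun α => (invFourier_hasModeDeriv g α).modeDeriv l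

theorem foldr_modeDeriv_gaussianDensity [DecidableEq ι] (s : List (ι × ℤˣ)) :
    s.foldr modeDeriv gaussianDensity =
      invFourier ((-1 : ℂ) ^ s.length • (s.map MvPolynomial.X).prod) := by
  induction s with
  | nil =>
    funext α
    simp [invFourier_one]
  | cons l s ih =>
    rw [List.foldr_cons, ih, modeDeriv_invFourier]
    funext α
    rw [List.map_cons, List.prod_cons, List.length_cons, mul_smul_comm, invFourier_smul,
      invFourier_smul, pow_succ]
    ring

theorem gaussianDensity_ne_zero (α : ι → ℂ) : gaussianDensity α ≠ 0 := by
  unfold gaussianDensity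
  exact_mod_cast (Finset.prod_pos fun i _ => by positivity).ne'

/-- The sign in the definition of the Hermite polynomials cancels the signs brought down by the
derivatives. This identity translates the whole expansion into algebra in the symbols. -/
theorem genHermite_mul_gaussianDensity [DecidableEq ι] (s : List (ι × ℤˣ)) (α : ι → ℂ) :
    genHermite s α * gaussianDensity α = invFourier (s.map MvPolynomial.X).prod α := by
  rw [genHermite, foldr_modeDeriv_gaussianDensity, invFourier_smul]
  have h1 := gaussianDensity_ne_zero α
  have h2 : ((-1 : ℂ) ^ s.length) * (-1) ^ s.length = 1 := by
    rw [← mul_pow]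
    simp
  field_simp
  linear_combination invFourier (s.map MvPolynomial.X).prod α * h2

/-- The polynomial `H_{l_1 ⋯ l_n}` in the variables `α_l`. -/
def hermPoly : List (ι × ℤˣ) → MvPolynomial (ι × ℤˣ) ℂ
  | [] => 1
  | l :: s => MvPolynomial.X (opp l) * hermPoly s - MvPolynomial.pderiv l (hermPoly s)

theorem invFourier_X_mul [DecidableEq ι] {g r : MvPolynomial (ι × ℤˣ) ℂ}
    (h : ∀ α, invFourier g α = polyValue r α * gaussianDensity α) (l : ι × ℤˣ) (α : ι → ℂ) :
    invFourier (MvPolynomial.X l * g) α = -(polyValue (gaussDeriv l r) α * gaussianDensity α) := by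
  have h1 := congrFun (modeDeriv_invFourier g l) α
  rw [funext h, (hasModeDeriv_mul_gaussianDensity r α).modeDeriv l] at h1
  rw [h1, neg_neg]

theorem invFourier_list [DecidableEq ι] (s : List (ι × ℤˣ)) (α : ι → ℂ) :
    invFourier (s.map MvPolynomial.X).prod α = polyValue (hermPoly s) α * gaussianDensity α := by
  induction s generalizing α with
  | nil => simp [hermPoly, invFourier_one]
  | cons l s ih =>
    rw [List.map_cons, List.prod_cons, invFourier_X_mul ih, hermPoly, gaussDeriv]
    simp only [polyValue_sub]
    ring

/-- Multiplying by a symbol corresponds to applying `-gaussDeriv`, hence the form persists by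
induction on `g`. Its mere existence gives integrability and integration by parts below. -/
theorem exists_invFourier_eq [DecidableEq ι] (g : MvPolynomial (ι × ℤˣ) ℂ) :
    ∃ r : MvPolynomial (ι × ℤˣ) ℂ, ∀ α, invFourier g α = polyValue r α * gaussianDensity α := by
  induction g using MvPolynomial.induction_on with
  | C c =>
    refine ⟨MvPolynomial.C c, fun α => ?_⟩
    have : (MvPolynomial.C c : MvPolynomial (ι × ℤˣ) ℂ) = c • 1 := by
      rw [MvPolynomial.smul_eq_C_mul, mul_one]
    rw [polyValue_C, this, invFourier_smul, invFourier_one]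
  | add p q hp hq =>
    obtain ⟨r, hr⟩ := hp
    obtain ⟨r', hr'⟩ := hq
    exact ⟨r + r', fun α => by rw [invFourier_add, hr, hr', polyValue_add, add_mul]⟩
  | mul_X p l hp =>
    obtain ⟨r, hr⟩ := hp
    refine ⟨-gaussDeriv l r, fun α => ?_⟩
    rw [mul_comm, invFourier_X_mul hr]
    simp [polyValue]

theorem integrable_polyValue_mul_invFourier [DecidableEq ι] (q g : MvPolynomial (ι × ℤˣ) ℂ) :
    Integrable fun α => polyValue q α * invFourier g α := by
  obtain ⟨r, hr⟩ := exists_invFourier_eq g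
  simp only [hr, ← mul_assoc, ← polyValue_mul]
  exact integrable_polyValue_mul_gaussianDensity _

/-- Integration by parts. -/
theorem integral_polyValue_mul_invFourier_X_mul [DecidableEq ι] (q g : MvPolynomial (ι × ℤˣ) ℂ)
    (l : ι × ℤˣ) : ∫ α, polyValue q α * invFourier (MvPolynomial.X l * g) α =
      ∫ α, polyValue (MvPolynomial.pderiv l q) α * invFourier g α := by
  obtain ⟨r, hr⟩ := exists_invFourier_eq g
  have h1 : ∀ α, polyValue q α * invFourier (MvPolynomial.X l * g) α =
      polyValue (-(q * gaussDeriv l r)) α * gaussianDensity α := fun α => by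
    rw [invFourier_X_mul hr]
    simp [polyValue]
    ring
  have h2 : ∀ α, polyValue (MvPolynomial.pderiv l q) α * invFourier g α =
      polyValue (MvPolynomial.pderiv l q * r) α * gaussianDensity α := fun α => by
    rw [hr, polyValue_mul, mul_assoc]
  simp only [h1, h2]
  -- The two sides differ, up to sign, by the Gaussian mean of `gaussDeriv l (q * r)`.
  rw [← gaussMoment_apply, ← gaussMoment_apply, ← sub_eq_zero, ← map_sub, ← neg_eq_zero, ← map_neg,
    ← gaussMoment_gaussDeriv l (q * r)]
  congr 1
  simp only [gaussDeriv, Derivation.leibniz, smul_eq_mul]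
  ring

end Fourier

/-! ### The exponential of a power series, coefficient by coefficient -/

section ExpCoeff

variable {R S : Type*} [CommRing R] [Algebra ℂ R] [CommRing S] [Algebra ℂ S]

/-- The `n`-th coefficient of `exp (∑ c_j ε^j)`, when `c_0 = 0`. -/
def expCoeff (c : ℕ → R) (n : ℕ) : R :=
  ∑ m ∈ Finset.range (n + 1), ((m.factorial : ℂ)⁻¹) • PowerSeries.coeff n (PowerSeries.mk c ^ m)

theorem coeff_pow_eq_zero {h : PowerSeries R} (h0 : PowerSeries.constantCoeff h = 0) {m n : ℕ}
    (hmn : n < m) : PowerSeries.coeff n (h ^ m) = 0 :=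
  PowerSeries.X_pow_dvd_iff.1 (pow_dvd_pow_of_dvd (PowerSeries.X_dvd_iff.2 h0) m) n hmn

/-- Without constant term the m-th power begins at order m, so any cutoff beyond `n` gives the same
value. A cutoff common to all `n` allows sums over `n` and `m` to be exchanged. -/
theorem expCoeff_eq_sum {c : ℕ → R} (h0 : c 0 = 0) {n K : ℕ} (hK : n ≤ K) :
    expCoeff c n = ∑ m ∈ Finset.range (K + 1),
      ((m.factorial : ℂ)⁻¹) • PowerSeries.coeff n (PowerSeries.mk c ^ m) := by
  refine Finset.sum_subset (Finset.range_subset_range.2 (by omega)) fun m _ hm => ?_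
  rw [coeff_pow_eq_zero (by simpa using h0) (by simpa using hm), smul_zero]

theorem map_expCoeff (φ : R →ₐ[ℂ] S) (c : ℕ → R) (n : ℕ) :
    φ (expCoeff c n) = expCoeff (fun j => φ (c j)) n := by
  unfold expCoeff
  rw [map_sum]
  refine Finset.sum_congr rfl fun m _ => ?_
  have h : PowerSeries.mk (fun j => φ (c j)) = PowerSeries.map (φ : R →+* S) (PowerSeries.mk c) := by
    ext j
    simp
  rw [map_smul, h, ← map_pow, PowerSeries.coeff_map]
  rfl

theorem coeff_exp_subst {h : PowerSeries ℂ} (h0 : PowerSeries.constantCoeff h = 0) (n : ℕ) :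
    PowerSeries.coeff n ((PowerSeries.exp ℂ).subst h) =
      expCoeff (fun j => PowerSeries.coeff j h) n := by
  rw [PowerSeries.coeff_subst' (PowerSeries.HasSubst.of_constantCoeff_zero' h0)]
  rw [finsum_eq_sum_of_support_subset (s := Finset.range (n + 1))]
  · unfold expCoeff
    have : PowerSeries.mk (fun j => PowerSeries.coeff j h) = h := by ext; simp
    rw [this]
    refine Finset.sum_congr rfl fun m _ => ?_
    simp [PowerSeries.coeff_exp]
  · intro m hm
    simp only [Finset.coe_range, Set.mem_Iio]
    by_contra! hlt
    exact hm (by simp only; rw [coeff_pow_eq_zero h0 (by omega), smul_zero])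

/-- As `c 0 = 0`, only decompositions of n into m positive parts survive; no part exceeds n, hence
the finite range. -/
theorem coeff_mk_pow {c : ℕ → R} (h0 : c 0 = 0) (m n : ℕ) :
    PowerSeries.coeff n (PowerSeries.mk c ^ m) =
      ∑ ν ∈ (Fintype.piFinset fun _ : Fin m => Finset.Icc 1 n) with ∑ j, ν j = n, ∏ j, c (ν j) := by
  have h1 : PowerSeries.mk c ^ m = ∏ _j : Fin m, PowerSeries.mk c := by simp
  rw [h1, PowerSeries.coeff_prod]
  simp only [PowerSeries.coeff_mk]
  refine Finset.sum_bij_ne_zero (fun l _ _ => (l : Fin m → ℕ)) ?_ ?_ ?_ ?_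
  · intro l hl hne
    have hsum : ∑ j, l j = n := by
      rw [Finset.mem_finsuppAntidiag] at hl
      exact hl.1
    simp only [Finset.mem_filter, Fintype.mem_piFinset, Finset.mem_Icc]
    refine ⟨fun j => ⟨?_, ?_⟩, hsum⟩
    · by_contra! h
      have hj : l j = 0 := by omega
      exact hne (Finset.prod_eq_zero (Finset.mem_univ j) (by rw [hj, h0]))
    · rw [← hsum]
      exact Finset.single_le_sum (f := fun j => l j) (fun _ _ => Nat.zero_le _) (Finset.mem_univ j)
  · intro l _ _ l' _ _ h
    exact DFunLike.coe_injective h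
  · intro ν hν hne
    simp only [Finset.mem_filter] at hν
    refine ⟨Finsupp.equivFunOnFinite.symm ν, ?_, ?_, ?_⟩
    · rw [Finset.mem_finsuppAntidiag]
      exact ⟨hν.2, Finset.subset_univ _⟩
    · exact hne
    · rfl
  · intro l _ _
    rfl

end ExpCoeff

/-! ### The formal density -/

section Density

variable {ι : Type*} [Fintype ι]

/-- The polynomial `(1/(n+2)!) ∑ p^{(n+2)}(l) y_{l_1} ⋯ y_{l_{n+2}}`. -/
def cumulantPoly (p : (N : ℕ) → (Fin N → ι × ℤˣ) → ℂ) (n : ℕ) : MvPolynomial (ι × ℤˣ) ℂ :=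
  if n = 0 then 0
  else (((n + 2).factorial : ℂ)⁻¹) • ∑ l : Fin (n + 2) → ι × ℤˣ,
    p (n + 2) l • ∏ j, MvPolynomial.X (l j)

/-- The `n`-th coefficient of the exponential of the cumulant polynomials. -/
def densityPoly (p : (N : ℕ) → (Fin N → ι × ℤˣ) → ℂ) (n : ℕ) : MvPolynomial (ι × ℤˣ) ℂ :=
  expCoeff (cumulantPoly p) n

theorem cumulantPoly_zero (p : (N : ℕ) → (Fin N → ι × ℤˣ) → ℂ) : cumulantPoly p 0 = 0 := by
  simp [cumulantPoly]

theorem densityPoly_zero (p : (N : ℕ) → (Fin N → ι × ℤˣ) → ℂ) : densityPoly p 0 = 1 := by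
  simp [densityPoly, expCoeff]

/-- Distributing the product over the sums reproduces `expansionCoeff` with monomials in place of
Hermite polynomials. The term m = 0 is absent since n ≥ 1. -/
theorem densityPoly_eq (p : (N : ℕ) → (Fin N → ι × ℤˣ) → ℂ) {n : ℕ} (hn : 1 ≤ n) :
    densityPoly p n = ∑ m ∈ Finset.Icc 1 n, ((m.factorial : ℂ))⁻¹ •
      ∑ ν ∈ (Fintype.piFinset fun _ : Fin m => Finset.Icc 1 n) with ∑ j, ν j = n,
        (∏ j, (((ν j + 2).factorial : ℂ))⁻¹) •
          ∑ l : (j : Fin m) → Fin (ν j + 2) → ι × ℤˣ, (∏ j, p (ν j + 2) (l j)) •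
            ((List.ofFn fun j => List.ofFn (l j)).flatten.map MvPolynomial.X).prod := by
  have h1 : Finset.range (n + 1) = insert 0 (Finset.Icc 1 n) := by
    ext m
    simp only [Finset.mem_range, Finset.mem_insert, Finset.mem_Icc]
    omega
  rw [densityPoly, expCoeff, h1, Finset.sum_insert (by simp), pow_zero, PowerSeries.coeff_one,
    if_neg (by omega), smul_zero, zero_add]
  refine Finset.sum_congr rfl fun m _ => ?_
  congr 1
  rw [coeff_mk_pow (cumulantPoly_zero p)]
  refine Finset.sum_congr rfl fun ν hν => ?_
  have hν0 : ∀ j, ν j ≠ 0 := fun j => by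
    have := Fintype.mem_piFinset.1 (Finset.mem_filter.1 hν).1 j
    rw [Finset.mem_Icc] at this
    omega
  have h2 : ∀ j, cumulantPoly p (ν j) = (((ν j + 2).factorial : ℂ)⁻¹) •
      ∑ l : Fin (ν j + 2) → ι × ℤˣ, p (ν j + 2) l • ∏ i, MvPolynomial.X (l i) := fun j => by
    rw [cumulantPoly, if_neg (hν0 j)]
  simp only [h2]
  rw [Finset.prod_smul, Finset.prod_univ_sum]
  congr 1
  rw [Fintype.piFinset_univ]
  refine Finset.sum_congr rfl fun l _ => ?_
  rw [Finset.prod_smul]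
  congr 1
  rw [List.map_flatten, List.prod_flatten, List.map_ofFn, List.map_ofFn, List.prod_ofFn]
  refine Finset.prod_congr rfl fun j _ => ?_
  simp only [Function.comp_apply, List.map_ofFn]
  rw [List.prod_ofFn]
  rfl

theorem expansionCoeff_mul_gaussianDensity [DecidableEq ι]
    (p : (N : ℕ) → (Fin N → ι × ℤˣ) → ℂ) {n : ℕ} (hn : 1 ≤ n) (α : ι → ℂ) :
    expansionCoeff p n α * gaussianDensity α = invFourier (densityPoly p n) α := by
  rw [densityPoly_eq p hn, expansionCoeff]
  simp only [invFourier_sum, invFourier_smul, ← genHermite_mul_gaussianDensity, Finset.sum_mul,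
    mul_assoc]

end Density

section Family

variable {d : ℕ} {L : Fin d → ℝ} [∀ i, Fact (0 < L i)] {Ω : Type*} [MeasurableSpace Ω]
  {μ : Measure Ω} [IsProbabilityMeasure μ] {f : Torus L → Ω → ℝ} {ι : Type*} {k : ι → Mode d}
  [Fintype ι] [DecidableEq ι]

/-- By the normalized covariance the second cumulant of X is ∑|J_i|²/2. -/
theorem IsModeFamily.exp_pairingCumulant_two (h : IsModeFamily L μ f k) (J : ι → ℂ) :
    Complex.exp ((-Complex.I) ^ 2 / 2 * pairingCumulant L μ f k J 2) = gaussWeight (1 / 4) J := by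
  rw [h.pairingCumulant_eq, h.cumulantSelf_linForm_two, gaussWeight, ← Complex.exp_sum, sum_labels,
    Finset.mul_sum]
  congr 1
  refine Finset.sum_congr rfl fun i _ => ?_
  simp only [opp, neg_neg, signedVar_up, signedVar_dn, neg_sq, Complex.I_sq]
  have := Complex.mul_conj (J i)
  rw [Complex.normSq_eq_norm_sq] at this
  push_cast at this ⊢
  linear_combination -1 / 4 * this

/-- The prefactor (-i/2)^{n+2} is distributed over the n + 2 labels, turning each J_{-l} into a
symbol. -/
theorem IsModeFamily.coeff_cumulantSeries (h : IsModeFamily L μ f k) (J : ι → ℂ) (n : ℕ) :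
    PowerSeries.coeff n (cumulantSeries L μ f k J) =
      MvPolynomial.eval (symbol J) (cumulantPoly (pSpec L μ f k) n) := by
  rw [cumulantSeries, PowerSeries.coeff_mk, cumulantPoly]
  split_ifs with hn
  · simp
  · rw [h.pairingCumulant_eq, h.cumulantSelf_linForm, MvPolynomial.smul_eval, map_sum, Finset.mul_sum,
      Finset.mul_sum]
    refine Finset.sum_congr rfl fun l _ => ?_
    rw [MvPolynomial.smul_eval, MvPolynomial.eval_prod]
    simp only [MvPolynomial.eval_X, symbol, Finset.prod_mul_distrib, Finset.prod_const,
      Finset.card_univ, Fintype.card_fin]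
    have : (-Complex.I / 2) ^ (n + 2) = (-Complex.I) ^ (n + 2) * (1 / 2) ^ (n + 2) := by
      rw [← mul_pow]
      ring
    rw [this]
    ring

/-- Evaluation at the symbols is an algebra homomorphism, so it commutes with extracting
coefficients of the exponential. -/
theorem IsModeFamily.coeff_formalCharFun (h : IsModeFamily L μ f k) (J : ι → ℂ) (n : ℕ) :
    PowerSeries.coeff n (formalCharFun L μ f k J) =
      gaussWeight (1 / 4) J * MvPolynomial.eval (symbol J) (densityPoly (pSpec L μ f k) n) := by
  have h0 : PowerSeries.constantCoeff (cumulantSeries L μ f k J) = 0 := by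
    rw [← PowerSeries.coeff_zero_eq_constantCoeff_apply, h.coeff_cumulantSeries, cumulantPoly_zero,
      map_zero]
  rw [formalCharFun, PowerSeries.coeff_C_mul, h.exp_pairingCumulant_two, coeff_exp_subst h0]
  simp only [h.coeff_cumulantSeries]
  congr 1
  exact (map_expCoeff (MvPolynomial.aeval (symbol J)) _ n).symm

theorem IsModeFamily.integrable_formalCharFun (h : IsModeFamily L μ f k) (n : ℕ) (α : ι → ℂ) :
    Integrable fun J : ι → ℂ => Complex.exp (Complex.I * pairing J α) *
      PowerSeries.coeff n (formalCharFun L μ f k J) := by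
  simp only [h.coeff_formalCharFun]
  exact integrable_fourierIntegrand _ α

theorem IsModeFamily.coeff_formalDensity (h : IsModeFamily L μ f k) (n : ℕ) (α : ι → ℂ) :
    PowerSeries.coeff n (formalDensity L μ f k α) =
      invFourier (densityPoly (pSpec L μ f k) n) α := by
  rw [formalDensity, PowerSeries.coeff_mk]
  simp only [h.coeff_formalCharFun]
  rfl

end Family

/-! ### Moments of the formal density -/

section GaussianSeries

variable {ι : Type*} [Fintype ι] [DecidableEq ι]

theorem gaussMoment_one : gaussMoment (1 : MvPolynomial (ι × ℤˣ) ℂ) = 1 := by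
  rw [gaussMoment_apply]
  simp only [polyValue_one, one_mul, gaussianDensity_eq, gaussWeight]
  rw [integral_const_mul, integral_fintype_prod_volume_eq_prod (fun _ (z : ℂ) =>
    Complex.exp (-((1 : ℝ) : ℂ) * (‖z‖ : ℂ) ^ 2)), Finset.prod_const, Finset.card_univ,
    GaussianFourier.integral_cexp_neg_mul_sq_norm (V := ℂ) (by simp), Complex.finrank_real_complex,
    ← mul_pow]
  have : (Real.pi : ℂ) ≠ 0 := by exact_mod_cast Real.pi_ne_zero
  simp [this]

theorem pderiv_linForm (c : ι × ℤˣ → ℂ) (l : ι × ℤˣ) :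
    MvPolynomial.pderiv l (linForm c) = MvPolynomial.C (c l) := by
  rw [linForm, map_sum, Finset.sum_eq_single l]
  · rw [Derivation.map_smul, MvPolynomial.pderiv_X_self, MvPolynomial.smul_eq_C_mul, mul_one]
  · intro l' _ h
    rw [Derivation.map_smul, MvPolynomial.pderiv_X_of_ne h, smul_zero]
  · simp

theorem pderiv_linForm_pow (c : ι × ℤˣ → ℂ) (l : ι × ℤˣ) (D : ℕ) :
    MvPolynomial.pderiv l (linForm c ^ D) = (D * c l : ℂ) • linForm c ^ (D - 1) := by
  rw [Derivation.leibniz_pow, pderiv_linForm, MvPolynomial.smul_eq_C_mul]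
  simp only [smul_eq_mul, nsmul_eq_mul, map_mul, map_natCast]
  ring

theorem gaussMoment_X_mul (l : ι × ℤˣ) (r : MvPolynomial (ι × ℤˣ) ℂ) :
    gaussMoment (MvPolynomial.X l * r) = gaussMoment (MvPolynomial.pderiv (opp l) r) := by
  have h := gaussMoment_gaussDeriv (opp l) r
  rw [gaussDeriv, map_sub, opp_opp, sub_eq_zero] at h
  exact h.symm

/-- Wick contraction of one factor with each of the `D` others. For `D = 0` the truncated exponent
is harmless, as the factor `D` vanishes. -/
theorem gaussMoment_linForm_pow_succ (c : ι × ℤˣ → ℂ) (D : ℕ) :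
    gaussMoment (linForm c ^ (D + 1)) =
      (∑ l, c l * c (opp l)) * (D * gaussMoment (linForm c ^ (D - 1))) := by
  have h1 : linForm c ^ (D + 1) = ∑ l, c l • (MvPolynomial.X l * linForm c ^ D) := by
    rw [pow_succ', linForm, Finset.sum_mul]
    simp only [smul_mul_assoc]
  rw [h1, map_sum, Finset.sum_mul]
  refine Finset.sum_congr rfl fun l _ => ?_
  rw [map_smul, gaussMoment_X_mul, pderiv_linForm_pow, map_smul, smul_eq_mul, smul_eq_mul]
  ring

/-- The exponential generating series of the moments of an element. -/
def momentSeries {A : Type*} [CommRing A] [Algebra ℂ A] (E : A →ₗ[ℂ] ℂ) (x : A) : PowerSeries ℂ :=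
  PowerSeries.mk fun D => E (x ^ D) / D.factorial

theorem coeff_derivative_momentSeries {A : Type*} [CommRing A] [Algebra ℂ A] (E : A →ₗ[ℂ] ℂ) (x : A)
    (D : ℕ) : PowerSeries.coeff D (PowerSeries.derivative ℂ (momentSeries E x)) =
      E (x ^ (D + 1)) / D.factorial := by
  rw [PowerSeries.coeff_derivative, momentSeries, PowerSeries.coeff_mk, Nat.factorial_succ]
  have h1 : (D.factorial : ℂ) ≠ 0 := by exact_mod_cast D.factorial_ne_zero
  have h2 : ((D : ℂ) + 1) ≠ 0 := by exact_mod_cast D.succ_ne_zero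
  push_cast
  field_simp

/-- The Wick recursion as a first-order equation G' = κtG. The constant κ is also the second
cumulant of the same linear form in the modes, by `cumulantSelf_linForm_two`. -/
theorem derivative_gaussSeries (c : ι × ℤˣ → ℂ) :
    PowerSeries.derivative ℂ (momentSeries gaussMoment (linForm c)) =
      PowerSeries.C (∑ l, c l * c (opp l)) * PowerSeries.X *
        momentSeries gaussMoment (linForm c) := by
  ext D
  rw [coeff_derivative_momentSeries, gaussMoment_linForm_pow_succ, mul_assoc,
    PowerSeries.coeff_C_mul]
  rcases D with _ | D
  · simp
  · rw [PowerSeries.coeff_succ_X_mul, momentSeries, PowerSeries.coeff_mk, Nat.factorial_succ]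
    have h1 : (D.factorial : ℂ) ≠ 0 := by exact_mod_cast D.factorial_ne_zero
    have h2 : ((D : ℂ) + 1) ≠ 0 := by exact_mod_cast D.succ_ne_zero
    push_cast
    field_simp

/-- The restriction of a polynomial to the line spanned by `c`, as a power series. -/
def lineSeries (c : ι × ℤˣ → ℂ) : MvPolynomial (ι × ℤˣ) ℂ →ₐ[ℂ] PowerSeries ℂ :=
  MvPolynomial.aeval fun l => PowerSeries.C (c l) * PowerSeries.X

/-- Testing against all powers amounts to testing against exp(t ∑ c_l α_l), for which ∂/∂α_l is
multiplication by c_l t. Integration by parts therefore restricts `g` to the line tc and leaves the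
Gaussian moment series. -/
theorem integral_linForm_pow_mul_invFourier (c : ι × ℤˣ → ℂ) (g : MvPolynomial (ι × ℤˣ) ℂ) (D : ℕ) :
    ∫ α, polyValue (linForm c ^ D) α * invFourier g α = D.factorial *
      PowerSeries.coeff D (lineSeries c g * momentSeries gaussMoment (linForm c)) := by
  induction g using MvPolynomial.induction_on generalizing D with
  | C a =>
    have h1 : (MvPolynomial.C a : MvPolynomial (ι × ℤˣ) ℂ) = a • 1 := by
      rw [MvPolynomial.smul_eq_C_mul, mul_one]
    have h2 : ∀ α : ι → ℂ, polyValue (linForm c ^ D) α * invFourier (MvPolynomial.C a) α =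
        a * (polyValue (linForm c ^ D) α * gaussianDensity α) := fun α => by
      rw [h1, invFourier_smul, invFourier_one]
      ring
    simp only [h2]
    rw [integral_const_mul, ← gaussMoment_apply, h1, map_smul, map_one, smul_mul_assoc, one_mul,
      PowerSeries.coeff_smul, momentSeries, PowerSeries.coeff_mk, smul_eq_mul]
    have h3 : (D.factorial : ℂ) ≠ 0 := by exact_mod_cast D.factorial_ne_zero
    field_simp
  | add p q hp hq =>
    have h1 : ∀ α : ι → ℂ, polyValue (linForm c ^ D) α * invFourier (p + q) α =
        polyValue (linForm c ^ D) α * invFourier p α +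
          polyValue (linForm c ^ D) α * invFourier q α := fun α => by
      rw [invFourier_add, mul_add]
    simp only [h1]
    rw [integral_add (integrable_polyValue_mul_invFourier _ _)
      (integrable_polyValue_mul_invFourier _ _), hp, hq, map_add, add_mul, map_add, mul_add]
  | mul_X p l hp =>
    rw [mul_comm p, integral_polyValue_mul_invFourier_X_mul, pderiv_linForm_pow]
    simp only [polyValue_smul, mul_assoc]
    rw [integral_const_mul, integral_const_mul, hp, map_mul (lineSeries c)]
    have h1 : lineSeries c (MvPolynomial.X l) = PowerSeries.C (c l) * PowerSeries.X := by
      simp [lineSeries]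
    rw [h1, mul_assoc, mul_assoc, PowerSeries.coeff_C_mul]
    rcases D with _ | D
    · simp
    · rw [PowerSeries.coeff_succ_X_mul, Nat.factorial_succ]
      push_cast
      ring

end GaussianSeries

/-! ### The moment series as an exponential of cumulants -/

section CumulantSeries

variable {A : Type*} [CommRing A] [Algebra ℂ A] (E : A →ₗ[ℂ] ℂ)

/-- The equation expresses (n + 1) times the coefficient of order n + 1 through lower ones, and n +
1 is invertible. -/
theorem eq_of_derivative_eq_mul {K F G : PowerSeries ℂ} (hF : PowerSeries.derivative ℂ F = K * F)
    (hG : PowerSeries.derivative ℂ G = K * G)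
    (h0 : PowerSeries.coeff 0 F = PowerSeries.coeff 0 G) : F = G := by
  ext n
  induction n using Nat.strong_induction_on with
  | _ n ih =>
    rcases n with _ | n
    · exact h0
    · have h1 : PowerSeries.coeff n (PowerSeries.derivative ℂ F) =
          PowerSeries.coeff n (PowerSeries.derivative ℂ G) := by
        rw [hF, hG, PowerSeries.coeff_mul, PowerSeries.coeff_mul]
        refine Finset.sum_congr rfl fun x hx => ?_
        rw [Finset.HasAntidiagonal.mem_antidiagonal] at hx
        rw [ih x.2 (by omega)]
      rw [PowerSeries.coeff_derivative, PowerSeries.coeff_derivative] at h1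
      exact mul_right_cancel₀ (by exact_mod_cast n.succ_ne_zero) h1

/-- The cumulants of order at least three, as the coefficients of a generating series divided by
the square of its variable. -/
def higherCumulants (x : A) (n : ℕ) : ℂ :=
  if n = 0 then 0 else cumulantSelf E x (n + 2) / (n + 2).factorial

/-- This is M' = K'M from `moment_succ`, with K' split into its quadratic part and the rest; the
vanishing mean removes the first cumulant. -/
theorem derivative_momentSeries (hE : E 1 = 1) {x : A} (hx : E x = 0) :
    PowerSeries.derivative ℂ (momentSeries E x) =
      (PowerSeries.C (cumulantSelf E x 2) * PowerSeries.X +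
        PowerSeries.derivative ℂ (PowerSeries.X ^ 2 * PowerSeries.mk (higherCumulants E x))) *
        momentSeries E x := by
  have hK : PowerSeries.C (cumulantSelf E x 2) * PowerSeries.X +
      PowerSeries.derivative ℂ (PowerSeries.X ^ 2 * PowerSeries.mk (higherCumulants E x)) =
      PowerSeries.mk fun j => cumulantSelf E x (j + 1) / j.factorial := by
    ext j
    rw [map_add, PowerSeries.coeff_C_mul, PowerSeries.coeff_derivative, PowerSeries.coeff_mk,
      PowerSeries.coeff_X_pow_mul']
    rcases j with _ | _ | j
    · simp [cumulantSelf_one E hE, hx]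
    · simp [PowerSeries.coeff_X, higherCumulants]
    · rw [if_pos (by omega), PowerSeries.coeff_X, if_neg (by omega), PowerSeries.coeff_mk,
        show j + 1 + 1 + 1 - 2 = j + 1 by omega, higherCumulants, if_neg (by omega),
        show j + 1 + 2 = (j + 1 + 1) + 1 by omega, Nat.factorial_succ (j + 1 + 1)]
      have h1 : ((j + 1 + 1).factorial : ℂ) ≠ 0 := by exact_mod_cast (j + 1 + 1).factorial_ne_zero
      have h2 : ((j : ℂ) + 1 + 1 + 1) ≠ 0 := by exact_mod_cast (j + 1 + 1).succ_ne_zero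
      push_cast
      field_simp
      ring
  rw [hK]
  ext D
  rw [coeff_derivative_momentSeries, moment_succ E hE, PowerSeries.coeff_mul,
    Finset.Nat.sum_antidiagonal_eq_sum_range_succ_mk, Finset.sum_div]
  refine Finset.sum_congr rfl fun j hj => ?_
  rw [momentSeries, PowerSeries.coeff_mk, PowerSeries.coeff_mk,
    Nat.cast_choose ℂ (Nat.le_of_lt_succ (Finset.mem_range.1 hj))]
  have h1 : (j.factorial : ℂ) ≠ 0 := by exact_mod_cast j.factorial_ne_zero
  have h2 : ((D - j).factorial : ℂ) ≠ 0 := by exact_mod_cast (D - j).factorial_ne_zero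
  have h3 : (D.factorial : ℂ) ≠ 0 := by exact_mod_cast D.factorial_ne_zero
  field_simp

/-- Both sides solve F' = K'F with constant term 1. Only the differential equation of `G` matters,
so `G` may be the moment series of another functional, namely the Gaussian one. -/
theorem momentSeries_eq (hE : E 1 = 1) {x : A} (hx : E x = 0) {G : PowerSeries ℂ}
    (hG : PowerSeries.derivative ℂ G =
      PowerSeries.C (cumulantSelf E x 2) * PowerSeries.X * G)
    (hG0 : PowerSeries.coeff 0 G = 1) :
    momentSeries E x = (PowerSeries.exp ℂ).subst
      (PowerSeries.X ^ 2 * PowerSeries.mk (higherCumulants E x)) * G := by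
  have hs : PowerSeries.constantCoeff
      (PowerSeries.X ^ 2 * PowerSeries.mk (higherCumulants E x)) = 0 := by simp
  refine eq_of_derivative_eq_mul (derivative_momentSeries E hE hx) ?_ ?_
  · rw [Derivation.leibniz, hG, PowerSeries.derivative_subst
      (PowerSeries.HasSubst.of_constantCoeff_zero' hs), PowerSeries.derivative_exp]
    simp only [smul_eq_mul]
    ring
  · rw [PowerSeries.coeff_mul, Finset.Nat.antidiagonal_zero, Finset.sum_singleton, hG0,
      coeff_exp_subst hs]
    simp [expCoeff, momentSeries, hE]

/-- Weighting the `n`-th coefficient by `t^n` collects the orders of the formal expansion. -/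
theorem coeff_exp_subst_eq_sum {b : ℕ → ℂ} (hb : b 0 = 0) {s : ℂ} (hs : s ≠ 0) {i M : ℕ} (hi : i ≤ M) :
    ∑ n ∈ Finset.range (M + 1), s⁻¹ ^ n * PowerSeries.coeff i (expCoeff (fun j =>
        (PowerSeries.C (s ^ j * b j) * PowerSeries.X ^ (j + 2) : PowerSeries ℂ)) n) =
      PowerSeries.coeff i ((PowerSeries.exp ℂ).subst (PowerSeries.X ^ 2 * PowerSeries.mk b)) := by
  -- With m factors, order n comes with degree exactly n + 2m in X. Rescaling by sX produces the
  -- powers of s and of X together.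
  have hpow : ∀ m n, PowerSeries.coeff n ((PowerSeries.mk fun j =>
      (PowerSeries.C (s ^ j * b j) * PowerSeries.X ^ (j + 2) : PowerSeries ℂ)) ^ m) =
      PowerSeries.C (s ^ n * PowerSeries.coeff n (PowerSeries.mk b ^ m)) *
        PowerSeries.X ^ (n + 2 * m) := by
    intro m n
    have h1 : (PowerSeries.mk fun j =>
        (PowerSeries.C (s ^ j * b j) * PowerSeries.X ^ (j + 2) : PowerSeries ℂ)) =
        PowerSeries.C (PowerSeries.X ^ 2) * PowerSeries.rescale (PowerSeries.C s * PowerSeries.X)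
          (PowerSeries.map (PowerSeries.C (R := ℂ)) (PowerSeries.mk b)) := by
      refine PowerSeries.ext fun j => ?_
      rw [PowerSeries.coeff_mk, PowerSeries.coeff_C_mul, PowerSeries.coeff_rescale,
        PowerSeries.coeff_map, PowerSeries.coeff_mk, map_mul, map_pow]
      ring
    rw [h1, mul_pow, ← map_pow PowerSeries.C, ← map_pow (PowerSeries.rescale _),
      ← map_pow (PowerSeries.map _), PowerSeries.coeff_C_mul, PowerSeries.coeff_rescale,
      PowerSeries.coeff_map, map_mul, map_pow PowerSeries.C]
    ring
  have h0 : PowerSeries.constantCoeff (PowerSeries.X ^ 2 * PowerSeries.mk b) = 0 := by simp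
  rw [coeff_exp_subst h0, expCoeff_eq_sum (by simp) hi]
  have h2 : (PowerSeries.mk fun j => PowerSeries.coeff j (PowerSeries.X ^ 2 * PowerSeries.mk b)) =
      PowerSeries.X ^ 2 * PowerSeries.mk b := by
    ext
    simp
  rw [h2]
  have h3 : ∀ n ∈ Finset.range (M + 1), s⁻¹ ^ n * PowerSeries.coeff i (expCoeff (fun j =>
        (PowerSeries.C (s ^ j * b j) * PowerSeries.X ^ (j + 2) : PowerSeries ℂ)) n) =
      ∑ m ∈ Finset.range (M + 1), if i = n + 2 * m then ((m.factorial : ℂ)⁻¹) •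
        PowerSeries.coeff n (PowerSeries.mk b ^ m) else 0 := by
    intro n hn
    rw [expCoeff_eq_sum (by simp [hb]) (Nat.le_of_lt_succ (Finset.mem_range.1 hn)), map_sum,
      Finset.mul_sum]
    refine Finset.sum_congr rfl fun m _ => ?_
    rw [hpow, PowerSeries.coeff_smul, PowerSeries.coeff_C_mul, PowerSeries.coeff_X_pow]
    split_ifs
    · simp only [smul_eq_mul, mul_one]
      have : s⁻¹ ^ n * s ^ n = 1 := by
        rw [← mul_pow, inv_mul_cancel₀ hs, one_pow]
      linear_combination (m.factorial : ℂ)⁻¹ * PowerSeries.coeff n (PowerSeries.mk b ^ m) * this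
    · simp
  rw [Finset.sum_congr rfl h3, Finset.sum_comm]
  refine Finset.sum_congr rfl fun m _ => ?_
  rw [mul_pow, ← pow_mul, PowerSeries.coeff_X_pow_mul']
  split_ifs with hm
  · rw [Finset.sum_eq_single (i - 2 * m)]
    · rw [if_pos (by omega)]
    · intro n _ hn
      rw [if_neg (by omega)]
    · intro hn
      simp only [Finset.mem_range] at hn
      omega
  · rw [smul_zero]
    exact Finset.sum_eq_zero fun n _ => if_neg (by omega)

end CumulantSeries

/-! ### Polynomial moments of the modes from the formal density -/

section Moments

variable {d : ℕ} {L : Fin d → ℝ} [∀ i, Fact (0 < L i)] {Ω : Type*} [MeasurableSpace Ω]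
  {μ : Measure Ω} [IsProbabilityMeasure μ] {f : Torus L → Ω → ℝ} {ι : Type*} {k : ι → Mode d}
  [Fintype ι] [DecidableEq ι]

theorem boxVolume_pos (L : Fin d → ℝ) [h : ∀ i, Fact (0 < L i)] : 0 < boxVolume L :=
  Finset.prod_pos fun i _ => (h i).out

theorem sqrt_boxVolume_ne_zero (L : Fin d → ℝ) [h : ∀ i, Fact (0 < L i)] :
    ((√(boxVolume L) : ℝ) : ℂ) ≠ 0 := by
  exact_mod_cast (Real.sqrt_pos.2 (boxVolume_pos L)).ne'

/-- On the line spanned by `c` the cumulant polynomials collapse to the cumulants of the single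
variable `linForm c`, to which the generating series apply. -/
theorem IsModeFamily.lineSeries_densityPoly (h : IsModeFamily L μ f k) (c : ι × ℤˣ → ℂ) (n : ℕ) :
    lineSeries c (densityPoly (pSpec L μ f k) n) = expCoeff (fun j =>
      (PowerSeries.C (((√(boxVolume L) : ℝ) : ℂ) ^ j * higherCumulants h.moment (linForm c) j) *
        PowerSeries.X ^ (j + 2) : PowerSeries ℂ)) n := by
  rw [densityPoly, map_expCoeff]
  congr 1
  funext j
  rw [cumulantPoly, higherCumulants]
  split_ifs with hj
  · simp
  · rw [mul_div_assoc', h.cumulantSelf_linForm, map_smul, map_sum, Finset.sum_div, map_sum,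
      Finset.sum_mul, Finset.smul_sum]
    refine Finset.sum_congr rfl fun l _ => ?_
    rw [map_smul, map_prod, smul_smul]
    have h1 : ∀ l, lineSeries c (MvPolynomial.X l) = PowerSeries.C (c l) * PowerSeries.X := by
      simp [lineSeries]
    simp only [h1, Finset.prod_mul_distrib, Finset.prod_const, Finset.card_univ, Fintype.card_fin]
    rw [PowerSeries.smul_eq_C_mul, ← map_prod, ← mul_assoc, ← map_mul]
    congr 2
    ring

/-- Both sides are D! times a coefficient of the product of the exponential of the higher cumulants
with the Gaussian series; on the right that exponential is sorted by powers of V^{-1/2}. -/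
theorem IsModeFamily.moment_linForm_pow (h : IsModeFamily L μ f k) (c : ι × ℤˣ → ℂ) {D M : ℕ}
    (hD : D ≤ M) : h.moment (linForm c ^ D) = ∑ n ∈ Finset.range (M + 1),
      ((√(boxVolume L) : ℝ) : ℂ)⁻¹ ^ n * ∫ α : ι → ℂ, polyValue (linForm c ^ D) α *
        invFourier (densityPoly (pSpec L μ f k) n) α := by
  have hx : h.moment (linForm c) = 0 := by simp [linForm, h.moment_X]
  have h1 := momentSeries_eq h.moment h.moment_one hx
    (G := momentSeries gaussMoment (linForm c))
    (by rw [h.cumulantSelf_linForm_two]; exact derivative_gaussSeries c)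
    (by simp [momentSeries, gaussMoment_one])
  have hfac : (D.factorial : ℂ) ≠ 0 := by exact_mod_cast D.factorial_ne_zero
  have h2 : h.moment (linForm c ^ D) =
      D.factorial * PowerSeries.coeff D (momentSeries h.moment (linForm c)) := by
    rw [momentSeries, PowerSeries.coeff_mk]
    field_simp
  rw [h2, h1]
  simp only [integral_linForm_pow_mul_invFourier, h.lineSeries_densityPoly]
  rw [PowerSeries.coeff_mul, Finset.mul_sum]
  simp only [PowerSeries.coeff_mul, Finset.mul_sum]
  rw [Finset.sum_comm]
  refine Finset.sum_congr rfl fun x hx => ?_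
  rw [Finset.HasAntidiagonal.mem_antidiagonal] at hx
  rw [← coeff_exp_subst_eq_sum (by simp [higherCumulants]) (sqrt_boxVolume_ne_zero L)
    (show x.1 ≤ M by omega), Finset.sum_mul, Finset.mul_sum]
  refine Finset.sum_congr rfl fun n _ => ?_
  ring

/-- A linear functional on polynomials that vanishes on powers of linear forms vanishes. -/
theorem eq_zero_of_linForm_pow (F : MvPolynomial (ι × ℤˣ) ℂ →ₗ[ℂ] ℂ) {M : ℕ}
    (hF : ∀ c, ∀ D ≤ M, F (linForm c ^ D) = 0) (q : MvPolynomial (ι × ℤˣ) ℂ)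
    (hq : q.totalDegree ≤ M) : F q = 0 := by
  have hmon : ∀ s : ι × ℤˣ →₀ ℕ, (∑ l, s l) ≤ M → F (MvPolynomial.monomial s 1) = 0 := by
    intro s hs
    -- Polarization: as a function of `c` this value is a polynomial whose coefficients are
    -- multinomial numbers times values of `F` on monomials. It vanishes identically, hence so does
    -- every coefficient.
    have hexp : ∀ c, F (linForm c ^ (∑ l, s l)) = MvPolynomial.eval c
        (∑ t ∈ Finset.piAntidiag Finset.univ (∑ l, s l), MvPolynomial.monomial
          (Finsupp.equivFunOnFinite.symm t) ((Nat.multinomial Finset.univ t : ℂ) *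
            F (MvPolynomial.monomial (Finsupp.equivFunOnFinite.symm t) 1))) := by
      intro c
      rw [linForm, Finset.sum_pow_eq_sum_piAntidiag, map_sum, map_sum]
      refine Finset.sum_congr rfl fun t _ => ?_
      have h1 : (Nat.multinomial Finset.univ t : MvPolynomial (ι × ℤˣ) ℂ) *
          ∏ l, (c l • MvPolynomial.X l) ^ t l = ((Nat.multinomial Finset.univ t : ℂ) *
            ∏ l, c l ^ t l) • MvPolynomial.monomial (Finsupp.equivFunOnFinite.symm t) 1 := by
        rw [MvPolynomial.monomial_eq, Finsupp.prod_fintype _ _ (fun _ => pow_zero _)]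
        simp only [MvPolynomial.smul_eq_C_mul, mul_pow, Finset.prod_mul_distrib, map_mul,
          map_natCast, map_prod, map_pow, map_one, one_mul, Finsupp.equivFunOnFinite_symm_apply_apply]
        ring
      rw [h1, map_smul, MvPolynomial.eval_monomial, Finsupp.prod_fintype _ _ (fun _ => pow_zero _)]
      simp only [Finsupp.equivFunOnFinite_symm_apply_apply, smul_eq_mul]
      ring
    have hzero := MvPolynomial.funext (p := ∑ t ∈ Finset.piAntidiag Finset.univ (∑ l, s l),
        MvPolynomial.monomial (Finsupp.equivFunOnFinite.symm t) ((Nat.multinomial Finset.univ t : ℂ) *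
            F (MvPolynomial.monomial (Finsupp.equivFunOnFinite.symm t) 1))) (q := 0) fun c => by
      rw [← hexp, hF c _ hs, map_zero]
    have hc := congrArg (MvPolynomial.coeff s) hzero
    rw [MvPolynomial.coeff_sum, MvPolynomial.coeff_zero, Finset.sum_eq_single (s : ι × ℤˣ → ℕ)] at hc
    · rw [MvPolynomial.coeff_monomial, if_pos (by simp), mul_eq_zero] at hc
      rcases hc with hc | hc
      · exact absurd hc (by exact_mod_cast (Nat.multinomial_pos _ _).ne')
      · simpa using hc
    · intro t _ ht
      rw [MvPolynomial.coeff_monomial, if_neg]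
      intro h
      apply ht
      rw [← h]
      rfl
    · intro hn
      exact absurd (by simp) hn
  rw [q.as_sum, map_sum]
  refine Finset.sum_eq_zero fun s hs => ?_
  have h1 : MvPolynomial.monomial s (MvPolynomial.coeff s q) =
      MvPolynomial.coeff s q • MvPolynomial.monomial s (1 : ℂ) := by
    rw [MvPolynomial.smul_monomial, smul_eq_mul, mul_one]
  rw [h1, map_smul, hmon, smul_zero]
  have h2 := MvPolynomial.le_totalDegree hs
  rw [Finsupp.sum_fintype _ _ (fun _ => rfl)] at h2
  omega

theorem IsModeFamily.moment_eq_sum (h : IsModeFamily L μ f k) (q : MvPolynomial (ι × ℤˣ) ℂ) {M : ℕ}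
    (hM : q.totalDegree ≤ M) : h.moment q = ∑ n ∈ Finset.range (M + 1),
      ((√(boxVolume L) : ℝ) : ℂ)⁻¹ ^ n * ∫ α : ι → ℂ, polyValue q α *
        invFourier (densityPoly (pSpec L μ f k) n) α := by
  let Λ : ℕ → MvPolynomial (ι × ℤˣ) ℂ →ₗ[ℂ] ℂ := fun n =>
    { toFun := fun q => ∫ α : ι → ℂ, polyValue q α *
        invFourier (densityPoly (pSpec L μ f k) n) α
      map_add' := fun q r => by
        simp only [polyValue_add, add_mul]
        exact integral_add (integrable_polyValue_mul_invFourier _ _)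
          (integrable_polyValue_mul_invFourier _ _)
      map_smul' := fun c q => by
        simp only [polyValue_smul, mul_assoc, integral_const_mul, RingHom.id_apply, smul_eq_mul] }
  have h1 := eq_zero_of_linForm_pow (h.moment - ∑ n ∈ Finset.range (M + 1),
    (((√(boxVolume L) : ℝ) : ℂ)⁻¹ ^ n) • Λ n) (M := M) (fun c D hD => by
      rw [LinearMap.sub_apply, h.moment_linForm_pow c hD, LinearMap.sum_apply, sub_eq_zero]
      rfl) q hM
  rw [LinearMap.sub_apply, LinearMap.sum_apply, sub_eq_zero] at h1
  exact h1

end Moments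

/-! ### Sums over mutually different modes -/

section DistinctSums

variable {ι : Type*} [Fintype ι] [DecidableEq ι] {M : Type*} [AddCommMonoid M]

/-- Renaming the indices of a sum over mutually different modes. -/
theorem sum_embedding_congr {r : ℕ} (σ : Fin r → Fin r) (hσ : Function.Bijective σ)
    (F G : (Fin r → ι) → M) (h : ∀ x : Fin r → ι, F (fun j => x (σ j)) = G x) :
    ∑ x : Fin r ↪ ι, F x = ∑ x : Fin r ↪ ι, G x :=
  (Equiv.sum_comp (Equiv.embeddingCongr (Equiv.ofBijective σ hσ).symm (Equiv.refl ι))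
    fun k => F k).symm.trans (Finset.sum_congr rfl fun x _ => h x)

/-- A further mode is either new or equal to one already chosen. Iteration splits a free sum over
tuples into sums over different modes, one for each coincidence pattern. -/
theorem sum_embedding_succ {r : ℕ} (F : (Fin r ↪ ι) → ι → M) :
    ∑ k : Fin r ↪ ι, ∑ x, F k x = ∑ k : Fin (r + 1) ↪ ι,
      F (Fin.castSuccEmb.trans k) (k (Fin.last r)) + ∑ k : Fin r ↪ ι, ∑ j, F k (k j) := by
  -- `embeddingFinSucc` puts the new element in front; the rotation moves it to the last place.
  rw [← Equiv.sum_comp (Equiv.embeddingCongr (finRotate (r + 1)).symm (Equiv.refl ι)) fun k =>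
    F (Fin.castSuccEmb.trans k) (k (Fin.last r)), ← Equiv.sum_comp (Equiv.embeddingFinSucc r ι).symm,
    Fintype.sum_sigma, ← Finset.sum_add_distrib]
  refine Finset.sum_congr rfl fun e _ => ?_
  have h1 : ∀ x : {i // i ∉ Set.range e}, Fin.castSuccEmb.trans ((Equiv.embeddingCongr
      (finRotate (r + 1)).symm (Equiv.refl ι)) ((Equiv.embeddingFinSucc r ι).symm ⟨e, x⟩)) = e := by
    intro x
    ext j
    change (Equiv.embeddingFinSucc r ι).symm ⟨e, x⟩ (finRotate (r + 1) j.castSucc) = e j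
    rw [Equiv.coe_embeddingFinSucc_symm, finRotate_apply, Fin.coeSucc_eq_succ, Fin.cons_succ]
  have h2 : ∀ x : {i // i ∉ Set.range e}, (Equiv.embeddingCongr (finRotate (r + 1)).symm
      (Equiv.refl ι)) ((Equiv.embeddingFinSucc r ι).symm ⟨e, x⟩) (Fin.last r) = x := by
    intro x
    change (Equiv.embeddingFinSucc r ι).symm ⟨e, x⟩ (finRotate (r + 1) (Fin.last r)) = x
    rw [Equiv.coe_embeddingFinSucc_symm, finRotate_apply, Fin.last_add_one, Fin.cons_zero]
  simp only [h1, h2]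
  rw [add_comm, ← Finset.sum_filter_add_sum_filter_not Finset.univ (· ∈ Set.range e)]
  congr 1
  · have : Finset.univ.filter (· ∈ Set.range e) = Finset.univ.map e := by
      ext x
      simp
    rw [this, Finset.sum_map]
  · exact Finset.sum_subtype _ (by simp) _

theorem sum_eq_sum_embedding (F : ι → M) : ∑ x, F x = ∑ k : Fin 1 ↪ ι, F (k 0) := by
  have h := sum_embedding_succ (r := 0) (fun _ x => F x)
  simpa using h

theorem castSucc_two {n : ℕ} : Fin.castSucc (2 : Fin (n + 3)) = 2 := rfl

theorem castSucc_three {n : ℕ} : Fin.castSucc (3 : Fin (n + 4)) = 3 := rfl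

theorem castSucc_four {n : ℕ} : Fin.castSucc (4 : Fin (n + 5)) = 4 := rfl

end DistinctSums

/-! ### Coincidence patterns of two bispectra -/

section Coincidences

variable {ι : Type*} [Fintype ι] [DecidableEq ι] {d : ℕ} {k : ι → Mode d}

theorem mode_eq_of_add_self_eq {x y : Mode d} (h : x + x = y + y) : x = y := by
  ext i
  have := congrFun h i
  simp only [Pi.add_apply] at this
  omega

theorem sum_bispectrum_pairs (hinj : Function.Injective k) (h0 : ∀ i, k i ≠ 0)
    (h2 : ∀ i j, k i + k j ≠ 0) (Φ : ι → ι → ι → ι → ι → ι → ℂ)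
    (hΦ : ∀ i j m a b c, Φ i j m a b c ≠ 0 → k i + k j = k m ∧ k a + k b = k c)
    (s1 : ∀ i j m a b c, Φ i j m a b c = Φ j i m a b c)
    (s2 : ∀ i j m a b c, Φ i j m a b c = Φ i j m b a c)
    (s3 : ∀ i j m a b c, Φ i j m a b c = Φ a b c i j m) :
    ∑ i, ∑ j, ∑ m, ∑ a, ∑ b, ∑ c, Φ i j m a b c =
      ∑ x : Fin 2 ↪ ι, Φ (x 0) (x 0) (x 1) (x 0) (x 0) (x 1) +
      2 * ∑ x : Fin 3 ↪ ι, Φ (x 0) (x 1) (x 2) (x 0) (x 1) (x 2) +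
      2 * ∑ x : Fin 3 ↪ ι, Φ (x 0) (x 0) (x 1) (x 1) (x 1) (x 2) +
      4 * ∑ x : Fin 3 ↪ ι, Φ (x 0) (x 0) (x 1) (x 0) (x 1) (x 2) +
      ∑ x : Fin 4 ↪ ι, Φ (x 0) (x 0) (x 2) (x 1) (x 1) (x 3) +
      4 * ∑ x : Fin 4 ↪ ι, Φ (x 0) (x 0) (x 2) (x 0) (x 3) (x 1) +
      2 * ∑ x : Fin 4 ↪ ι, Φ (x 0) (x 0) (x 3) (x 1) (x 2) (x 0) +
      4 * ∑ x : Fin 4 ↪ ι, Φ (x 0) (x 0) (x 3) (x 1) (x 3) (x 2) +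
      2 * ∑ x : Fin 4 ↪ ι, Φ (x 0) (x 0) (x 3) (x 1) (x 2) (x 3) +
      8 * ∑ x : Fin 4 ↪ ι, Φ (x 0) (x 1) (x 3) (x 0) (x 3) (x 2) +
      2 * ∑ x : Fin 5 ↪ ι, Φ (x 0) (x 0) (x 3) (x 1) (x 2) (x 4) +
      4 * ∑ x : Fin 5 ↪ ι, Φ (x 2) (x 4) (x 0) (x 1) (x 4) (x 3) +
      4 * ∑ x : Fin 5 ↪ ι, Φ (x 0) (x 1) (x 4) (x 2) (x 4) (x 3) +
      ∑ x : Fin 5 ↪ ι, Φ (x 0) (x 1) (x 4) (x 2) (x 3) (x 4) +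
      ∑ x : Fin 6 ↪ ι, Φ (x 0) (x 1) (x 2) (x 3) (x 4) (x 5) := by
  -- A mode is never the sum of itself and another mode, since modes are nonzero.
  have own1 : ∀ i j a b c, Φ i j i a b c = 0 := by
    intro i j a b c
    by_contra h
    exact h0 j (by linear_combination (hΦ _ _ _ _ _ _ h).1)
  have own2 : ∀ i j a b c, Φ i j j a b c = 0 := fun i j a b c => by rw [s1, own1]
  have own3 : ∀ i j m a b, Φ i j m a b a = 0 := fun i j m a b => by rw [s3, own1]
  have own4 : ∀ i j m a b, Φ i j m a b b = 0 := fun i j m a b => by rw [s3, own2]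
  -- Equal sums with one common summand have equal other summands; `twice` and `legs1` below are the
  -- variants with doubled modes and with equal summands.
  have shared1 : ∀ i j m b, j ≠ b → Φ i j m i b m = 0 := by
    intro i j m b hb
    by_contra h
    obtain ⟨e1, e2⟩ := hΦ _ _ _ _ _ _ h
    exact hb (hinj (by linear_combination e1 - e2))
  have shared2 : ∀ i j m b, i ≠ b → Φ i j m j b m = 0 := fun i j m b hb => by rw [s1, shared1 _ _ _ _ hb]
  have shared3 : ∀ i j m a, j ≠ a → Φ i j m a i m = 0 := fun i j m b hb => by rw [s2, shared1 _ _ _ _ hb]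
  have shared4 : ∀ i j m a, i ≠ a → Φ i j m a j m = 0 := fun i j m b hb => by rw [s2, shared2 _ _ _ _ hb]
  have twice : ∀ i m a, i ≠ a → Φ i i m a a m = 0 := by
    intro i m a ha
    by_contra h
    obtain ⟨e1, e2⟩ := hΦ _ _ _ _ _ _ h
    exact ha (hinj (mode_eq_of_add_self_eq (e1.trans e2.symm)))
  have legs1 : ∀ i j m c, m ≠ c → Φ i j m i j c = 0 := by
    intro i j m c hc
    by_contra h
    obtain ⟨e1, e2⟩ := hΦ _ _ _ _ _ _ h
    exact hc (hinj (e1.symm.trans e2))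
  have legs2 : ∀ i j m c, m ≠ c → Φ i j m j i c = 0 := fun i j m c hc => by rw [s2, legs1 _ _ _ _ hc]
  -- If each sum were a summand of the other equation, the two remaining modes would add up to zero.
  have cycle1 : ∀ i j m b, Φ i j m m b i = 0 := by
    intro i j m b
    by_contra h
    obtain ⟨e1, e2⟩ := hΦ _ _ _ _ _ _ h
    exact h2 j b (by linear_combination e1 + e2)
  have cycle2 : ∀ i j m b, Φ i j m m b j = 0 := fun i j m b => by rw [s1, cycle1]
  have cycle3 : ∀ i j m a, Φ i j m a m i = 0 := fun i j m b => by rw [s2, cycle1]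
  have cycle4 : ∀ i j m a, Φ i j m a m j = 0 := fun i j m b => by rw [s2, cycle2]
  -- The digits encode the coincidence pattern, equal digits marking equal modes. Each surviving
  -- pattern is carried to the representative of its class by renaming 0, 1, … as listed in the
  -- vector and then applying the symmetries.
  have leaf001023 : ∑ x : Fin 4 ↪ ι, Φ (x 0) (x 0) (x 1) (x 0) (x 2) (x 3) =
      ∑ x : Fin 4 ↪ ι, Φ (x 0) (x 0) (x 2) (x 0) (x 3) (x 1) :=
    sum_embedding_congr ![0, 2, 3, 1] (by decide)
      (fun x => Φ (x 0) (x 0) (x 1) (x 0) (x 2) (x 3)) _ fun x =>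
        rfl
  have leaf001102 : ∑ x : Fin 3 ↪ ι, Φ (x 0) (x 0) (x 1) (x 1) (x 0) (x 2) =
      ∑ x : Fin 3 ↪ ι, Φ (x 0) (x 0) (x 1) (x 0) (x 1) (x 2) :=
    sum_embedding_congr ![0, 1, 2] (by decide)
      (fun x => Φ (x 0) (x 0) (x 1) (x 1) (x 0) (x 2)) _ fun x =>
        s2 _ _ _ _ _ _
  have leaf001123 : ∑ x : Fin 4 ↪ ι, Φ (x 0) (x 0) (x 1) (x 1) (x 2) (x 3) =
      ∑ x : Fin 4 ↪ ι, Φ (x 0) (x 0) (x 3) (x 1) (x 3) (x 2) :=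
    sum_embedding_congr ![0, 3, 1, 2] (by decide)
      (fun x => Φ (x 0) (x 0) (x 1) (x 1) (x 2) (x 3)) _ fun x =>
        s2 _ _ _ _ _ _
  have leaf001203 : ∑ x : Fin 4 ↪ ι, Φ (x 0) (x 0) (x 1) (x 2) (x 0) (x 3) =
      ∑ x : Fin 4 ↪ ι, Φ (x 0) (x 0) (x 2) (x 0) (x 3) (x 1) :=
    sum_embedding_congr ![0, 2, 3, 1] (by decide)
      (fun x => Φ (x 0) (x 0) (x 1) (x 2) (x 0) (x 3)) _ fun x =>
        s2 _ _ _ _ _ _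
  have leaf001213 : ∑ x : Fin 4 ↪ ι, Φ (x 0) (x 0) (x 1) (x 2) (x 1) (x 3) =
      ∑ x : Fin 4 ↪ ι, Φ (x 0) (x 0) (x 3) (x 1) (x 3) (x 2) :=
    sum_embedding_congr ![0, 3, 1, 2] (by decide)
      (fun x => Φ (x 0) (x 0) (x 1) (x 2) (x 1) (x 3)) _ fun x =>
        rfl
  have leaf001220 : ∑ x : Fin 3 ↪ ι, Φ (x 0) (x 0) (x 1) (x 2) (x 2) (x 0) =
      ∑ x : Fin 3 ↪ ι, Φ (x 0) (x 0) (x 1) (x 1) (x 1) (x 2) :=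
    sum_embedding_congr ![1, 2, 0] (by decide)
      (fun x => Φ (x 0) (x 0) (x 1) (x 2) (x 2) (x 0)) _ fun x =>
        s3 _ _ _ _ _ _
  have leaf001223 : ∑ x : Fin 4 ↪ ι, Φ (x 0) (x 0) (x 1) (x 2) (x 2) (x 3) =
      ∑ x : Fin 4 ↪ ι, Φ (x 0) (x 0) (x 2) (x 1) (x 1) (x 3) :=
    sum_embedding_congr ![0, 2, 1, 3] (by decide)
      (fun x => Φ (x 0) (x 0) (x 1) (x 2) (x 2) (x 3)) _ fun x =>
        rfl
  have leaf001230 : ∑ x : Fin 4 ↪ ι, Φ (x 0) (x 0) (x 1) (x 2) (x 3) (x 0) =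
      ∑ x : Fin 4 ↪ ι, Φ (x 0) (x 0) (x 3) (x 1) (x 2) (x 0) :=
    sum_embedding_congr ![0, 3, 1, 2] (by decide)
      (fun x => Φ (x 0) (x 0) (x 1) (x 2) (x 3) (x 0)) _ fun x =>
        rfl
  have leaf001231 : ∑ x : Fin 4 ↪ ι, Φ (x 0) (x 0) (x 1) (x 2) (x 3) (x 1) =
      ∑ x : Fin 4 ↪ ι, Φ (x 0) (x 0) (x 3) (x 1) (x 2) (x 3) :=
    sum_embedding_congr ![0, 3, 1, 2] (by decide)
      (fun x => Φ (x 0) (x 0) (x 1) (x 2) (x 3) (x 1)) _ fun x =>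
        rfl
  have leaf001234 : ∑ x : Fin 5 ↪ ι, Φ (x 0) (x 0) (x 1) (x 2) (x 3) (x 4) =
      ∑ x : Fin 5 ↪ ι, Φ (x 0) (x 0) (x 3) (x 1) (x 2) (x 4) :=
    sum_embedding_congr ![0, 3, 1, 2, 4] (by decide)
      (fun x => Φ (x 0) (x 0) (x 1) (x 2) (x 3) (x 4)) _ fun x =>
        rfl
  have leaf012001 : ∑ x : Fin 3 ↪ ι, Φ (x 0) (x 1) (x 2) (x 0) (x 0) (x 1) =
      ∑ x : Fin 3 ↪ ι, Φ (x 0) (x 0) (x 1) (x 0) (x 1) (x 2) :=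
    sum_embedding_congr ![0, 1, 2] (by decide)
      (fun x => Φ (x 0) (x 1) (x 2) (x 0) (x 0) (x 1)) _ fun x =>
        s3 _ _ _ _ _ _
  have leaf012003 : ∑ x : Fin 4 ↪ ι, Φ (x 0) (x 1) (x 2) (x 0) (x 0) (x 3) =
      ∑ x : Fin 4 ↪ ι, Φ (x 0) (x 0) (x 2) (x 0) (x 3) (x 1) :=
    sum_embedding_congr ![0, 3, 1, 2] (by decide)
      (fun x => Φ (x 0) (x 1) (x 2) (x 0) (x 0) (x 3)) _ fun x =>
        s3 _ _ _ _ _ _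
  have leaf012023 : ∑ x : Fin 4 ↪ ι, Φ (x 0) (x 1) (x 2) (x 0) (x 2) (x 3) =
      ∑ x : Fin 4 ↪ ι, Φ (x 0) (x 1) (x 3) (x 0) (x 3) (x 2) :=
    sum_embedding_congr ![0, 1, 3, 2] (by decide)
      (fun x => Φ (x 0) (x 1) (x 2) (x 0) (x 2) (x 3)) _ fun x =>
        rfl
  have leaf012031 : ∑ x : Fin 4 ↪ ι, Φ (x 0) (x 1) (x 2) (x 0) (x 3) (x 1) =
      ∑ x : Fin 4 ↪ ι, Φ (x 0) (x 1) (x 3) (x 0) (x 3) (x 2) :=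
    sum_embedding_congr ![0, 3, 2, 1] (by decide)
      (fun x => Φ (x 0) (x 1) (x 2) (x 0) (x 3) (x 1)) _ fun x =>
        s3 _ _ _ _ _ _
  have leaf012034 : ∑ x : Fin 5 ↪ ι, Φ (x 0) (x 1) (x 2) (x 0) (x 3) (x 4) =
      ∑ x : Fin 5 ↪ ι, Φ (x 2) (x 4) (x 0) (x 1) (x 4) (x 3) :=
    sum_embedding_congr ![4, 2, 0, 1, 3] (by decide)
      (fun x => Φ (x 0) (x 1) (x 2) (x 0) (x 3) (x 4)) _ fun x =>
        (s1 _ _ _ _ _ _).trans (s2 _ _ _ _ _ _)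
  have leaf012102 : ∑ x : Fin 3 ↪ ι, Φ (x 0) (x 1) (x 2) (x 1) (x 0) (x 2) =
      ∑ x : Fin 3 ↪ ι, Φ (x 0) (x 1) (x 2) (x 0) (x 1) (x 2) :=
    sum_embedding_congr ![1, 0, 2] (by decide)
      (fun x => Φ (x 0) (x 1) (x 2) (x 1) (x 0) (x 2)) _ fun x =>
        s1 _ _ _ _ _ _
  have leaf012110 : ∑ x : Fin 3 ↪ ι, Φ (x 0) (x 1) (x 2) (x 1) (x 1) (x 0) =
      ∑ x : Fin 3 ↪ ι, Φ (x 0) (x 0) (x 1) (x 0) (x 1) (x 2) :=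
    sum_embedding_congr ![1, 0, 2] (by decide)
      (fun x => Φ (x 0) (x 1) (x 2) (x 1) (x 1) (x 0)) _ fun x =>
        (s1 _ _ _ _ _ _).trans (s3 _ _ _ _ _ _)
  have leaf012113 : ∑ x : Fin 4 ↪ ι, Φ (x 0) (x 1) (x 2) (x 1) (x 1) (x 3) =
      ∑ x : Fin 4 ↪ ι, Φ (x 0) (x 0) (x 2) (x 0) (x 3) (x 1) :=
    sum_embedding_congr ![3, 0, 1, 2] (by decide)
      (fun x => Φ (x 0) (x 1) (x 2) (x 1) (x 1) (x 3)) _ fun x =>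
        (s1 _ _ _ _ _ _).trans (s3 _ _ _ _ _ _)
  have leaf012123 : ∑ x : Fin 4 ↪ ι, Φ (x 0) (x 1) (x 2) (x 1) (x 2) (x 3) =
      ∑ x : Fin 4 ↪ ι, Φ (x 0) (x 1) (x 3) (x 0) (x 3) (x 2) :=
    sum_embedding_congr ![1, 0, 3, 2] (by decide)
      (fun x => Φ (x 0) (x 1) (x 2) (x 1) (x 2) (x 3)) _ fun x =>
        s1 _ _ _ _ _ _
  have leaf012130 : ∑ x : Fin 4 ↪ ι, Φ (x 0) (x 1) (x 2) (x 1) (x 3) (x 0) =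
      ∑ x : Fin 4 ↪ ι, Φ (x 0) (x 1) (x 3) (x 0) (x 3) (x 2) :=
    sum_embedding_congr ![3, 0, 2, 1] (by decide)
      (fun x => Φ (x 0) (x 1) (x 2) (x 1) (x 3) (x 0)) _ fun x =>
        (s1 _ _ _ _ _ _).trans (s3 _ _ _ _ _ _)
  have leaf012134 : ∑ x : Fin 5 ↪ ι, Φ (x 0) (x 1) (x 2) (x 1) (x 3) (x 4) =
      ∑ x : Fin 5 ↪ ι, Φ (x 2) (x 4) (x 0) (x 1) (x 4) (x 3) :=
    sum_embedding_congr ![2, 4, 0, 1, 3] (by decide)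
      (fun x => Φ (x 0) (x 1) (x 2) (x 1) (x 3) (x 4)) _ fun x =>
        s2 _ _ _ _ _ _
  have leaf012203 : ∑ x : Fin 4 ↪ ι, Φ (x 0) (x 1) (x 2) (x 2) (x 0) (x 3) =
      ∑ x : Fin 4 ↪ ι, Φ (x 0) (x 1) (x 3) (x 0) (x 3) (x 2) :=
    sum_embedding_congr ![0, 1, 3, 2] (by decide)
      (fun x => Φ (x 0) (x 1) (x 2) (x 2) (x 0) (x 3)) _ fun x =>
        s2 _ _ _ _ _ _
  have leaf012213 : ∑ x : Fin 4 ↪ ι, Φ (x 0) (x 1) (x 2) (x 2) (x 1) (x 3) =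
      ∑ x : Fin 4 ↪ ι, Φ (x 0) (x 1) (x 3) (x 0) (x 3) (x 2) :=
    sum_embedding_congr ![1, 0, 3, 2] (by decide)
      (fun x => Φ (x 0) (x 1) (x 2) (x 2) (x 1) (x 3)) _ fun x =>
        (s1 _ _ _ _ _ _).trans (s2 _ _ _ _ _ _)
  have leaf012223 : ∑ x : Fin 4 ↪ ι, Φ (x 0) (x 1) (x 2) (x 2) (x 2) (x 3) =
      ∑ x : Fin 4 ↪ ι, Φ (x 0) (x 0) (x 3) (x 1) (x 2) (x 0) :=
    sum_embedding_congr ![1, 2, 0, 3] (by decide)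
      (fun x => Φ (x 0) (x 1) (x 2) (x 2) (x 2) (x 3)) _ fun x =>
        s3 _ _ _ _ _ _
  have leaf012234 : ∑ x : Fin 5 ↪ ι, Φ (x 0) (x 1) (x 2) (x 2) (x 3) (x 4) =
      ∑ x : Fin 5 ↪ ι, Φ (x 0) (x 1) (x 4) (x 2) (x 4) (x 3) :=
    sum_embedding_congr ![0, 1, 4, 2, 3] (by decide)
      (fun x => Φ (x 0) (x 1) (x 2) (x 2) (x 3) (x 4)) _ fun x =>
        s2 _ _ _ _ _ _
  have leaf012301 : ∑ x : Fin 4 ↪ ι, Φ (x 0) (x 1) (x 2) (x 3) (x 0) (x 1) =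
      ∑ x : Fin 4 ↪ ι, Φ (x 0) (x 1) (x 3) (x 0) (x 3) (x 2) :=
    sum_embedding_congr ![0, 3, 2, 1] (by decide)
      (fun x => Φ (x 0) (x 1) (x 2) (x 3) (x 0) (x 1)) _ fun x =>
        (s2 _ _ _ _ _ _).trans (s3 _ _ _ _ _ _)
  have leaf012304 : ∑ x : Fin 5 ↪ ι, Φ (x 0) (x 1) (x 2) (x 3) (x 0) (x 4) =
      ∑ x : Fin 5 ↪ ι, Φ (x 2) (x 4) (x 0) (x 1) (x 4) (x 3) :=
    sum_embedding_congr ![4, 2, 0, 1, 3] (by decide)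
      (fun x => Φ (x 0) (x 1) (x 2) (x 3) (x 0) (x 4)) _ fun x =>
        s1 _ _ _ _ _ _
  have leaf012310 : ∑ x : Fin 4 ↪ ι, Φ (x 0) (x 1) (x 2) (x 3) (x 1) (x 0) =
      ∑ x : Fin 4 ↪ ι, Φ (x 0) (x 1) (x 3) (x 0) (x 3) (x 2) :=
    sum_embedding_congr ![3, 0, 2, 1] (by decide)
      (fun x => Φ (x 0) (x 1) (x 2) (x 3) (x 1) (x 0)) _ fun x =>
        (s1 _ _ _ _ _ _).trans ((s2 _ _ _ _ _ _).trans (s3 _ _ _ _ _ _))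
  have leaf012314 : ∑ x : Fin 5 ↪ ι, Φ (x 0) (x 1) (x 2) (x 3) (x 1) (x 4) =
      ∑ x : Fin 5 ↪ ι, Φ (x 2) (x 4) (x 0) (x 1) (x 4) (x 3) :=
    sum_embedding_congr ![2, 4, 0, 1, 3] (by decide)
      (fun x => Φ (x 0) (x 1) (x 2) (x 3) (x 1) (x 4)) _ fun x =>
        rfl
  have leaf012324 : ∑ x : Fin 5 ↪ ι, Φ (x 0) (x 1) (x 2) (x 3) (x 2) (x 4) =
      ∑ x : Fin 5 ↪ ι, Φ (x 0) (x 1) (x 4) (x 2) (x 4) (x 3) :=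
    sum_embedding_congr ![0, 1, 4, 2, 3] (by decide)
      (fun x => Φ (x 0) (x 1) (x 2) (x 3) (x 2) (x 4)) _ fun x =>
        rfl
  have leaf012330 : ∑ x : Fin 4 ↪ ι, Φ (x 0) (x 1) (x 2) (x 3) (x 3) (x 0) =
      ∑ x : Fin 4 ↪ ι, Φ (x 0) (x 0) (x 3) (x 1) (x 3) (x 2) :=
    sum_embedding_congr ![3, 1, 2, 0] (by decide)
      (fun x => Φ (x 0) (x 1) (x 2) (x 3) (x 3) (x 0)) _ fun x =>
        (s1 _ _ _ _ _ _).trans (s3 _ _ _ _ _ _)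
  have leaf012331 : ∑ x : Fin 4 ↪ ι, Φ (x 0) (x 1) (x 2) (x 3) (x 3) (x 1) =
      ∑ x : Fin 4 ↪ ι, Φ (x 0) (x 0) (x 3) (x 1) (x 3) (x 2) :=
    sum_embedding_congr ![1, 3, 2, 0] (by decide)
      (fun x => Φ (x 0) (x 1) (x 2) (x 3) (x 3) (x 1)) _ fun x =>
        s3 _ _ _ _ _ _
  have leaf012332 : ∑ x : Fin 4 ↪ ι, Φ (x 0) (x 1) (x 2) (x 3) (x 3) (x 2) =
      ∑ x : Fin 4 ↪ ι, Φ (x 0) (x 0) (x 3) (x 1) (x 2) (x 3) :=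
    sum_embedding_congr ![1, 2, 3, 0] (by decide)
      (fun x => Φ (x 0) (x 1) (x 2) (x 3) (x 3) (x 2)) _ fun x =>
        s3 _ _ _ _ _ _
  have leaf012334 : ∑ x : Fin 5 ↪ ι, Φ (x 0) (x 1) (x 2) (x 3) (x 3) (x 4) =
      ∑ x : Fin 5 ↪ ι, Φ (x 0) (x 0) (x 3) (x 1) (x 2) (x 4) :=
    sum_embedding_congr ![1, 2, 4, 0, 3] (by decide)
      (fun x => Φ (x 0) (x 1) (x 2) (x 3) (x 3) (x 4)) _ fun x =>
        s3 _ _ _ _ _ _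
  have leaf012340 : ∑ x : Fin 5 ↪ ι, Φ (x 0) (x 1) (x 2) (x 3) (x 4) (x 0) =
      ∑ x : Fin 5 ↪ ι, Φ (x 0) (x 1) (x 4) (x 2) (x 4) (x 3) :=
    sum_embedding_congr ![4, 2, 3, 0, 1] (by decide)
      (fun x => Φ (x 0) (x 1) (x 2) (x 3) (x 4) (x 0)) _ fun x =>
        (s1 _ _ _ _ _ _).trans (s3 _ _ _ _ _ _)
  have leaf012341 : ∑ x : Fin 5 ↪ ι, Φ (x 0) (x 1) (x 2) (x 3) (x 4) (x 1) =
      ∑ x : Fin 5 ↪ ι, Φ (x 0) (x 1) (x 4) (x 2) (x 4) (x 3) :=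
    sum_embedding_congr ![2, 4, 3, 0, 1] (by decide)
      (fun x => Φ (x 0) (x 1) (x 2) (x 3) (x 4) (x 1)) _ fun x =>
        s3 _ _ _ _ _ _
  have leaf012342 : ∑ x : Fin 5 ↪ ι, Φ (x 0) (x 1) (x 2) (x 3) (x 4) (x 2) =
      ∑ x : Fin 5 ↪ ι, Φ (x 0) (x 1) (x 4) (x 2) (x 3) (x 4) :=
    sum_embedding_congr ![0, 1, 4, 2, 3] (by decide)
      (fun x => Φ (x 0) (x 1) (x 2) (x 3) (x 4) (x 2)) _ fun x =>
        rfl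
  -- The first `simp only` generates all coincidence patterns, the second discards those excluded by
  -- momentum conservation.
  rw [sum_eq_sum_embedding]
  simp only [sum_embedding_succ, Nat.reduceAdd, Function.Embedding.trans_apply, Fin.coe_castSuccEmb,
    Fin.castSucc_zero, Fin.castSucc_one, castSucc_two, castSucc_three, castSucc_four, Fin.reduceLast,
    Finset.sum_add_distrib, Fin.sum_univ_succ, Finset.univ_unique, Finset.sum_singleton,
    Fin.succ_zero_eq_one, Fin.reduceSucc, Fin.default_eq_zero, Fin.isValue]
  simp only [own1, own2, own3, own4, shared1, shared2, shared3, shared4, twice, legs1, legs2, cycle1,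
    cycle2, cycle3, cycle4, ne_eq, EmbeddingLike.apply_eq_iff_eq, Fin.reduceEq, not_false_eq_true,
    Finset.sum_const_zero, add_zero, zero_add]
  rw [leaf001023, leaf001102, leaf001123, leaf001203, leaf001213, leaf001220, leaf001223,
    leaf001230, leaf001231, leaf001234, leaf012001, leaf012003, leaf012023, leaf012031,
    leaf012034, leaf012102, leaf012110, leaf012113, leaf012123, leaf012130, leaf012134,
    leaf012203, leaf012213, leaf012223, leaf012234, leaf012301, leaf012304, leaf012310,
    leaf012314, leaf012324, leaf012330, leaf012331, leaf012332, leaf012334, leaf012340,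
    leaf012341, leaf012342]
  ring

end Coincidences

section LowOrderSums

variable {ι : Type*} [Fintype ι] [DecidableEq ι] {d : ℕ} {k : ι → Mode d}

theorem sum_bispectrum (h0 : ∀ i, k i ≠ 0) (Φ : ι → ι → ι → ℂ)
    (hΦ : ∀ i j m, Φ i j m ≠ 0 → k i + k j = k m) (s1 : ∀ i j m, Φ i j m = Φ j i m) :
    ∑ i, ∑ j, ∑ m, Φ i j m =
      ∑ x : Fin 2 ↪ ι, Φ (x 0) (x 0) (x 1) + ∑ x : Fin 3 ↪ ι, Φ (x 0) (x 1) (x 2) := by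
  have own1 : ∀ i j, Φ i j i = 0 := by
    intro i j
    by_contra h
    exact h0 j (by linear_combination hΦ _ _ _ h)
  have own2 : ∀ i j, Φ i j j = 0 := fun i j => by rw [s1, own1]
  rw [sum_eq_sum_embedding]
  simp only [sum_embedding_succ, Nat.reduceAdd, Function.Embedding.trans_apply, Fin.coe_castSuccEmb,
    Fin.castSucc_zero, Fin.castSucc_one, Fin.reduceLast,
    Finset.sum_add_distrib, Fin.sum_univ_succ, Finset.univ_unique, Finset.sum_singleton,
    Fin.succ_zero_eq_one, Fin.default_eq_zero, Fin.isValue]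
  simp only [own1, own2, Finset.sum_const_zero, add_zero]
  ring

/-- The sum k_n differs from each summand, as otherwise the other two would add up to zero. So only
the three summands may coincide, a pair among them in 3 ways. -/
theorem sum_trispectrum_three (h2 : ∀ i j, k i + k j ≠ 0) (Φ : ι → ι → ι → ι → ℂ)
    (hΦ : ∀ i j m n, Φ i j m n ≠ 0 → k i + k j + k m = k n)
    (s1 : ∀ i j m n, Φ i j m n = Φ j i m n) (s2 : ∀ i j m n, Φ i j m n = Φ i m j n) :
    ∑ i, ∑ j, ∑ m, ∑ n, Φ i j m n = ∑ x : Fin 2 ↪ ι, Φ (x 0) (x 0) (x 0) (x 1) +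
      3 * ∑ x : Fin 3 ↪ ι, Φ (x 0) (x 0) (x 1) (x 2) +
      ∑ x : Fin 4 ↪ ι, Φ (x 0) (x 1) (x 2) (x 3) := by
  have own1 : ∀ i j m, Φ i j m m = 0 := by
    intro i j m
    by_contra h
    exact h2 i j (by linear_combination hΦ _ _ _ _ h)
  have own2 : ∀ i j m, Φ i j m j = 0 := fun i j m => by rw [s2, own1]
  have own3 : ∀ i j m, Φ i j m i = 0 := fun i j m => by rw [s1, own2]
  have leaf1 : ∑ x : Fin 3 ↪ ι, Φ (x 0) (x 1) (x 0) (x 2) =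
      ∑ x : Fin 3 ↪ ι, Φ (x 0) (x 0) (x 1) (x 2) :=
    Finset.sum_congr rfl fun x _ => s2 _ _ _ _
  have leaf2 : ∑ x : Fin 3 ↪ ι, Φ (x 0) (x 1) (x 1) (x 2) =
      ∑ x : Fin 3 ↪ ι, Φ (x 0) (x 0) (x 1) (x 2) :=
    sum_embedding_congr ![1, 0, 2] (by decide)
      (fun x => Φ (x 0) (x 1) (x 1) (x 2)) _ fun x =>
      (s1 _ _ _ _).trans (s2 _ _ _ _)
  rw [sum_eq_sum_embedding]
  simp only [sum_embedding_succ, Nat.reduceAdd, Function.Embedding.trans_apply, Fin.coe_castSuccEmb,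
    Fin.castSucc_zero, Fin.castSucc_one, castSucc_two, Fin.reduceLast,
    Finset.sum_add_distrib, Fin.sum_univ_succ, Finset.univ_unique, Finset.sum_singleton,
    Fin.succ_zero_eq_one, Fin.reduceSucc, Fin.default_eq_zero, Fin.isValue]
  simp only [own1, own2, own3, Finset.sum_const_zero, add_zero]
  rw [leaf1, leaf2]
  ring

/-- A mode common to both sides forces the pairs to agree, in 2 orders when their members differ.
Otherwise at most one side is a doubled mode, which accounts for the other factor 2. -/
theorem sum_trispectrum_two (hinj : Function.Injective k) (Φ : ι → ι → ι → ι → ℂ)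
    (hΦ : ∀ i j m n, Φ i j m n ≠ 0 → k i + k j = k m + k n)
    (s1 : ∀ i j m n, Φ i j m n = Φ j i m n) (s2 : ∀ i j m n, Φ i j m n = Φ i j n m)
    (s3 : ∀ i j m n, Φ i j m n = Φ m n i j) :
    ∑ i, ∑ j, ∑ m, ∑ n, Φ i j m n = ∑ x : Fin 1 ↪ ι, Φ (x 0) (x 0) (x 0) (x 0) +
      2 * ∑ x : Fin 2 ↪ ι, Φ (x 0) (x 1) (x 0) (x 1) +
      2 * ∑ x : Fin 3 ↪ ι, Φ (x 0) (x 0) (x 1) (x 2) +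
      ∑ x : Fin 4 ↪ ι, Φ (x 0) (x 1) (x 2) (x 3) := by
  have one1 : ∀ i j n, j ≠ n → Φ i j i n = 0 := by
    intro i j n hn
    by_contra h
    exact hn (hinj (by linear_combination hΦ _ _ _ _ h))
  have one2 : ∀ i j n, i ≠ n → Φ i j j n = 0 := fun i j n hn => by rw [s1, one1 _ _ _ hn]
  have one3 : ∀ i j m, j ≠ m → Φ i j m i = 0 := fun i j m hm => by rw [s2, one1 _ _ _ hm]
  have one4 : ∀ i j m, i ≠ m → Φ i j m j = 0 := fun i j m hm => by rw [s2, one2 _ _ _ hm]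
  have twice : ∀ i m, i ≠ m → Φ i i m m = 0 := by
    intro i m hm
    by_contra h
    exact hm (hinj (mode_eq_of_add_self_eq (hΦ _ _ _ _ h)))
  have leaf1 : ∑ x : Fin 2 ↪ ι, Φ (x 0) (x 1) (x 1) (x 0) =
      ∑ x : Fin 2 ↪ ι, Φ (x 0) (x 1) (x 0) (x 1) :=
    Finset.sum_congr rfl fun x _ => s2 _ _ _ _
  have leaf2 : ∑ x : Fin 3 ↪ ι, Φ (x 0) (x 1) (x 2) (x 2) =
      ∑ x : Fin 3 ↪ ι, Φ (x 0) (x 0) (x 1) (x 2) :=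
    sum_embedding_congr ![1, 2, 0] (by decide)
      (fun x => Φ (x 0) (x 1) (x 2) (x 2)) _ fun x =>
      s3 _ _ _ _
  rw [sum_eq_sum_embedding]
  simp only [sum_embedding_succ, Nat.reduceAdd, Function.Embedding.trans_apply, Fin.coe_castSuccEmb,
    Fin.castSucc_zero, Fin.castSucc_one, castSucc_two, Fin.reduceLast,
    Finset.sum_add_distrib, Fin.sum_univ_succ, Finset.univ_unique, Finset.sum_singleton,
    Fin.succ_zero_eq_one, Fin.reduceSucc, Fin.default_eq_zero, Fin.isValue]
  simp only [one1, one2, one3, one4, twice, ne_eq, EmbeddingLike.apply_eq_iff_eq, Fin.reduceEq,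
    not_false_eq_true, zero_ne_one, one_ne_zero, Finset.sum_const_zero, add_zero, zero_add]
  rw [leaf1, leaf2]
  ring

end LowOrderSums

/-! ### Cumulant polynomials of the bispectrum and the trispectrum -/

section CumulantPolynomials

theorem sum_vecCons {κ M : Type*} [Fintype κ] [AddCommMonoid M] {n : ℕ} (F : (Fin (n + 1) → κ) → M) :
    ∑ l, F l = ∑ a, ∑ l : Fin n → κ, F (Matrix.vecCons a l) := by
  rw [← Equiv.sum_comp (Fin.consEquiv fun _ : Fin (n + 1) => κ), Fintype.sum_prod_type]
  rfl

/-- With equal signs excluded, one sign is odd; symmetry moves it from any of its three positions to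
the last. -/
theorem sum_signs_three {ι M : Type*} [Fintype ι] [AddCommMonoid M]
    (F : ι × ℤˣ → ι × ℤˣ → ι × ℤˣ → M) (s1 : ∀ a b c, F a b c = F b a c)
    (s2 : ∀ a b c, F a b c = F a c b) (hup : ∀ i j m, F (up i) (up j) (up m) = 0)
    (hdn : ∀ i j m, F (dn i) (dn j) (dn m) = 0) :
    ∑ a, ∑ b, ∑ c, F a b c =
      3 • ∑ i, ∑ j, ∑ m, (F (up i) (up j) (dn m) + F (dn i) (dn j) (up m)) := by
  have e1 : ∀ s t : ℤˣ, ∑ i, ∑ j, ∑ m, F (i, s) (j, t) (m, s) =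
      ∑ i, ∑ j, ∑ m, F (i, s) (j, s) (m, t) := fun s t =>
    Finset.sum_congr rfl fun i _ => (Finset.sum_congr rfl fun j _ =>
      Finset.sum_congr rfl fun m _ => s2 _ _ _).trans Finset.sum_comm
  have e2 : ∀ s t : ℤˣ, ∑ i, ∑ j, ∑ m, F (i, t) (j, s) (m, s) =
      ∑ i, ∑ j, ∑ m, F (i, s) (j, s) (m, t) := fun s t =>
    (Finset.sum_comm.trans (Finset.sum_congr rfl fun i _ => Finset.sum_congr rfl fun j _ =>
      Finset.sum_congr rfl fun m _ => s1 _ _ _)).trans (e1 s t)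
  simp only [sum_labels, Finset.sum_add_distrib, hup, hdn, Finset.sum_const_zero, zero_add, add_zero]
  rw [e1 1 (-1), e1 (-1) 1, e2 1 (-1), e2 (-1) 1]
  abel

/-- Of the 16 sign patterns, 8 have one odd sign, at 4 positions with 2 orientations, and 6 are
balanced, giving 3 pairs of opposite patterns. Adjacent transpositions bring each to its normal
form. -/
theorem sum_signs_four {ι M : Type*} [Fintype ι] [AddCommMonoid M]
    (F : ι × ℤˣ → ι × ℤˣ → ι × ℤˣ → ι × ℤˣ → M) (s1 : ∀ a b c e, F a b c e = F b a c e)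
    (s2 : ∀ a b c e, F a b c e = F a c b e) (s3 : ∀ a b c e, F a b c e = F a b e c)
    (hup : ∀ i j m n, F (up i) (up j) (up m) (up n) = 0)
    (hdn : ∀ i j m n, F (dn i) (dn j) (dn m) (dn n) = 0) :
    ∑ a, ∑ b, ∑ c, ∑ e, F a b c e =
      4 • ∑ i, ∑ j, ∑ m, ∑ n, (F (up i) (up j) (up m) (dn n) + F (dn i) (dn j) (dn m) (up n)) +
      3 • ∑ i, ∑ j, ∑ m, ∑ n,
        (F (up i) (up j) (dn m) (dn n) + F (dn i) (dn j) (up m) (up n)) := by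
  have e3 : ∀ s t u v : ℤˣ, ∑ i, ∑ j, ∑ m, ∑ n, F (i, s) (j, t) (m, u) (n, v) =
      ∑ i, ∑ j, ∑ m, ∑ n, F (i, s) (j, t) (m, v) (n, u) := fun s t u v =>
    Finset.sum_congr rfl fun i _ => Finset.sum_congr rfl fun j _ =>
      (Finset.sum_congr rfl fun m _ => Finset.sum_congr rfl fun n _ => s3 _ _ _ _).trans
        Finset.sum_comm
  have e2 : ∀ s t u v : ℤˣ, ∑ i, ∑ j, ∑ m, ∑ n, F (i, s) (j, t) (m, u) (n, v) =
      ∑ i, ∑ j, ∑ m, ∑ n, F (i, s) (j, u) (m, t) (n, v) := fun s t u v =>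
    Finset.sum_congr rfl fun i _ => (Finset.sum_congr rfl fun j _ => Finset.sum_congr rfl fun m _ =>
      Finset.sum_congr rfl fun n _ => s2 _ _ _ _).trans Finset.sum_comm
  have e1 : ∀ s t u v : ℤˣ, ∑ i, ∑ j, ∑ m, ∑ n, F (i, s) (j, t) (m, u) (n, v) =
      ∑ i, ∑ j, ∑ m, ∑ n, F (i, t) (j, s) (m, u) (n, v) := fun s t u v =>
    (Finset.sum_congr rfl fun i _ => Finset.sum_congr rfl fun j _ => Finset.sum_congr rfl fun m _ =>
      Finset.sum_congr rfl fun n _ => s1 _ _ _ _).trans Finset.sum_comm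
  simp only [sum_labels, Finset.sum_add_distrib, hup, hdn, Finset.sum_const_zero, zero_add, add_zero]
  rw [e3 1 1 (-1) 1, e2 1 (-1) 1 1, e3 1 1 (-1) 1, e1 (-1) 1 1 1, e2 1 (-1) 1 1, e3 1 1 (-1) 1,
    e3 (-1) (-1) 1 (-1), e2 (-1) 1 (-1) (-1), e3 (-1) (-1) 1 (-1), e1 1 (-1) (-1) (-1),
    e2 (-1) 1 (-1) (-1), e3 (-1) (-1) 1 (-1),
    e2 1 (-1) 1 (-1), e3 1 (-1) (-1) 1, e2 1 (-1) 1 (-1), e1 (-1) 1 1 (-1), e2 1 (-1) 1 (-1),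
    e1 (-1) 1 (-1) 1, e3 1 (-1) (-1) 1, e2 1 (-1) 1 (-1), e2 (-1) (-1) 1 1, e1 (-1) 1 (-1) 1,
    e3 1 (-1) (-1) 1, e2 1 (-1) 1 (-1)]
  abel

variable {d : ℕ} {L : Fin d → ℝ} [∀ i, Fact (0 < L i)] {Ω : Type*} [MeasurableSpace Ω]
  {μ : Measure Ω} [IsProbabilityMeasure μ] {f : Torus L → Ω → ℝ} {ι : Type*} {k : ι → Mode d}

theorem IsModeFamily.add_ne_zero (h : IsModeFamily L μ f k) (i j : ι) : k i + k j ≠ 0 := by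
  obtain ⟨H, hH, hk⟩ := h.upper
  exact fun h0 => hH.zero_notMem (h0 ▸ hH.add_mem _ (hk i) _ (hk j))

theorem IsModeFamily.add_add_ne_zero (h : IsModeFamily L μ f k) (i j m : ι) :
    k i + k j + k m ≠ 0 := by
  obtain ⟨H, hH, hk⟩ := h.upper
  exact fun h0 => hH.zero_notMem (h0 ▸ hH.add_mem _ (hH.add_mem _ (hk i) _ (hk j)) _ (hk m))

theorem IsModeFamily.add_add_add_ne_zero (h : IsModeFamily L μ f k) (i j m n : ι) :
    k i + k j + k m + k n ≠ 0 := by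
  obtain ⟨H, hH, hk⟩ := h.upper
  exact fun h0 => hH.zero_notMem (h0 ▸ hH.add_mem _ (hH.add_mem _ (hH.add_mem _ (hk i) _ (hk j)) _
    (hk m)) _ (hk n))

theorem IsModeFamily.bispectrum_swap (h : IsModeFamily L μ f k) (a b c : ι × ℤˣ) :
    pSpec L μ f k 3 ![a, b, c] = pSpec L μ f k 3 ![b, a, c] := by
  rw [← h.pSpec_perm (Equiv.swap 0 1)]
  congr 1
  funext j
  fin_cases j <;> rfl

theorem IsModeFamily.bispectrum_swap' (h : IsModeFamily L μ f k) (a b c : ι × ℤˣ) :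
    pSpec L μ f k 3 ![a, b, c] = pSpec L μ f k 3 ![a, c, b] := by
  rw [← h.pSpec_perm (Equiv.swap 1 2)]
  congr 1
  funext j
  fin_cases j <;> rfl

theorem IsModeFamily.trispectrum_swap (h : IsModeFamily L μ f k) (a b c e : ι × ℤˣ) :
    pSpec L μ f k 4 ![a, b, c, e] = pSpec L μ f k 4 ![b, a, c, e] := by
  rw [← h.pSpec_perm (Equiv.swap 0 1)]
  congr 1
  funext j
  fin_cases j <;> rfl

theorem IsModeFamily.trispectrum_swap' (h : IsModeFamily L μ f k) (a b c e : ι × ℤˣ) :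
    pSpec L μ f k 4 ![a, b, c, e] = pSpec L μ f k 4 ![a, c, b, e] := by
  rw [← h.pSpec_perm (Equiv.swap 1 2)]
  congr 1
  funext j
  fin_cases j <;> rfl

theorem IsModeFamily.trispectrum_swap'' (h : IsModeFamily L μ f k) (a b c e : ι × ℤˣ) :
    pSpec L μ f k 4 ![a, b, c, e] = pSpec L μ f k 4 ![a, b, e, c] := by
  rw [← h.pSpec_perm (Equiv.swap 2 3)]
  congr 1
  funext j
  fin_cases j <;> rfl

theorem IsReflectionSymmetric.bispectrum (hs : IsReflectionSymmetric L μ f k) (i j m : ι)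
    (s t u : ℤˣ) : pSpec L μ f k 3 ![(i, -s), (j, -t), (m, -u)] =
      pSpec L μ f k 3 ![(i, s), (j, t), (m, u)] := by
  rw [← hs 3 (Or.inl rfl)]
  congr 1
  ext x
  all_goals fin_cases x <;> simp

theorem IsReflectionSymmetric.trispectrum (hs : IsReflectionSymmetric L μ f k) (i j m n : ι)
    (s t u v : ℤˣ) : pSpec L μ f k 4 ![(i, -s), (j, -t), (m, -u), (n, -v)] =
      pSpec L μ f k 4 ![(i, s), (j, t), (m, u), (n, v)] := by
  rw [← hs 4 (Or.inr rfl)]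
  congr 1
  ext x
  all_goals fin_cases x <;> simp

theorem add_eq_of_bispectrum_ne_zero {i j m : ι}
    (hp : pSpec L μ f k 3 ![up i, up j, dn m] ≠ 0) : k i + k j = k m := by
  by_contra h
  refine hp (pSpec_eq_zero _ fun h0 => h ?_)
  simp only [Fin.sum_univ_three, signedMode, Matrix.cons_val, Units.val_one, Units.val_neg, one_smul,
    neg_smul] at h0
  linear_combination h0

theorem IsModeFamily.bispectrum_up (h : IsModeFamily L μ f k) (i j m : ι) :
    pSpec L μ f k 3 ![up i, up j, up m] = 0 := by
  refine pSpec_eq_zero _ fun h0 => h.add_add_ne_zero i j m ?_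
  simpa only [Fin.sum_univ_three, signedMode, Matrix.cons_val, Units.val_one, one_smul] using h0

theorem add_eq_of_trispectrum_ne_zero {i j m n : ι}
    (hp : pSpec L μ f k 4 ![up i, up j, up m, dn n] ≠ 0) : k i + k j + k m = k n := by
  by_contra h
  refine hp (pSpec_eq_zero _ fun h0 => h ?_)
  simp only [Fin.sum_univ_four, signedMode, Matrix.cons_val, Units.val_one, Units.val_neg, one_smul,
    neg_smul] at h0
  linear_combination h0

theorem add_eq_add_of_trispectrum_ne_zero {i j m n : ι}
    (hp : pSpec L μ f k 4 ![up i, up j, dn m, dn n] ≠ 0) : k i + k j = k m + k n := by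
  by_contra h
  refine hp (pSpec_eq_zero _ fun h0 => h ?_)
  simp only [Fin.sum_univ_four, signedMode, Matrix.cons_val, Units.val_one, Units.val_neg, one_smul,
    neg_smul] at h0
  linear_combination h0

theorem IsModeFamily.trispectrum_up (h : IsModeFamily L μ f k) (i j m n : ι) :
    pSpec L μ f k 4 ![up i, up j, up m, up n] = 0 := by
  refine pSpec_eq_zero _ fun h0 => h.add_add_add_ne_zero i j m n ?_
  simpa only [Fin.sum_univ_four, signedMode, Matrix.cons_val, Units.val_one, one_smul] using h0

theorem sum_fin_three {κ M : Type*} [Fintype κ] [AddCommMonoid M] (F : (Fin 3 → κ) → M) :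
    ∑ l, F l = ∑ a, ∑ b, ∑ c, F ![a, b, c] := by
  simp only [sum_vecCons, Finset.univ_unique, Finset.sum_singleton]
  rfl

theorem sum_fin_four {κ M : Type*} [Fintype κ] [AddCommMonoid M] (F : (Fin 4 → κ) → M) :
    ∑ l, F l = ∑ a, ∑ b, ∑ c, ∑ e, F ![a, b, c, e] := by
  simp only [sum_vecCons, Finset.univ_unique, Finset.sum_singleton]
  rfl

variable [Fintype ι]

/-- The binomial `y_i y_j y_{-m} + y_{-i} y_{-j} y_m`. -/
def bispectrumBinomial (i j m : ι) : MvPolynomial (ι × ℤˣ) ℂ :=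
  MvPolynomial.X (up i) * MvPolynomial.X (up j) * MvPolynomial.X (dn m) +
    MvPolynomial.X (dn i) * MvPolynomial.X (dn j) * MvPolynomial.X (up m)

/-- The factor is 3/3!; reflection symmetry gives both orientations the same coefficient, so they
merge into one binomial. -/
theorem IsModeFamily.cumulantPoly_one (h : IsModeFamily L μ f k)
    (hs : IsReflectionSymmetric L μ f k) : cumulantPoly (pSpec L μ f k) 1 =
      (1 / 2 : ℂ) • ∑ i, ∑ j, ∑ m, pSpec L μ f k 3 ![up i, up j, dn m] • bispectrumBinomial i j m := by
  rw [cumulantPoly, if_neg one_ne_zero]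
  simp only [Nat.reduceAdd]
  rw [sum_fin_three]
  simp only [Fin.prod_univ_three, Matrix.cons_val]
  rw [sum_signs_three]
  · have : ∀ i j m : ι, pSpec L μ f k 3 ![dn i, dn j, up m] = pSpec L μ f k 3 ![up i, up j, dn m] :=
      fun i j m => by simpa using hs.bispectrum i j m 1 1 (-1)
    simp only [this, bispectrumBinomial, smul_add]
    rw [← Nat.cast_smul_eq_nsmul ℂ, smul_smul]
    norm_num [Nat.factorial]
  · intro a b c
    rw [h.bispectrum_swap a b c, mul_comm (MvPolynomial.X a)]
  · intro a b c
    rw [h.bispectrum_swap' a b c, mul_right_comm]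
  · intro i j m
    rw [h.bispectrum_up, zero_smul]
  · intro i j m
    have := hs.bispectrum i j m 1 1 1
    rw [h.bispectrum_up] at this
    rw [this, zero_smul]

/-- The binomial `y_i y_j y_m y_{-n} + y_{-i} y_{-j} y_{-m} y_n`. -/
def trispectrumBinomial (i j m n : ι) : MvPolynomial (ι × ℤˣ) ℂ :=
  MvPolynomial.X (up i) * MvPolynomial.X (up j) * MvPolynomial.X (up m) * MvPolynomial.X (dn n) +
    MvPolynomial.X (dn i) * MvPolynomial.X (dn j) * MvPolynomial.X (dn m) * MvPolynomial.X (up n)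

/-- The binomial `y_i y_j y_{-m} y_{-n} + y_{-i} y_{-j} y_m y_n`. -/
def trispectrumBinomial' (i j m n : ι) : MvPolynomial (ι × ℤˣ) ℂ :=
  MvPolynomial.X (up i) * MvPolynomial.X (up j) * MvPolynomial.X (dn m) * MvPolynomial.X (dn n) +
    MvPolynomial.X (dn i) * MvPolynomial.X (dn j) * MvPolynomial.X (up m) * MvPolynomial.X (up n)

/-- The factors are 4/4! and 3/4!, from the sign patterns with one odd sign and the balanced ones.
-/
theorem IsModeFamily.cumulantPoly_two (h : IsModeFamily L μ f k)
    (hs : IsReflectionSymmetric L μ f k) : cumulantPoly (pSpec L μ f k) 2 =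
      (1 / 6 : ℂ) • ∑ i, ∑ j, ∑ m, ∑ n,
        pSpec L μ f k 4 ![up i, up j, up m, dn n] • trispectrumBinomial i j m n +
      (1 / 8 : ℂ) • ∑ i, ∑ j, ∑ m, ∑ n,
        pSpec L μ f k 4 ![up i, up j, dn m, dn n] • trispectrumBinomial' i j m n := by
  rw [cumulantPoly, if_neg two_ne_zero]
  simp only [Nat.reduceAdd]
  rw [sum_fin_four]
  simp only [Fin.prod_univ_four, Matrix.cons_val]
  rw [sum_signs_four]
  · have : ∀ i j m n : ι, pSpec L μ f k 4 ![dn i, dn j, dn m, up n] =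
        pSpec L μ f k 4 ![up i, up j, up m, dn n] :=
      fun i j m n => by simpa using hs.trispectrum i j m n 1 1 1 (-1)
    have h2 : ∀ i j m n : ι, pSpec L μ f k 4 ![dn i, dn j, up m, up n] =
        pSpec L μ f k 4 ![up i, up j, dn m, dn n] :=
      fun i j m n => by simpa using hs.trispectrum i j m n 1 1 (-1) (-1)
    simp only [this, h2, trispectrumBinomial, trispectrumBinomial', ← smul_add]
    rw [← Nat.cast_smul_eq_nsmul ℂ, ← Nat.cast_smul_eq_nsmul ℂ, smul_add, smul_smul, smul_smul]
    norm_num [Nat.factorial]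
  · intro a b c e
    rw [h.trispectrum_swap a b c, mul_comm (MvPolynomial.X a)]
  · intro a b c e
    rw [h.trispectrum_swap' a b c, mul_right_comm (MvPolynomial.X a)]
  · intro a b c e
    rw [h.trispectrum_swap'' a b c, mul_right_comm]
  · intro i j m n
    rw [h.trispectrum_up, zero_smul]
  · intro i j m n
    have := hs.trispectrum i j m n 1 1 1 1
    rw [h.trispectrum_up] at this
    rw [this, zero_smul]

theorem densityPoly_one (p : (N : ℕ) → (Fin N → ι × ℤˣ) → ℂ) :
    densityPoly p 1 = cumulantPoly p 1 := by
  simp [densityPoly, expCoeff, Finset.sum_range_succ, PowerSeries.coeff_one]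

theorem densityPoly_two (p : (N : ℕ) → (Fin N → ι × ℤˣ) → ℂ) :
    densityPoly p 2 = cumulantPoly p 2 + (1 / 2 : ℂ) • (cumulantPoly p 1 * cumulantPoly p 1) := by
  simp [densityPoly, expCoeff, Finset.sum_range_succ, PowerSeries.coeff_one, pow_two,
    PowerSeries.coeff_mul, Finset.Nat.antidiagonal_succ, cumulantPoly_zero]

end CumulantPolynomials

/-! ### Hermite polynomials of low order -/

section LowOrderHermite

variable {ι : Type*} [Fintype ι] [DecidableEq ι]

/-- The Kronecker delta. -/
def kron (i j : ι) : ℂ := if i = j then 1 else 0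

theorem pderiv_X_same_sign (i j : ι) (s : ℤˣ) :
    MvPolynomial.pderiv (i, s) (MvPolynomial.X (j, s) : MvPolynomial (ι × ℤˣ) ℂ) =
      MvPolynomial.C (kron i j) := by
  rw [kron]
  split_ifs with h
  · rw [h, MvPolynomial.pderiv_X_self, map_one]
  · rw [MvPolynomial.pderiv_X_of_ne (by simp [Ne.symm h]), map_zero]

theorem pderiv_up_X_dn (i j : ι) :
    MvPolynomial.pderiv (up i) (MvPolynomial.X (dn j) : MvPolynomial (ι × ℤˣ) ℂ) = 0 :=
  MvPolynomial.pderiv_X_of_ne (by simp)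

theorem pderiv_dn_X_up (i j : ι) :
    MvPolynomial.pderiv (dn i) (MvPolynomial.X (up j) : MvPolynomial (ι × ℤˣ) ℂ) = 0 :=
  MvPolynomial.pderiv_X_of_ne (by simp)

/-- The polynomial `H_{a, b, -i}`, in which `z` and `w` stand for the variables of both halves. -/
def hermite21 (z w : ι → ℂ) (a b i : ι) : ℂ :=
    w a * w b * z i - (kron a i * w b + kron b i * w a)

theorem invFourier_hermite21_up (a b i : ι) (α : ι → ℂ) :
    invFourier (MvPolynomial.X (up a) * MvPolynomial.X (up b) * MvPolynomial.X (dn i)) α =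
      hermite21 α (fun i => conj (α i)) a b i * gaussianDensity α := by
  have h := invFourier_list [up a, up b, dn i] α
  simp only [List.map_cons, List.map_nil, List.prod_cons, List.prod_nil, mul_one, ← mul_assoc] at h
  rw [h]
  simp only [hermPoly, opp, neg_neg, map_sub, map_add, mul_one, Derivation.leibniz, smul_eq_mul,
    pderiv_X_same_sign, pderiv_up_X_dn, pderiv_dn_X_up, MvPolynomial.pderiv_C,
    Derivation.map_one_eq_zero, sub_zero, mul_zero, zero_add, add_zero, polyValue_sub, polyValue_mul,
    polyValue_add, polyValue_X, polyValue_C, signedVar_up, signedVar_dn, hermite21]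
  ring

/-- Reversing all labels exchanges the variables with their conjugates, hence the interchanged
arguments. -/
theorem invFourier_hermite21_dn (a b i : ι) (α : ι → ℂ) :
    invFourier (MvPolynomial.X (dn a) * MvPolynomial.X (dn b) * MvPolynomial.X (up i)) α =
      hermite21 (fun i => conj (α i)) α a b i * gaussianDensity α := by
  have h := invFourier_list [dn a, dn b, up i] α
  simp only [List.map_cons, List.map_nil, List.prod_cons, List.prod_nil, mul_one, ← mul_assoc] at h
  rw [h]
  simp only [hermPoly, opp, neg_neg, map_sub, map_add, mul_one, Derivation.leibniz, smul_eq_mul,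
    pderiv_X_same_sign, pderiv_up_X_dn, pderiv_dn_X_up, MvPolynomial.pderiv_C,
    Derivation.map_one_eq_zero, sub_zero, mul_zero, zero_add, add_zero, polyValue_sub, polyValue_mul,
    polyValue_add, polyValue_X, polyValue_C, signedVar_up, signedVar_dn, hermite21]
  ring

/-- The polynomial `H_{a, b, c, -i}`. -/
def hermite31 (z w : ι → ℂ) (a b c i : ι) : ℂ :=
    w a * w b * w c * z i - (kron a i * w b * w c + kron b i * w a * w c + kron c i * w a * w b)

theorem invFourier_hermite31_up (a b c i : ι) (α : ι → ℂ) :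
    invFourier (MvPolynomial.X (up a) * MvPolynomial.X (up b) * MvPolynomial.X (up c) * MvPolynomial.X
      (dn i)) α =
      hermite31 α (fun i => conj (α i)) a b c i * gaussianDensity α := by
  have h := invFourier_list [up a, up b, up c, dn i] α
  simp only [List.map_cons, List.map_nil, List.prod_cons, List.prod_nil, mul_one, ← mul_assoc] at h
  rw [h]
  simp only [hermPoly, opp, neg_neg, map_sub, map_add, mul_one, Derivation.leibniz, smul_eq_mul,
    pderiv_X_same_sign, pderiv_up_X_dn, pderiv_dn_X_up, MvPolynomial.pderiv_C,
    Derivation.map_one_eq_zero, sub_zero, mul_zero, zero_add, add_zero, polyValue_sub, polyValue_mul,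
    polyValue_add, polyValue_X, polyValue_C, signedVar_up, signedVar_dn, hermite31]
  ring

theorem invFourier_hermite31_dn (a b c i : ι) (α : ι → ℂ) :
    invFourier (MvPolynomial.X (dn a) * MvPolynomial.X (dn b) * MvPolynomial.X (dn c) * MvPolynomial.X
      (up i)) α =
      hermite31 (fun i => conj (α i)) α a b c i * gaussianDensity α := by
  have h := invFourier_list [dn a, dn b, dn c, up i] α
  simp only [List.map_cons, List.map_nil, List.prod_cons, List.prod_nil, mul_one, ← mul_assoc] at h
  rw [h]
  simp only [hermPoly, opp, neg_neg, map_sub, map_add, mul_one, Derivation.leibniz, smul_eq_mul,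
    pderiv_X_same_sign, pderiv_up_X_dn, pderiv_dn_X_up, MvPolynomial.pderiv_C,
    Derivation.map_one_eq_zero, sub_zero, mul_zero, zero_add, add_zero, polyValue_sub, polyValue_mul,
    polyValue_add, polyValue_X, polyValue_C, signedVar_up, signedVar_dn, hermite31]
  ring

/-- The polynomial `H_{a, b, -i, -j}`. -/
def hermite22 (z w : ι → ℂ) (a b i j : ι) : ℂ :=
    w a * w b * z i * z j - (kron a i * w b * z j + kron a j * w b * z i + kron b i * w a * z j
      + kron b j * w a * z i) + (kron a i * kron b j + kron a j * kron b i)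

theorem invFourier_hermite22_up (a b i j : ι) (α : ι → ℂ) :
    invFourier (MvPolynomial.X (up a) * MvPolynomial.X (up b) * MvPolynomial.X (dn i) * MvPolynomial.X
      (dn j)) α =
      hermite22 α (fun i => conj (α i)) a b i j * gaussianDensity α := by
  have h := invFourier_list [up a, up b, dn i, dn j] α
  simp only [List.map_cons, List.map_nil, List.prod_cons, List.prod_nil, mul_one, ← mul_assoc] at h
  rw [h]
  simp only [hermPoly, opp, neg_neg, map_sub, map_add, mul_one, Derivation.leibniz, smul_eq_mul,
    pderiv_X_same_sign, pderiv_up_X_dn, pderiv_dn_X_up, MvPolynomial.pderiv_C,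
    Derivation.map_one_eq_zero, sub_zero, mul_zero, zero_add, add_zero, polyValue_sub, polyValue_mul,
    polyValue_add, polyValue_X, polyValue_C, signedVar_up, signedVar_dn, hermite22]
  ring

/-- The polynomial `H_{a, b, c, e, -i, -j}`. -/
def hermite42 (z w : ι → ℂ) (a b c e i j : ι) : ℂ :=
    w a * w b * w c * w e * z i * z j - (kron a i * w b * w c * w e * z j + kron a j * w b * w c
      * w e * z i + kron b i * w a * w c * w e * z j + kron b j * w a * w c * w e * z i + kron c
      i * w a * w b * w e * z j + kron c j * w a * w b * w e * z i + kron e i * w a * w b * w c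
      * z j + kron e j * w a * w b * w c * z i) + (kron a i * kron b j * w c * w e + kron a j *
      kron b i * w c * w e + kron a i * kron c j * w b * w e + kron a j * kron c i * w b * w e +
      kron a i * kron e j * w b * w c + kron a j * kron e i * w b * w c + kron b i * kron c j *
      w a * w e + kron b j * kron c i * w a * w e + kron b i * kron e j * w a * w c + kron b j *
      kron e i * w a * w c + kron c i * kron e j * w a * w b + kron c j * kron e i * w a * w b)

theorem invFourier_hermite42_up (a b c e i j : ι) (α : ι → ℂ) :
    invFourier (MvPolynomial.X (up a) * MvPolynomial.X (up b) * MvPolynomial.X (up c) * MvPolynomial.X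
      (up e) * MvPolynomial.X (dn i) * MvPolynomial.X (dn j)) α =
      hermite42 α (fun i => conj (α i)) a b c e i j * gaussianDensity α := by
  have h := invFourier_list [up a, up b, up c, up e, dn i, dn j] α
  simp only [List.map_cons, List.map_nil, List.prod_cons, List.prod_nil, mul_one, ← mul_assoc] at h
  rw [h]
  simp only [hermPoly, opp, neg_neg, map_sub, map_add, mul_one, Derivation.leibniz, smul_eq_mul,
    pderiv_X_same_sign, pderiv_up_X_dn, pderiv_dn_X_up, MvPolynomial.pderiv_C,
    Derivation.map_one_eq_zero, sub_zero, mul_zero, zero_add, add_zero, polyValue_sub, polyValue_mul,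
    polyValue_add, polyValue_X, polyValue_C, signedVar_up, signedVar_dn, hermite42]
  ring

theorem invFourier_hermite42_dn (a b c e i j : ι) (α : ι → ℂ) :
    invFourier (MvPolynomial.X (dn a) * MvPolynomial.X (dn b) * MvPolynomial.X (dn c) * MvPolynomial.X
      (dn e) * MvPolynomial.X (up i) * MvPolynomial.X (up j)) α =
      hermite42 (fun i => conj (α i)) α a b c e i j * gaussianDensity α := by
  have h := invFourier_list [dn a, dn b, dn c, dn e, up i, up j] α
  simp only [List.map_cons, List.map_nil, List.prod_cons, List.prod_nil, mul_one, ← mul_assoc] at h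
  rw [h]
  simp only [hermPoly, opp, neg_neg, map_sub, map_add, mul_one, Derivation.leibniz, smul_eq_mul,
    pderiv_X_same_sign, pderiv_up_X_dn, pderiv_dn_X_up, MvPolynomial.pderiv_C,
    Derivation.map_one_eq_zero, sub_zero, mul_zero, zero_add, add_zero, polyValue_sub, polyValue_mul,
    polyValue_add, polyValue_X, polyValue_C, signedVar_up, signedVar_dn, hermite42]
  ring

/-- The polynomial `H_{a, b, c, -i, -j, -m}`. -/
def hermite33 (z w : ι → ℂ) (a b c i j m : ι) : ℂ :=
    w a * w b * w c * z i * z j * z m - (kron a i * w b * w c * z j * z m + kron a j * w b * w c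
      * z i * z m + kron a m * w b * w c * z i * z j + kron b i * w a * w c * z j * z m + kron b
      j * w a * w c * z i * z m + kron b m * w a * w c * z i * z j + kron c i * w a * w b * z j
      * z m + kron c j * w a * w b * z i * z m + kron c m * w a * w b * z i * z j) + (kron a i *
      kron b j * w c * z m + kron a i * kron b m * w c * z j + kron a j * kron b i * w c * z m +
      kron a j * kron b m * w c * z i + kron a m * kron b i * w c * z j + kron a m * kron b j *
      w c * z i + kron a i * kron c j * w b * z m + kron a i * kron c m * w b * z j + kron a j *
      kron c i * w b * z m + kron a j * kron c m * w b * z i + kron a m * kron c i * w b * z j +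
      kron a m * kron c j * w b * z i + kron b i * kron c j * w a * z m + kron b i * kron c m *
      w a * z j + kron b j * kron c i * w a * z m + kron b j * kron c m * w a * z i + kron b m *
      kron c i * w a * z j + kron b m * kron c j * w a * z i) - (kron a i * kron b j * kron c m
      + kron a i * kron b m * kron c j + kron a j * kron b i * kron c m + kron a j * kron b m *
      kron c i + kron a m * kron b i * kron c j + kron a m * kron b j * kron c i)

theorem invFourier_hermite33_up (a b c i j m : ι) (α : ι → ℂ) :
    invFourier (MvPolynomial.X (up a) * MvPolynomial.X (up b) * MvPolynomial.X (up c) * MvPolynomial.X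
      (dn i) * MvPolynomial.X (dn j) * MvPolynomial.X (dn m)) α =
      hermite33 α (fun i => conj (α i)) a b c i j m * gaussianDensity α := by
  have h := invFourier_list [up a, up b, up c, dn i, dn j, dn m] α
  simp only [List.map_cons, List.map_nil, List.prod_cons, List.prod_nil, mul_one, ← mul_assoc] at h
  rw [h]
  simp only [hermPoly, opp, neg_neg, map_sub, map_add, mul_one, Derivation.leibniz, smul_eq_mul,
    pderiv_X_same_sign, pderiv_up_X_dn, pderiv_dn_X_up, MvPolynomial.pderiv_C,
    Derivation.map_one_eq_zero, sub_zero, mul_zero, zero_add, add_zero, polyValue_sub, polyValue_mul,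
    polyValue_add, polyValue_X, polyValue_C, signedVar_up, signedVar_dn, hermite33]
  ring

theorem invFourier_bispectrumBinomial (i j m : ι) (α : ι → ℂ) :
    invFourier (bispectrumBinomial i j m) α = (hermite21 α (fun i => conj (α i)) i j m +
      hermite21 (fun i => conj (α i)) α i j m) * gaussianDensity α := by
  rw [bispectrumBinomial, invFourier_add, invFourier_hermite21_up, invFourier_hermite21_dn, add_mul]

theorem invFourier_trispectrumBinomial (i j m n : ι) (α : ι → ℂ) :
    invFourier (trispectrumBinomial i j m n) α = (hermite31 α (fun i => conj (α i)) i j m n +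
      hermite31 (fun i => conj (α i)) α i j m n) * gaussianDensity α := by
  rw [trispectrumBinomial, invFourier_add, invFourier_hermite31_up, invFourier_hermite31_dn, add_mul]

/-- Reversing a balanced monomial only exchanges its two pairs of indices, so no conjugate version
of `hermite22` is needed. -/
theorem invFourier_trispectrumBinomial' (i j m n : ι) (α : ι → ℂ) :
    invFourier (trispectrumBinomial' i j m n) α = (hermite22 α (fun i => conj (α i)) i j m n +
      hermite22 α (fun i => conj (α i)) m n i j) * gaussianDensity α := by
  have h1 : (MvPolynomial.X (dn i) * MvPolynomial.X (dn j) * MvPolynomial.X (up m) *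
      MvPolynomial.X (up n) : MvPolynomial (ι × ℤˣ) ℂ) = MvPolynomial.X (up m) *
        MvPolynomial.X (up n) * MvPolynomial.X (dn i) * MvPolynomial.X (dn j) := by ring
  rw [trispectrumBinomial', invFourier_add, h1, invFourier_hermite22_up, invFourier_hermite22_up,
    add_mul]

theorem invFourier_bispectrumBinomial_mul (i j m a b c : ι) (α : ι → ℂ) :
    invFourier (bispectrumBinomial i j m * bispectrumBinomial a b c) α =
      (hermite42 α (fun i => conj (α i)) i j a b m c +
        hermite33 α (fun i => conj (α i)) i j c m a b +
        hermite33 α (fun i => conj (α i)) m a b i j c +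
        hermite42 (fun i => conj (α i)) α i j a b m c) * gaussianDensity α := by
  have h1 : (bispectrumBinomial i j m * bispectrumBinomial a b c : MvPolynomial (ι × ℤˣ) ℂ) =
      MvPolynomial.X (up i) * MvPolynomial.X (up j) * MvPolynomial.X (up a) *
        MvPolynomial.X (up b) * MvPolynomial.X (dn m) * MvPolynomial.X (dn c) +
      MvPolynomial.X (up i) * MvPolynomial.X (up j) * MvPolynomial.X (up c) *
        MvPolynomial.X (dn m) * MvPolynomial.X (dn a) * MvPolynomial.X (dn b) +
      MvPolynomial.X (up m) * MvPolynomial.X (up a) * MvPolynomial.X (up b) *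
        MvPolynomial.X (dn i) * MvPolynomial.X (dn j) * MvPolynomial.X (dn c) +
      MvPolynomial.X (dn i) * MvPolynomial.X (dn j) * MvPolynomial.X (dn a) *
        MvPolynomial.X (dn b) * MvPolynomial.X (up m) * MvPolynomial.X (up c) := by
    rw [bispectrumBinomial, bispectrumBinomial]
    ring
  rw [h1, invFourier_add, invFourier_add, invFourier_add, invFourier_hermite42_up,
    invFourier_hermite33_up, invFourier_hermite33_up, invFourier_hermite42_dn]
  ring

end LowOrderHermite

/-! ### The first two orders in amplitudes and phases -/

section Phases

/-- The unit complex number with phase `t`. -/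
def phase (t : ℝ) : ℂ := Complex.exp (Complex.I * t)

theorem phase_ne_zero (t : ℝ) : phase t ≠ 0 := Complex.exp_ne_zero _

theorem phase_add (s t : ℝ) : phase (s + t) = phase s * phase t := by
  rw [phase, phase, phase, ← Complex.exp_add]
  push_cast
  ring_nf

theorem phase_sub (s t : ℝ) : phase (s - t) = phase s * (phase t)⁻¹ := by
  rw [phase, phase, phase, ← Complex.exp_neg, ← Complex.exp_add]
  push_cast
  ring_nf

theorem phase_two_mul (t : ℝ) : phase (2 * t) = phase t ^ 2 := by
  rw [two_mul, phase_add, sq]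

theorem phase_three_mul (t : ℝ) : phase (3 * t) = phase t ^ 3 := by
  rw [show 3 * t = t + t + t by ring, phase_add, phase_add]
  ring

/-- With cosines written through phases, the explicit formulas become rational identities that
`field_simp` and `ring` decide. -/
theorem ofReal_cos_eq (t : ℝ) : ((Real.cos t : ℝ) : ℂ) = (phase t + (phase t)⁻¹) / 2 := by
  rw [Complex.ofReal_cos, Complex.cos, phase, ← Complex.exp_neg]
  congr 3 <;> ring_nf

theorem conj_mul_phase (r t : ℝ) : conj ((r : ℂ) * phase t) = r * (phase t)⁻¹ := by
  rw [map_mul, Complex.conj_ofReal, phase, ← Complex.exp_conj, ← Complex.exp_neg]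
  simp

end Phases

section ExplicitOrders

variable {d : ℕ} {L : Fin d → ℝ} [∀ i, Fact (0 < L i)] {Ω : Type*} [MeasurableSpace Ω]
  {μ : Measure Ω} [IsProbabilityMeasure μ] {f : Torus L → Ω → ℝ} {ι : Type*} {k : ι → Mode d}
  [Fintype ι] [DecidableEq ι]

theorem kron_embedding {r : ℕ} (x : Fin r ↪ ι) (a b : Fin r) :
    kron (x a) (x b) = if a = b then 1 else 0 := by
  simp only [kron, EmbeddingLike.apply_eq_iff_eq]

/-- On each coincidence pattern the Kronecker deltas have definite values, so the terms can be
compared as Laurent polynomials in the phases. -/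
theorem IsModeFamily.invFourier_densityPoly_one (h : IsModeFamily L μ f k)
    (hs : IsReflectionSymmetric L μ f k) {A θ : ι → ℝ} {α : ι → ℂ}
    (hα : ∀ i, α i = A i * phase (θ i)) :
    invFourier (densityPoly (pSpec L μ f k) 1) α =
      firstOrder (pSpec L μ f k) A θ * gaussianDensity α := by
  rw [densityPoly_one, h.cumulantPoly_one hs]
  simp only [invFourier_smul, invFourier_sum, Finset.mul_sum]
  rw [sum_bispectrum h.ne_zero]
  · rw [firstOrder, Fin.sum_univ_two, Q1, add_mul]
    simp only [Matrix.cons_val, Finset.sum_mul]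
    congr 1 <;> refine Finset.sum_congr rfl fun x _ => ?_
    all_goals
      rw [invFourier_bispectrumBinomial]
      simp only [hermite21, kron_embedding, Fin.isValue, Fin.reduceEq, zero_ne_one, one_ne_zero,
        ↓reduceIte, hα, conj_mul_phase, Complex.ofReal_mul, Complex.ofReal_pow, ofReal_cos_eq,
        phase_add, phase_sub, phase_two_mul]
      field_simp [phase_ne_zero]
      ring
  · intro i j m hne
    exact add_eq_of_bispectrum_ne_zero (left_ne_zero_of_mul (right_ne_zero_of_mul hne))
  · intro i j m
    rw [h.bispectrum_swap, show bispectrumBinomial i j m = bispectrumBinomial j i m by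
      simp only [bispectrumBinomial]; ring]

theorem bispectrumBinomial_swap (i j m : ι) :
    (bispectrumBinomial i j m : MvPolynomial (ι × ℤˣ) ℂ) = bispectrumBinomial j i m := by
  simp only [bispectrumBinomial]
  ring

theorem IsModeFamily.invFourier_cumulantPoly_sq (h : IsModeFamily L μ f k)
    (hs : IsReflectionSymmetric L μ f k) (α : ι → ℂ) :
    invFourier ((1 / 2 : ℂ) • (cumulantPoly (pSpec L μ f k) 1 * cumulantPoly (pSpec L μ f k) 1)) α =
      ∑ i, ∑ j, ∑ m, ∑ a, ∑ b, ∑ c, 1 / 8 * (pSpec L μ f k 3 ![up i, up j, dn m] *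
        (pSpec L μ f k 3 ![up a, up b, dn c] *
          invFourier (bispectrumBinomial i j m * bispectrumBinomial a b c) α)) := by
  rw [h.cumulantPoly_one hs, smul_mul_smul_comm, smul_smul]
  simp only [Finset.sum_mul]
  simp only [Finset.mul_sum, smul_mul_smul_comm, invFourier_smul, invFourier_sum]
  norm_num [mul_assoc]

set_option maxHeartbeats 1000000 in
theorem IsModeFamily.invFourier_cumulantPoly_sq_eq (h : IsModeFamily L μ f k)
    (hs : IsReflectionSymmetric L μ f k) {A θ : ι → ℝ} {α : ι → ℂ}
    (hα : ∀ i, α i = A i * phase (θ i)) :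
    invFourier ((1 / 2 : ℂ) • (cumulantPoly (pSpec L μ f k) 1 * cumulantPoly (pSpec L μ f k) 1)) α =
      (∑ i, Q2bi (pSpec L μ f k) A θ i) * gaussianDensity α := by
  -- The listed terms carry their signs in various positions. These three identities bring every
  -- bispectrum to the form with two positive modes followed by a negative one; `e3` needs
  -- reflection symmetry.
  have e1 : ∀ i j m : ι, pSpec L μ f k 3 ![up i, dn j, up m] = pSpec L μ f k 3 ![up i, up m, dn j] :=
    fun i j m => h.bispectrum_swap' _ _ _
  have e2 : ∀ i j m : ι, pSpec L μ f k 3 ![dn i, up j, up m] = pSpec L μ f k 3 ![up j, up m, dn i] :=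
    fun i j m => (h.bispectrum_swap _ _ _).trans (h.bispectrum_swap' _ _ _)
  have e3 : ∀ i j m : ι, pSpec L μ f k 3 ![up i, dn j, dn m] = pSpec L μ f k 3 ![up j, up m, dn i] :=
    fun i j m => (hs.bispectrum i j m (-1) 1 1).trans (e2 i j m)
  rw [h.invFourier_cumulantPoly_sq hs, sum_bispectrum_pairs h.injective h.ne_zero h.add_ne_zero]
  · simp only [Q2bi, Fin.sum_univ_succ, Finset.univ_unique, Finset.sum_singleton, Fin.default_eq_zero,
      Matrix.cons_val_zero, Matrix.cons_val_succ, e1, e2, e3, ← add_assoc, add_mul, Finset.sum_mul,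
      Finset.mul_sum]
    -- The fifteen pattern sums match the fifteen terms of `Q2bi` one by one.
    repeat' refine congrArg₂ (· + ·) ?_ ?_
    all_goals
      refine Finset.sum_congr rfl fun x _ => ?_
      rw [invFourier_bispectrumBinomial_mul]
      simp only [hermite42, hermite33, kron_embedding, Fin.isValue, Fin.reduceEq, zero_ne_one,
        one_ne_zero, ↓reduceIte, zero_mul, one_mul, add_zero, zero_add, sub_zero, hα, conj_mul_phase,
        Complex.ofReal_mul, Complex.ofReal_pow, Complex.ofReal_sub, Complex.ofReal_add,
        Complex.ofReal_div, Complex.ofReal_one, Complex.ofReal_ofNat, ofReal_cos_eq, phase_add,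
        phase_sub, phase_two_mul, phase_three_mul]
      field_simp [phase_ne_zero]
      ring
  · intro i j m a b c hne
    have h1 := right_ne_zero_of_mul hne
    exact ⟨add_eq_of_bispectrum_ne_zero (left_ne_zero_of_mul h1),
      add_eq_of_bispectrum_ne_zero (left_ne_zero_of_mul (right_ne_zero_of_mul h1))⟩
  · intro i j m a b c
    rw [h.bispectrum_swap, bispectrumBinomial_swap]
  · intro i j m a b c
    rw [h.bispectrum_swap (up a), bispectrumBinomial_swap a]
  · intro i j m a b c
    rw [mul_comm (bispectrumBinomial i j m)]
    ring

end ExplicitOrders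

section Trispectrum

variable {d : ℕ} {L : Fin d → ℝ} [∀ i, Fact (0 < L i)] {Ω : Type*} [MeasurableSpace Ω]
  {μ : Measure Ω} [IsProbabilityMeasure μ] {f : Torus L → Ω → ℝ} {ι : Type*} {k : ι → Mode d}
  [Fintype ι] [DecidableEq ι]

/-- The zero-based positions 2, 3, 5 are 𝒬^{(2)}_3, 𝒬^{(2)}_4, 𝒬^{(2)}_6, the terms with three modes
balanced by one; the other four terms are the balanced ones, treated below. -/
theorem IsModeFamily.sum_trispectrumBinomial (h : IsModeFamily L μ f k) {A θ : ι → ℝ} {α : ι → ℂ}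
    (hα : ∀ i, α i = A i * phase (θ i)) :
    ∑ i, ∑ j, ∑ m, ∑ n, 1 / 6 * (pSpec L μ f k 4 ![up i, up j, up m, dn n] *
      invFourier (trispectrumBinomial i j m n) α) =
      (Q2tri (pSpec L μ f k) A θ 2 + Q2tri (pSpec L μ f k) A θ 3 + Q2tri (pSpec L μ f k) A θ 5) *
        gaussianDensity α := by
  rw [sum_trispectrum_three h.add_ne_zero]
  · simp only [Q2tri, Matrix.cons_val, add_mul, Finset.sum_mul, Finset.mul_sum]
    repeat' refine congrArg₂ (· + ·) ?_ ?_
    all_goals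
      refine Finset.sum_congr rfl fun x _ => ?_
      rw [invFourier_trispectrumBinomial]
      simp only [hermite31, kron_embedding, Fin.isValue, Fin.reduceEq, zero_ne_one,
        one_ne_zero, ↓reduceIte, zero_mul, one_mul, add_zero, zero_add, sub_zero, hα, conj_mul_phase,
        Complex.ofReal_mul, Complex.ofReal_pow, Complex.ofReal_sub, Complex.ofReal_add,
        Complex.ofReal_div, Complex.ofReal_one, Complex.ofReal_ofNat, ofReal_cos_eq, phase_add,
        phase_sub, phase_two_mul, phase_three_mul]
      field_simp [phase_ne_zero]
      ring
  · intro i j m n hne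
    exact add_eq_of_trispectrum_ne_zero (left_ne_zero_of_mul (right_ne_zero_of_mul hne))
  · intro i j m n
    rw [h.trispectrum_swap, trispectrumBinomial, trispectrumBinomial,
      mul_comm (MvPolynomial.X (up i)), mul_comm (MvPolynomial.X (dn i))]
  · intro i j m n
    rw [h.trispectrum_swap', trispectrumBinomial, trispectrumBinomial,
      mul_right_comm (MvPolynomial.X (up i)), mul_right_comm (MvPolynomial.X (dn i))]

/-- Reflection reverses the signs and symmetry restores the order. This supplies the exchange of
sides required by `sum_trispectrum_two`. -/
theorem IsModeFamily.trispectrum_reflect (h : IsModeFamily L μ f k)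
    (hs : IsReflectionSymmetric L μ f k) (i j m n : ι) :
    pSpec L μ f k 4 ![up i, up j, dn m, dn n] = pSpec L μ f k 4 ![up m, up n, dn i, dn j] := by
  have h1 := hs.trispectrum m n i j 1 1 (-1) (-1)
  rw [neg_neg] at h1
  rw [← h1, h.trispectrum_swap' (up i), h.trispectrum_swap (up i), h.trispectrum_swap'' (dn m),
    h.trispectrum_swap' (dn m) (up i)]

theorem IsModeFamily.sum_trispectrumBinomial' (h : IsModeFamily L μ f k)
    (hs : IsReflectionSymmetric L μ f k) {A θ : ι → ℝ} {α : ι → ℂ}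
    (hα : ∀ i, α i = A i * phase (θ i)) :
    ∑ i, ∑ j, ∑ m, ∑ n, 1 / 8 * (pSpec L μ f k 4 ![up i, up j, dn m, dn n] *
      invFourier (trispectrumBinomial' i j m n) α) =
      (Q2tri (pSpec L μ f k) A θ 0 + Q2tri (pSpec L μ f k) A θ 1 + Q2tri (pSpec L μ f k) A θ 4 +
        Q2tri (pSpec L μ f k) A θ 6) * gaussianDensity α := by
  rw [sum_trispectrum_two h.injective]
  · simp only [Q2tri, Matrix.cons_val, add_mul, Finset.sum_mul, Finset.mul_sum]
    repeat' refine congrArg₂ (· + ·) ?_ ?_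
    all_goals
      refine Finset.sum_congr rfl fun x _ => ?_
      rw [invFourier_trispectrumBinomial']
      simp only [hermite22, kron_embedding, Fin.isValue, Fin.reduceEq, zero_ne_one,
        one_ne_zero, ↓reduceIte, zero_mul, one_mul, add_zero, zero_add, sub_zero, hα, conj_mul_phase,
        Complex.ofReal_mul, Complex.ofReal_pow, Complex.ofReal_sub, Complex.ofReal_add,
        Complex.ofReal_div, Complex.ofReal_one, Complex.ofReal_ofNat, ofReal_cos_eq, phase_add,
        phase_sub, phase_two_mul, phase_three_mul]
      field_simp [phase_ne_zero]
      ring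
  · intro i j m n hne
    exact add_eq_add_of_trispectrum_ne_zero (left_ne_zero_of_mul (right_ne_zero_of_mul hne))
  · intro i j m n
    rw [h.trispectrum_swap, trispectrumBinomial', trispectrumBinomial',
      mul_comm (MvPolynomial.X (up i)), mul_comm (MvPolynomial.X (dn i))]
  · intro i j m n
    rw [h.trispectrum_swap'', trispectrumBinomial', trispectrumBinomial',
      mul_right_comm _ (MvPolynomial.X (dn m)), mul_right_comm _ (MvPolynomial.X (up m))]
  · intro i j m n
    have h2 : (trispectrumBinomial' i j m n : MvPolynomial (ι × ℤˣ) ℂ) =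
        trispectrumBinomial' m n i j := by
      rw [trispectrumBinomial', trispectrumBinomial']
      ring
    rw [h.trispectrum_reflect hs, h2]

theorem IsModeFamily.invFourier_densityPoly_two (h : IsModeFamily L μ f k)
    (hs : IsReflectionSymmetric L μ f k) {A θ : ι → ℝ} {α : ι → ℂ}
    (hα : ∀ i, α i = A i * phase (θ i)) :
    invFourier (densityPoly (pSpec L μ f k) 2) α =
      secondOrder (pSpec L μ f k) A θ * gaussianDensity α := by
  rw [densityPoly_two, invFourier_add, h.invFourier_cumulantPoly_sq_eq hs hα, h.cumulantPoly_two hs]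
  simp only [invFourier_add, invFourier_smul, invFourier_sum, Finset.mul_sum]
  rw [h.sum_trispectrumBinomial hα, h.sum_trispectrumBinomial' hs hα, secondOrder,
    Fin.sum_univ_seven (Q2tri (pSpec L μ f k) A θ)]
  ring

end Trispectrum

/-! ### The remainder -/

section Remainder

variable {ι : Type*} [Fintype ι] [DecidableEq ι]

/-- The derivative must be nonzero because `totalDegree 0 = 0`, so the strict inequality would fail
for constants. -/
theorem totalDegree_pderiv_lt {σ : Type*} (l : σ) (q : MvPolynomial σ ℂ)
    (hq : MvPolynomial.pderiv l q ≠ 0) :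
    (MvPolynomial.pderiv l q).totalDegree < q.totalDegree := by
  have h0 : q.totalDegree ≠ 0 := by
    intro h0
    rw [MvPolynomial.totalDegree_eq_zero_iff_eq_C] at h0
    rw [h0, MvPolynomial.pderiv_C] at hq
    exact hq rfl
  suffices h : (MvPolynomial.pderiv l q).totalDegree ≤ q.totalDegree - 1 by omega
  conv_lhs => rw [q.as_sum, map_sum]
  refine MvPolynomial.totalDegree_finsetSum_le fun s hs => ?_
  rw [MvPolynomial.pderiv_monomial]
  by_cases hsl : s l = 0
  · simp [hsl]
  · refine (MvPolynomial.totalDegree_monomial_le _ _).trans ?_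
    have h1 := MvPolynomial.le_totalDegree hs
    have h2 : s - Finsupp.single l 1 + Finsupp.single l 1 = s :=
      tsub_add_cancel_of_le (Finsupp.single_le_iff.2 (Nat.one_le_iff_ne_zero.2 hsl))
    have h3 : (s.sum fun _ e => e) = ((s - Finsupp.single l 1).sum fun _ => id) + 1 := by
      conv_lhs => rw [← h2]
      rw [Finsupp.sum_add_index' (fun _ => rfl) (fun _ _ _ => rfl), Finsupp.sum_single_index rfl]
      rfl
    omega

/-- Integration by parts turns each symbol into a derivative of `q`, and more than deg q derivatives
annihilate it. This is the orthogonality of Hermite polynomials to lower degrees. -/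
theorem integral_polyValue_mul_invFourier_list_eq_zero (s : List (ι × ℤˣ))
    (q : MvPolynomial (ι × ℤˣ) ℂ) (hs : q.totalDegree < s.length) :
    ∫ α, polyValue q α * invFourier (s.map MvPolynomial.X).prod α = 0 := by
  induction s generalizing q with
  | nil => simp at hs
  | cons l s ih =>
    rw [List.map_cons, List.prod_cons, integral_polyValue_mul_invFourier_X_mul]
    by_cases h : MvPolynomial.pderiv l q = 0
    · simp [h]
    · refine ih _ ?_
      have := totalDegree_pderiv_lt l q h
      rw [List.length_cons] at hs
      omega

end Remainder

section Bound

variable {ι : Type*} [Fintype ι] [DecidableEq ι]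

/-- Integration of a polynomial against inverse Fourier transforms. -/
def invFourierMoment (q : MvPolynomial (ι × ℤˣ) ℂ) : MvPolynomial (ι × ℤˣ) ℂ →ₗ[ℂ] ℂ where
  toFun g := ∫ α, polyValue q α * invFourier g α
  map_add' g g' := by
    simp only [invFourier_add, mul_add]
    exact integral_add (integrable_polyValue_mul_invFourier _ _)
      (integrable_polyValue_mul_invFourier _ _)
  map_smul' c g := by
    simp only [invFourier_smul, mul_left_comm _ c, integral_const_mul, RingHom.id_apply, smul_eq_mul]

/-- The moment is a polynomial in the values of `p` with coefficients fixed by `q`, so bounds on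
those values suffice. Products of total order above deg q drop out, and in the others every factor
has order at most deg q; this is why no higher polyspectra need be bounded. -/
theorem exists_bound_invFourierMoment (q : MvPolynomial (ι × ℤˣ) ℂ) (B : ℝ) (n : ℕ) (hn : 1 ≤ n) :
    ∃ C : ℝ, 0 ≤ C ∧ ∀ p : (N : ℕ) → (Fin N → ι × ℤˣ) → ℂ,
      (∀ N : ℕ, 3 ≤ N → N ≤ q.totalDegree → ∀ l, ‖p N l‖ ≤ B) →
        ‖invFourierMoment q (densityPoly p n)‖ ≤ C := by
  refine ⟨∑ m ∈ Finset.Icc 1 n, ‖((m.factorial : ℂ))⁻¹‖ *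
    ∑ ν ∈ (Fintype.piFinset fun _ : Fin m => Finset.Icc 1 n) with ∑ j, ν j = n,
      ‖∏ j, (((ν j + 2).factorial : ℂ))⁻¹‖ * ∑ l : (j : Fin m) → Fin (ν j + 2) → ι × ℤˣ,
        |B| ^ m * ‖invFourierMoment q
          ((List.ofFn fun j => List.ofFn (l j)).flatten.map MvPolynomial.X).prod‖,
    by positivity, fun p hp => ?_⟩
  rw [densityPoly_eq p hn]
  simp only [map_sum, map_smul, smul_eq_mul]
  refine norm_sum_le_of_le _ fun m _ => ?_
  rw [norm_mul]
  refine mul_le_mul_of_nonneg_left (norm_sum_le_of_le _ fun ν hν => ?_) (norm_nonneg _)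
  rw [norm_mul]
  refine mul_le_mul_of_nonneg_left (norm_sum_le_of_le _ fun l _ => ?_) (norm_nonneg _)
  rw [norm_mul]
  have hlen : (List.ofFn fun j => List.ofFn (l j)).flatten.length = ∑ j, (ν j + 2) := by
    rw [List.length_flatten, List.map_ofFn, List.sum_ofFn]
    simp
  by_cases hdeg : q.totalDegree < ∑ j, (ν j + 2)
  · have h0 : invFourierMoment q
        ((List.ofFn fun j => List.ofFn (l j)).flatten.map MvPolynomial.X).prod = 0 :=
      integral_polyValue_mul_invFourier_list_eq_zero _ q (hlen ▸ hdeg)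
    rw [h0, norm_zero, mul_zero, mul_zero]
  · refine mul_le_mul_of_nonneg_right ?_ (norm_nonneg _)
    rw [norm_prod]
    refine (Finset.prod_le_prod (fun j _ => norm_nonneg _) fun j _ => ?_).trans_eq
      (by rw [Finset.prod_const, Finset.card_univ, Fintype.card_fin])
    have hj := Fintype.mem_piFinset.1 (Finset.mem_filter.1 hν).1 j
    rw [Finset.mem_Icc] at hj
    refine (hp _ (by omega) ?_ _).trans (le_abs_self B)
    exact (Finset.single_le_sum (f := fun j => ν j + 2) (fun _ _ => Nat.zero_le _)
      (Finset.mem_univ j)).trans (not_lt.1 hdeg)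

end Bound

/-! ### Comparison with the explicit expansion through order 1/V -/

section Expansion

variable {d : ℕ} {L : Fin d → ℝ} [∀ i, Fact (0 < L i)] {Ω : Type*} [MeasurableSpace Ω]
  {μ : Measure Ω} [IsProbabilityMeasure μ] {f : Torus L → Ω → ℝ} {ι : Type*} {k : ι → Mode d}
  [Fintype ι] [DecidableEq ι]

theorem eq_norm_mul_phase_arg (z : ℂ) : z = ‖z‖ * phase z.arg := by
  rw [phase, mul_comm Complex.I, Complex.norm_mul_exp_arg_mul_I]

theorem sq_inv_sqrt_boxVolume (L : Fin d → ℝ) [∀ i, Fact (0 < L i)] :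
    ((√(boxVolume L) : ℝ) : ℂ)⁻¹ ^ 2 = ((boxVolume L : ℝ) : ℂ)⁻¹ := by
  rw [inv_pow, ← Complex.ofReal_pow, Real.sq_sqrt (boxVolume_pos L).le]

theorem IsModeFamily.explicit_eq (h : IsModeFamily L μ f k) (hs : IsReflectionSymmetric L μ f k)
    (q : MvPolynomial (ι × ℤˣ) ℂ) (α : ι → ℂ) :
    polyValue q α * ((1 + ((√(boxVolume L) : ℝ) : ℂ)⁻¹ *
        firstOrder (pSpec L μ f k) (fun i => ‖α i‖) (fun i => (α i).arg) +
      ((boxVolume L : ℝ) : ℂ)⁻¹ *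
        secondOrder (pSpec L μ f k) (fun i => ‖α i‖) (fun i => (α i).arg)) * gaussianDensity α) =
      ∑ n ∈ Finset.range 3, ((√(boxVolume L) : ℝ) : ℂ)⁻¹ ^ n *
        (polyValue q α * invFourier (densityPoly (pSpec L μ f k) n) α) := by
  have hα : ∀ i, α i = ‖α i‖ * phase (α i).arg := fun i => eq_norm_mul_phase_arg _
  rw [Finset.sum_range_succ, Finset.sum_range_succ, Finset.sum_range_one,
    h.invFourier_densityPoly_one hs hα, h.invFourier_densityPoly_two hs hα, densityPoly_zero,
    invFourier_one, sq_inv_sqrt_boxVolume]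
  ring

theorem norm_inv_sqrt_boxVolume_pow_le (hV : 1 ≤ boxVolume L) {n : ℕ} (hn : 3 ≤ n) :
    ‖((√(boxVolume L) : ℝ) : ℂ)⁻¹ ^ n‖ ≤ boxVolume L ^ (-(3 / 2) : ℝ) := by
  have h1 : (boxVolume L) ^ (-(3 / 2) : ℝ) = (√(boxVolume L))⁻¹ ^ 3 := by
    rw [Real.sqrt_eq_rpow, ← Real.rpow_neg (boxVolume_pos L).le, ← Real.rpow_natCast,
      ← Real.rpow_mul (boxVolume_pos L).le]
    norm_num
  rw [h1, norm_pow, norm_inv, Complex.norm_real, Real.norm_of_nonneg (Real.sqrt_nonneg _)]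
  exact pow_le_pow_of_le_one (by positivity) (inv_le_one_of_one_le₀ (Real.one_le_sqrt.2 hV)) hn

/-- The range begins at the first omitted order and ends at the last one needed for exactness on
`q`. The constant is independent of `p`. -/
theorem exists_remainder_bound (q : MvPolynomial (ι × ℤˣ) ℂ) (B : ℝ) : ∃ C : ℝ,
    ∀ p : (N : ℕ) → (Fin N → ι × ℤˣ) → ℂ,
      (∀ N : ℕ, 3 ≤ N → N ≤ q.totalDegree → ∀ l, ‖p N l‖ ≤ B) →
        ∑ n ∈ Finset.Ico 3 (max q.totalDegree 2 + 1), ‖invFourierMoment q (densityPoly p n)‖ ≤ C := by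
  choose! C _ hC using fun n (hn : 1 ≤ n) => exists_bound_invFourierMoment q B n hn
  refine ⟨∑ n ∈ Finset.Ico 3 (max q.totalDegree 2 + 1), C n, fun p hp =>
    Finset.sum_le_sum fun n hn => hC n ?_ p hp⟩
  have := (Finset.mem_Ico.1 hn).1
  omega

theorem IsModeFamily.integrable_explicit (h : IsModeFamily L μ f k)
    (hs : IsReflectionSymmetric L μ f k) (q : MvPolynomial (ι × ℤˣ) ℂ) :
    Integrable fun α : ι → ℂ => polyValue q α * ((1 + ((√(boxVolume L) : ℝ) : ℂ)⁻¹ *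
        firstOrder (pSpec L μ f k) (fun i => ‖α i‖) (fun i => (α i).arg) +
      ((boxVolume L : ℝ) : ℂ)⁻¹ *
        secondOrder (pSpec L μ f k) (fun i => ‖α i‖) (fun i => (α i).arg)) * gaussianDensity α) := by
  simp only [h.explicit_eq hs]
  exact integrable_finsetSum _ fun n _ => (integrable_polyValue_mul_invFourier _ _).const_mul _

theorem IsModeFamily.norm_sub_integral_explicit_le (h : IsModeFamily L μ f k)
    (hs : IsReflectionSymmetric L μ f k) (q : MvPolynomial (ι × ℤˣ) ℂ) (hV : 1 ≤ boxVolume L) :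
    ‖∫ ω, polyValue q (modeVector L μ f k ω) ∂μ -
        ∫ α : ι → ℂ, polyValue q α * ((1 + ((√(boxVolume L) : ℝ) : ℂ)⁻¹ *
            firstOrder (pSpec L μ f k) (fun i => ‖α i‖) (fun i => (α i).arg) +
          ((boxVolume L : ℝ) : ℂ)⁻¹ *
            secondOrder (pSpec L μ f k) (fun i => ‖α i‖) (fun i => (α i).arg)) *
              gaussianDensity α)‖ ≤
      (∑ n ∈ Finset.Ico 3 (max q.totalDegree 2 + 1),
        ‖invFourierMoment q (densityPoly (pSpec L μ f k) n)‖) * boxVolume L ^ (-(3 / 2) : ℝ) := by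
  -- The maximum with 2 keeps the three explicit orders in the sum even when deg q < 2, so that they
  -- cancel exactly.
  rw [← h.moment_apply, h.moment_eq_sum q (le_max_left _ 2)]
  simp only [h.explicit_eq hs]
  rw [integral_finsetSum _ fun n _ => (integrable_polyValue_mul_invFourier _ _).const_mul _]
  simp only [integral_const_mul]
  rw [← Finset.sum_range_add_sum_Ico _ (show 3 ≤ max q.totalDegree 2 + 1 by omega),
    add_sub_cancel_left, Finset.sum_mul]
  refine norm_sum_le_of_le _ fun n hn => ?_
  rw [norm_mul, mul_comm]
  exact mul_le_mul_of_nonneg_left (norm_inv_sqrt_boxVolume_pow_le hV (Finset.mem_Ico.1 hn).1)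
    (norm_nonneg _)

end Expansion

end FourierModes

end

theorem mainTheorem4 {ι : Type*} [Fintype ι] [DecidableEq ι] {d : ℕ} :
    -- for every field and every finite family of modes: the formal expansion
    (∀ (L : Fin d → ℝ) [∀ i, Fact (0 < L i)] {Ω : Type*} [MeasurableSpace Ω]
      (μ : Measure Ω) [IsProbabilityMeasure μ] (f : Torus L → Ω → ℝ) (k : ι → Mode d),
      IsModeFamily L μ f k →
      -- the inverse Fourier integrals that define the formal density converge absolutely
      (∀ (n : ℕ) (α : ι → ℂ), Integrable fun J : ι → ℂ =>
        Complex.exp (Complex.I * pairing J α) * PowerSeries.coeff n (formalCharFun L μ f k J)) ∧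
      -- the expansion to all orders
      (∀ α : ι → ℂ, PowerSeries.coeff 0 (formalDensity L μ f k α) = gaussianDensity α) ∧
      (∀ (n : ℕ) (α : ι → ℂ), 1 ≤ n → PowerSeries.coeff n (formalDensity L μ f k α) =
        expansionCoeff (pSpec L μ f k) n α * gaussianDensity α) ∧
      -- it represents the joint law of the modes: all expectations of polynomials are finite sums
      (∀ q : MvPolynomial (ι × ℤˣ) ℂ,
        Integrable (fun ω => polyValue q (modeVector L μ f k ω)) μ ∧
        (∀ n : ℕ, Integrable fun α : ι → ℂ =>
          polyValue q α * PowerSeries.coeff n (formalDensity L μ f k α)) ∧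
        ∀ M : ℕ, q.totalDegree ≤ M →
          ∫ ω, polyValue q (modeVector L μ f k ω) ∂μ =
            ∑ n ∈ Finset.range (M + 1), ((√(boxVolume L) : ℝ) : ℂ)⁻¹ ^ n *
              ∫ α : ι → ℂ, polyValue q α * PowerSeries.coeff n (formalDensity L μ f k α)) ∧
      -- the first two orders in amplitudes and phases, as sums over different modes
      (IsReflectionSymmetric L μ f k → ∀ A θ : ι → ℝ, (∀ i, 0 ≤ A i) →
        ∀ α : ι → ℂ, (∀ i, α i = A i * Complex.exp (Complex.I * θ i)) →
          PowerSeries.coeff 1 (formalDensity L μ f k α) =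
            firstOrder (pSpec L μ f k) A θ * gaussianDensity α ∧
          PowerSeries.coeff 2 (formalDensity L μ f k α) =
            secondOrder (pSpec L μ f k) A θ * gaussianDensity α)) ∧
    -- the remainder is of order `V^{-3/2}`, uniformly as long as the polyspectra stay bounded
    (∀ (q : MvPolynomial (ι × ℤˣ) ℂ) (B : ℝ), ∃ C : ℝ,
      ∀ (L : Fin d → ℝ) [∀ i, Fact (0 < L i)] {Ω : Type*} [MeasurableSpace Ω]
        (μ : Measure Ω) [IsProbabilityMeasure μ] (f : Torus L → Ω → ℝ) (k : ι → Mode d),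
        IsModeFamily L μ f k → IsReflectionSymmetric L μ f k →
        (∀ N : ℕ, 3 ≤ N → N ≤ q.totalDegree →
          ∀ l : Fin N → ι × ℤˣ, ‖pSpec L μ f k N l‖ ≤ B) →
        1 ≤ boxVolume L →
        (Integrable fun α : ι → ℂ => polyValue q α *
          ((1 + ((√(boxVolume L) : ℝ) : ℂ)⁻¹ *
              firstOrder (pSpec L μ f k) (fun i => ‖α i‖) (fun i => (α i).arg) +
            ((boxVolume L : ℝ) : ℂ)⁻¹ *
              secondOrder (pSpec L μ f k) (fun i => ‖α i‖) (fun i => (α i).arg)) *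
            gaussianDensity α)) ∧
        ‖∫ ω, polyValue q (modeVector L μ f k ω) ∂μ -
            ∫ α : ι → ℂ, polyValue q α *
              ((1 + ((√(boxVolume L) : ℝ) : ℂ)⁻¹ *
                  firstOrder (pSpec L μ f k) (fun i => ‖α i‖) (fun i => (α i).arg) +
                ((boxVolume L : ℝ) : ℂ)⁻¹ *
                  secondOrder (pSpec L μ f k) (fun i => ‖α i‖) (fun i => (α i).arg)) *
                gaussianDensity α)‖
          ≤ C * boxVolume L ^ (-(3 / 2) : ℝ)) := by
  refine ⟨fun L _ Ω _ μ _ f k h => ⟨h.integrable_formalCharFun, fun α => ?_, fun n α hn => ?_,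
    fun q => ⟨h.integrable_polyValue q, fun n => ?_, fun M hM => ?_⟩,
    fun hs A θ _ α hα => ⟨?_, ?_⟩⟩, fun q B => ?_⟩
  · rw [h.coeff_formalDensity, densityPoly_zero, invFourier_one]
  · rw [h.coeff_formalDensity, expansionCoeff_mul_gaussianDensity _ hn]
  · simp only [h.coeff_formalDensity]
    exact integrable_polyValue_mul_invFourier _ _
  · simp only [h.coeff_formalDensity]
    rw [← h.moment_apply, h.moment_eq_sum q hM]
  · rw [h.coeff_formalDensity, h.invFourier_densityPoly_one hs hα]
  · rw [h.coeff_formalDensity, h.invFourier_densityPoly_two hs hα]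
  -- The constant is fixed before the box, the field and the modes are introduced, which gives the
  -- uniformity.
  · obtain ⟨C, hC⟩ := exists_remainder_bound q B
    refine ⟨C, fun L _ Ω _ μ _ f k h hs hp hV => ⟨h.integrable_explicit hs q,
      (h.norm_sub_integral_explicit_le hs q hV).trans ?_⟩⟩
    exact mul_le_mul_of_nonneg_right (hC _ hp) (Real.rpow_nonneg (boxVolume_pos L).le _)
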